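/- Notation. Let $P\subset\mathbb R^d$ be a full-dimensional polytope and $p\in\mathbb R^d$, $p\neq 0$. For a polytope $Q$ put $h_Q(v)=-\min_{y\in Q}\langle v,y\rangle$, and let $\mathcal N(Q)$ be its normal fan, with cones $C_F=\{v: h_Q(v)=-\langle v,y\rangle\ \forall y\in F\}$ for the nonempty faces $F$ of $Q$; each ray of a fan is represented by its unit vector. For a full-dimensional polytope $Q\subset\mathbb R^d$, the dual volume function is the rational function of $z=(z_1,\dots,z_d)$ $$\mathrm{Vol}^\vee_z(Q)=\sum_{C=\mathrm{cone}(v_1,\dots,v_d)\in\mathcal T}\frac{|\det(v_1,\dots,v_d)|}{\prod_{i=1}^d h_{Q-z}(v_i)},\qquad h_{Q-z}(v)=h_Q(v)+\langle v,z\rangle ,$$ where $\mathcal T$ is any triangulation of $\mathcal N(Q)$ into full-dimensional simplicial cones generated by rays of $\mathcal N(Q)$ (the result does not depend on $\mathcal T$). Let $H=p^\perp$, and let $P_{/p}\subset H$ be the orthogonal projection of $P$. Dual volumes of polytopes in $H\cong\mathbb R^{d-1}$ are defined in the same way, with $|\det(v_1,\dots,v_{d-1},p)|$ in place of $|\det(v_1,\dots,v_d)|$.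 Let $B_+(z)$, $B_0(z)$, $B_-(z)$ be the products of the $h_{P-z}(v)$ over the rays $v$ of $\mathcal N(P)$ with $\langle p,v\rangle>0$, $=0$, $<0$ respectively, and let $D(z)$ be the product of the $h_{P-z}(v)$ over the rays $v$ of $\mathcal N(P+[-p,p])$ that are not rays of $\mathcal N(P)$. Theorem. There is a unique pair of rational functions $W_+,W_-$ in $z$ such that 1. $W_+(z)+W_-(z)=\mathrm{Vol}^\vee_z(P)$; 2. $W_\pm(z)=A_\pm(z)/\big(B_\pm(z)B_0(z)D(z)\big)$ for some polynomials $A_\pm$; 3. $\displaystyle\lim_{t\to\infty}t\,W_\pm(z_0+tp)=\pm\,\mathrm{Vol}^\vee_{z_0}(P_{/p})/\|p\|^2$ for every $z_0\in H$ at which $\mathrm{Vol}^\vee_{z_0}(P_{/p})$ is defined, that is, $h_{P_{/p}-z_0}(v)\ne0$ for every ray $v$ of the normal fan of $P_{/p}$ in $H$. Moreover, let $V(x,z)=\mathrm{Vol}^\vee_z(P+x[-p,p])$, the rational function of $(x,z)$ obtained from a triangulation of $\mathcal N(P+[-p,p])$ and the support function $h_P+x\,h_{[-p,p]}+\langle\cdot,z\rangle$.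 Then $$V(x,z)=W_+(z+xp)+W_-(z-xp)$$ as rational functions of $(x,z)$, and for each real $x\ge0$ the rational function $\mathrm{Vol}^\vee_z(P+x[-p,p])$ of $z$ equals $W_+(z+xp)+W_-(z-xp)$. This gives a deletion–contraction recursion for zonotopes. For polytopes $Q_1,\dots,Q_r$ with full-dimensional sum, let the dual mixed volume function $m_{Q_1,\dots,Q_r}(x_1,\dots,x_r;z)$ be the rational function computed as above from a triangulation of $\mathcal N(Q_1+\dots+Q_r)$ and the support function $\sum_j x_jh_{Q_j}+\langle\cdot,z\rangle$. Suppose that $P=\sum_{j=1}^r a_j[-q_j,q_j]$ with $a_j>0$, $q_j\in\mathbb R^d$. Then, with $W_\pm$ as above and $\bar q_j$ the orthogonal projection of $q_j$ to $H$, one has $W_+(z)+W_-(z)=m_{[-q_1,q_1],\dots,[-q_r,q_r]}(a_1,\dots,a_r;z)$, $P_{/p}=\sum_j a_j[-\bar q_j,\bar q_j]$, and for every real $x>0$ $$m_{[-q_1,q_1],\dots,[-q_r,q_r],[-p,p]}(a_1,\dots,a_r,x;z)=W_+(z+xp)+W_-(z-xp).$$ -/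

import Mathlib

open scoped Pointwise Topology RealInnerProductSpace

noncomputable section

namespace DualVol

/-! ### Polytopes, normal fans, triangulations -/

section Fans

variable {E : Type*} [NormedAddCommGroup E] [InnerProductSpace ℝ E]

/-- A polytope: the convex hull of a nonempty finite set of points. -/
def IsPolytope (P : Set E) : Prop :=
  ∃ s : Finset E, s.Nonempty ∧ P = convexHull ℝ (s : Set E)

/-- The support function `h_S(v) = - min_{y ∈ S} ⟪v, y⟫` (used for compact nonempty `S` only). -/
def supportFn (S : Set E) (v : E) : ℝ :=
  - sInf ((fun y => ⟪v, y⟫) '' S)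

/-- The normal fan of `P`: the set of the cones
`C_F = {v | h_P(v) = - ⟪v, y⟫ for every y ∈ F}`, for the nonempty faces `F` of `P`. -/
def normalFan (P : Set E) : Set (Set E) :=
  {C | ∃ F : Set E, F.Nonempty ∧ IsExposed ℝ P F ∧
    C = {v | ∀ y ∈ F, supportFn P v = - ⟪v, y⟫}}

/-- The set of nonnegative linear combinations of elements of `s`. -/
def coneOn (s : Set E) : Set E :=
  (PointedCone.hull ℝ s : PointedCone ℝ E)

/-- The generators of the rays (one-dimensional cones `ℝ≥0 • v`) of a fan; the generator of a ray
is taken to be its unit vector. -/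
def rayGens (F : Set (Set E)) : Set E :=
  {v | ‖v‖ = 1 ∧ coneOn {v} ∈ F}

open Classical in
/-- `T` is a triangulation of the fan `F` into full-dimensional simplicial cones without new rays.
A simplicial cone is recorded by the finite set of its generators. As the generators of each cone
are linearly independent, the faces of `coneOn S` are the `coneOn S'` with `S' ⊆ S`, and so `inter`
says that any two cones of the triangulation meet in a common face. -/
structure IsTriangulation (F : Set (Set E)) (T : Finset (Finset E)) : Prop where
  gens : ∀ S ∈ T, (S : Set E) ⊆ rayGens F
  linearIndep : ∀ S ∈ T, LinearIndepOn ℝ id (S : Set E)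
  fullDim : ∀ S ∈ T, S.card = Module.finrank ℝ E
  inter : ∀ S ∈ T, ∀ S' ∈ T,
    coneOn (S : Set E) ∩ coneOn (S' : Set E) = coneOn ((S ∩ S' : Finset E) : Set E)
  subordinate : ∀ S ∈ T, ∃ C ∈ F, coneOn (S : Set E) ⊆ C
  cover : ⋃ S ∈ T, coneOn (S : Set E) = ⋃₀ F

/-- `∑_{S ∈ T} δ(S) / ∏_{v ∈ S} u(v)`, with values in a field `L` of numbers or of rational
functions; `δ(S)` is the absolute value of the determinant of the vectors in `S`, in the
normalization chosen for `E`. -/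
def triangulationSum {L : Type*} [Field L] [Algebra ℝ L] (δ : Finset E → ℝ)
    (T : Finset (Finset E)) (u : E → L) : L :=
  ∑ S ∈ T, algebraMap ℝ L (δ S) / ∏ v ∈ S, u v

open Classical in
/-- The value `f_F(u)` computed from a triangulation of the fan `F`. It does not depend on the
triangulation if `u` is linear on each cone of `F`, the only case that is used below. A fan with
no triangulation into full-dimensional cones gets the value `0`. -/
def fanVolume {L : Type*} [Field L] [Algebra ℝ L] (δ : Finset E → ℝ)
    (F : Set (Set E)) (u : E → L) : L :=
  if h : ∃ T, IsTriangulation F T then triangulationSum δ h.choose u else 0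

/-- The dual volume of a polytope, with respect to the determinant `δ`. -/
def dualVolume (δ : Finset E → ℝ) (P : Set E) : ℝ :=
  fanVolume δ (normalFan P) (supportFn P)

end Fans

/-! ### Rational functions -/

/-- The field of rational functions over `ℝ` in variables indexed by `σ`. -/
abbrev RatFn (σ : Type*) : Type _ := FractionRing (MvPolynomial σ ℝ)

/-- The `i`-th variable, as a rational function. -/
def var {σ : Type*} (i : σ) : RatFn σ :=
  algebraMap (MvPolynomial σ ℝ) (RatFn σ) (MvPolynomial.X i)

/-- Substitution of elements `φ i` of a field for the variables of a rational function, computed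
from its reduced fraction. It is meaningful if the reduced denominator does not vanish at `φ`. -/
def RatFn.subst {σ : Type*} {L : Type*} [Field L] [Algebra ℝ L] (W : RatFn σ) (φ : σ → L) : L :=
  MvPolynomial.aeval φ (IsFractionRing.num (MvPolynomial σ ℝ) W) /
    MvPolynomial.aeval φ (IsFractionRing.den (MvPolynomial σ ℝ) W : MvPolynomial σ ℝ)

/-! ### Dual volumes in `ℝ^d` -/

section Euclidean

variable {d : ℕ}

open Classical in
/-- `|det(v_1, …, v_d)|` for a set `S = {v_1, …, v_d}` of `d` vectors of `ℝ^d`. -/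
def absDet (S : Finset (EuclideanSpace ℝ (Fin d))) : ℝ :=
  if h : S.card = d then
    |(Matrix.of fun i j : Fin d =>
      ((S.equivFinOfCardEq h).symm i : EuclideanSpace ℝ (Fin d)) j).det|
  else 0

/-- `f_F(h + ⟪·, z⟫)` for a vector `z` with coordinates in a field `L`; if `h` is the support
function of `P` then `h + ⟪·, z⟫` is that of `P - z`. -/
def shiftedVolume {L : Type*} [Field L] [Algebra ℝ L] (F : Set (Set (EuclideanSpace ℝ (Fin d))))
    (h : EuclideanSpace ℝ (Fin d) → L) (z : Fin d → L) : L :=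
  fanVolume absDet F (fun v => h v + ∑ i, algebraMap ℝ L (v i) * z i)

/-- The dual volume function `Vol^∨_z(P)`, a rational function of `z = (z_1, …, z_d)`. -/
def dualVolumeFn (P : Set (EuclideanSpace ℝ (Fin d))) : RatFn (Fin d) :=
  shiftedVolume (normalFan P) (fun v => algebraMap ℝ _ (supportFn P v)) var

/-- The interval `[-p, p]`. -/
def interval {E : Type*} [AddCommGroup E] [Module ℝ E] (p : E) : Set E :=
  segment ℝ (-p) p

/-- `V(x, z) = Vol^∨_z(P + x[-p, p])`, a rational function of `x` (the variable `none`) and of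
`z_1, …, z_d` (the variables `some i`). -/
def thickenedVolumeFn (P : Set (EuclideanSpace ℝ (Fin d))) (p : EuclideanSpace ℝ (Fin d)) :
    RatFn (Option (Fin d)) :=
  shiftedVolume (normalFan (P + interval p))
    (fun v => algebraMap ℝ _ (supportFn P v) +
      var none * algebraMap ℝ _ (supportFn (interval p) v))
    (fun i => var (some i))

/-- The dual mixed volume function `m_Q(x, z)` of a sequence `Q` of polytopes, a rational function
of the `x_j` (the variables `Sum.inl j`) and the `z_i` (the variables `Sum.inr i`). -/
def dualMixedVolumeFn {ι : Type*} [Fintype ι] (Q : ι → Set (EuclideanSpace ℝ (Fin d))) :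
    RatFn (ι ⊕ Fin d) :=
  shiftedVolume (normalFan (∑ j, Q j))
    (fun v => ∑ j, var (Sum.inl j) * algebraMap ℝ _ (supportFn (Q j) v))
    (fun i => var (Sum.inr i))

/-! ### The hyperplane `H` normal to `p` -/

/-- The orthogonal projection `P_{/p}` of `P` into the hyperplane `H = pᗮ`. -/
def projAlong (p : EuclideanSpace ℝ (Fin d)) (P : Set (EuclideanSpace ℝ (Fin d))) :
    Set ((ℝ ∙ p)ᗮ : Submodule ℝ (EuclideanSpace ℝ (Fin d))) :=
  (ℝ ∙ p)ᗮ.orthogonalProjectionOnto '' P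

open Classical in
/-- The normalization `|det(v_1, …, v_{d-1}, p)|` of the determinant in `H = pᗮ`. -/
def absDetPerp (p : EuclideanSpace ℝ (Fin d))
    (S : Finset ((ℝ ∙ p)ᗮ : Submodule ℝ (EuclideanSpace ℝ (Fin d)))) : ℝ :=
  absDet (insert p (S.map (Function.Embedding.subtype _)))

/-- The affine-linear form `h_{P - z}(v) = h_P(v) + ⟪v, z⟫`, as a polynomial in `z`. -/
def affForm (P : Set (EuclideanSpace ℝ (Fin d))) (v : EuclideanSpace ℝ (Fin d)) :
    MvPolynomial (Fin d) ℝ :=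
  MvPolynomial.C (supportFn P v) + ∑ i, MvPolynomial.C (v i) * MvPolynomial.X i

/-- The factor `B_+` of the denominator: rays `v` of the normal fan of `P` with `⟪p, v⟫ > 0`. -/
def Bpos (P : Set (EuclideanSpace ℝ (Fin d))) (p : EuclideanSpace ℝ (Fin d)) :
    MvPolynomial (Fin d) ℝ :=
  ∏ᶠ v ∈ {v ∈ rayGens (normalFan P) | 0 < ⟪p, v⟫}, affForm P v

/-- The factor `B_0` of the denominator: rays `v` of the normal fan of `P` with `⟪p, v⟫ = 0`. -/
def Bzero (P : Set (EuclideanSpace ℝ (Fin d))) (p : EuclideanSpace ℝ (Fin d)) :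
    MvPolynomial (Fin d) ℝ :=
  ∏ᶠ v ∈ {v ∈ rayGens (normalFan P) | ⟪p, v⟫ = 0}, affForm P v

/-- The factor `B_-` of the denominator: rays `v` of the normal fan of `P` with `⟪p, v⟫ < 0`. -/
def Bneg (P : Set (EuclideanSpace ℝ (Fin d))) (p : EuclideanSpace ℝ (Fin d)) :
    MvPolynomial (Fin d) ℝ :=
  ∏ᶠ v ∈ {v ∈ rayGens (normalFan P) | ⟪p, v⟫ < 0}, affForm P v

/-- The polynomial `D`: rays of the normal fan of `P + [-p, p]` that are not rays of that of `P`. -/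
def Dnew (P : Set (EuclideanSpace ℝ (Fin d))) (p : EuclideanSpace ℝ (Fin d)) :
    MvPolynomial (Fin d) ℝ :=
  ∏ᶠ v ∈ rayGens (normalFan (P + interval p)) \ rayGens (normalFan P), affForm P v

/-- The three properties that characterize the pair `(W_+, W_-)`. In the limits, `z₀` runs over all
points of `H = pᗮ` at which `Vol^∨_{z₀}(P_{/p}) = Vol^∨(P_{/p} - z₀)` is defined, that is, at which
no denominator `h_{P_{/p} - z₀}(v)`, for `v` a ray of the normal fan, vanishes. -/
structure IsSplitting (P : Set (EuclideanSpace ℝ (Fin d))) (p : EuclideanSpace ℝ (Fin d))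
    (Wpos Wneg : RatFn (Fin d)) : Prop where
  add_eq : Wpos + Wneg = dualVolumeFn P
  denom_pos : ∃ A : MvPolynomial (Fin d) ℝ,
    Wpos = algebraMap _ (RatFn (Fin d)) A /
      algebraMap _ (RatFn (Fin d)) (Bpos P p * Bzero P p * Dnew P p)
  denom_neg : ∃ A : MvPolynomial (Fin d) ℝ,
    Wneg = algebraMap _ (RatFn (Fin d)) A /
      algebraMap _ (RatFn (Fin d)) (Bneg P p * Bzero P p * Dnew P p)
  lim_pos : ∀ z₀ : ((ℝ ∙ p)ᗮ : Submodule ℝ (EuclideanSpace ℝ (Fin d))),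
    (∀ v ∈ rayGens (normalFan (projAlong p P)), supportFn (projAlong p P - {z₀}) v ≠ 0) →
    Filter.Tendsto
      (fun t : ℝ => t * Wpos.subst (fun i => (z₀ : EuclideanSpace ℝ (Fin d)) i + t * p i))
      Filter.atTop
      (𝓝 (dualVolume (absDetPerp p) (projAlong p P - {z₀}) / ‖p‖ ^ 2))
  lim_neg : ∀ z₀ : ((ℝ ∙ p)ᗮ : Submodule ℝ (EuclideanSpace ℝ (Fin d))),
    (∀ v ∈ rayGens (normalFan (projAlong p P)), supportFn (projAlong p P - {z₀}) v ≠ 0) →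
    Filter.Tendsto
      (fun t : ℝ => t * Wneg.subst (fun i => (z₀ : EuclideanSpace ℝ (Fin d)) i + t * p i))
      Filter.atTop
      (𝓝 (-(dualVolume (absDetPerp p) (projAlong p P - {z₀}) / ‖p‖ ^ 2)))

end Euclidean

end DualVol

end

open scoped Pointwise
open DualVol

/-! Fix a triangulation `T` of the normal fan of P + [-p, p]. This fan refines the normal fan of P
and that of [-p, p]. Hence h_P is linear on each cone of `T`, and so is |⟪p, ·⟫|, which forces each
cone onto one side of H = pᗮ. The functions W_± are the partial sums of the dual volume over the
cones on the sides ⟪p, ·⟫ ≥ 0 and ⟪p, ·⟫ ≤ 0 (`halfVolume` for p and -p).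

The sum over all cones may be computed from any tiling on whose cones the support function is
linear. For z in the interior of P each term is, up to a common constant, the volume of a simplicial
cone cut off at h_{P-z} ≤ 1, so the sum is the volume of the polar body
(`triangulationSum_eq_of_pos`). Since the interior of P is open, this equality of numbers is an
identity of rational functions (`triangulationSum_eq`). So W_+ + W_- is the dual volume of P. On the
side ⟪p, v⟫ ≥ 0 the support function of x[-p, p] is x⟪p, v⟫, so thickening by x is the translation z
↦ z + xp there, and z ↦ z - xp on the other side. This gives the formula for V(x, z).

Denominators: a ray of the fan of P + [-p, p] outside pᗮ is already a ray of the fan of P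
(`mem_rayGens_of_inner_ne_zero`), so new rays contribute only to D.

Limits: along z₀ + tp the factor of v is affine in t with slope ⟪p, v⟫. After multiplication by t
only cones with exactly one generator off H survive. Their facets in H tile H
(`isTiling_image_trace`), and pulling that generator out of the determinant gives the dual volume of
the projection divided by ‖p‖² (`absDet_insert_mul`, `dualVolume_projAlong`).

Uniqueness: the difference of two candidates for W_+ has both B_+ B_0 D and B_- B_0 D as
denominators. As B_+ and B_- are coprime, it is N / (B_0 D) with a polynomial N. The product B_0 D
is constant in the direction p, so the limit condition says that t N(z₀ + tp) tends to 0 on generic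
lines, which forces N = 0.

The existence of a triangulation without new rays is proved by a generic perturbation of the facet
inequalities (`exists_isTriangulation`). -/

namespace DualVol

/-! ### Faces, normal cones and rays of the normal fan -/

section Faces

variable {E : Type*} [NormedAddCommGroup E] [InnerProductSpace ℝ E]

/-- The face of `P` on which the linear form `⟪v, ·⟫` is minimal. -/
def minFace (P : Set E) (v : E) : Set E :=
  {y | y ∈ P ∧ ∀ z ∈ P, ⟪v, y⟫ ≤ ⟪v, z⟫}

/-- The normal cone of the face of `P` on which `⟪v, ·⟫` is minimal. -/
def faceCone (P : Set E) (v : E) : Set E :=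
  {w | minFace P v ⊆ minFace P w}

lemma IsPolytope.isCompact {P : Set E} (hP : IsPolytope P) : IsCompact P := by
  obtain ⟨s, -, rfl⟩ := hP
  exact s.finite_toSet.isCompact_convexHull ℝ

lemma IsPolytope.nonempty {P : Set E} (hP : IsPolytope P) : P.Nonempty := by
  obtain ⟨s, hs, rfl⟩ := hP
  exact (Finset.coe_nonempty.2 hs).convexHull

lemma IsPolytope.convex {P : Set E} (hP : IsPolytope P) : Convex ℝ P := by
  obtain ⟨s, hs, rfl⟩ := hP
  exact convex_convexHull ℝ _

lemma minFace_nonempty {P : Set E} (hc : IsCompact P) (hn : P.Nonempty) (v : E) :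
    (minFace P v).Nonempty := by
  obtain ⟨y, hy, h⟩ := hc.exists_isMinOn hn
    (f := fun y => ⟪v, y⟫) (by fun_prop)
  exact ⟨y, hy, fun z hz => h hz⟩

lemma supportFn_eq_of_mem_minFace {P : Set E} {v y : E} (hy : y ∈ minFace P v) :
    supportFn P v = -⟪v, y⟫ := by
  have : IsLeast ((fun y => ⟪v, y⟫) '' P) ⟪v, y⟫ :=
    ⟨⟨y, hy.1, rfl⟩, by rintro _ ⟨z, hz, rfl⟩; exact hy.2 z hz⟩
  rw [supportFn, this.csInf_eq]

lemma neg_inner_le_supportFn {P : Set E} (hc : IsCompact P) {y : E} (hy : y ∈ P) (v : E) :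
    -⟪v, y⟫ ≤ supportFn P v := by
  obtain ⟨z, hz⟩ := minFace_nonempty hc ⟨y, hy⟩ v
  rw [supportFn_eq_of_mem_minFace hz]
  linarith [hz.2 y hy]

lemma mem_minFace_iff {P : Set E} (hc : IsCompact P) {v y : E} :
    y ∈ minFace P v ↔ y ∈ P ∧ supportFn P v = -⟪v, y⟫ := by
  refine ⟨fun h => ⟨h.1, supportFn_eq_of_mem_minFace h⟩, fun h => ⟨h.1, fun z hz => ?_⟩⟩
  linarith [neg_inner_le_supportFn hc hz v, h.2]

lemma self_mem_faceCone (P : Set E) (v : E) : v ∈ faceCone P v := fun _ h => h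

lemma mem_coneOn_singleton {v w : E} : w ∈ coneOn {v} ↔ ∃ c : ℝ, 0 ≤ c ∧ w = c • v := by
  rw [coneOn, SetLike.mem_coe, PointedCone.hull, Submodule.mem_span_singleton]
  constructor
  · rintro ⟨c, rfl⟩; exact ⟨c, c.2, rfl⟩
  · rintro ⟨c, hc, rfl⟩; exact ⟨⟨c, hc⟩, rfl⟩

lemma mem_coneOn_finset {S : Finset E} {x : E} :
    x ∈ coneOn (S : Set E) ↔ ∃ a : E → ℝ, (∀ v ∈ S, 0 ≤ a v) ∧ x = ∑ v ∈ S, a v • v := by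
  classical
  rw [coneOn, SetLike.mem_coe, PointedCone.hull, Submodule.mem_span_finset']
  constructor
  · rintro ⟨f, rfl⟩
    refine ⟨fun v => if h : v ∈ S then f ⟨v, h⟩ else 0, fun v hv => ?_, ?_⟩
    · simp only [hv, dif_pos]; exact (f _).2
    · rw [← Finset.sum_attach S]
      refine Finset.sum_congr rfl fun v _ => ?_
      simp only [v.2, dif_pos]; rfl
  · rintro ⟨a, ha, rfl⟩
    refine ⟨fun v => ⟨a v, ha v v.2⟩, ?_⟩
    rw [← Finset.sum_attach S]; rfl

lemma subset_coneOn (s : Set E) : s ⊆ coneOn s := PointedCone.subset_hull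

lemma coneOn_mono {s t : Set E} (h : s ⊆ t) : coneOn s ⊆ coneOn t :=
  Submodule.span_mono h

lemma coneOn_subset_of_convexCone {s C : Set E} (hs : s ⊆ C) (h0 : (0 : E) ∈ C)
    (hadd : ∀ x ∈ C, ∀ y ∈ C, x + y ∈ C) (hsmul : ∀ c : ℝ, 0 ≤ c → ∀ x ∈ C, c • x ∈ C) :
    coneOn s ⊆ C := by
  intro x hx
  refine Submodule.span_induction (p := fun x _ => x ∈ C) (fun x h => hs h) h0
    (fun x y _ _ hx hy => hadd x hx y hy) (fun (c : {c : ℝ // 0 ≤ c}) x _ hx => hsmul c c.2 x hx) hx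

lemma minFace_add_subset {P : Set E} {v w y : E} (hv : y ∈ minFace P v) (hw : y ∈ minFace P w) :
    y ∈ minFace P (v + w) := by
  refine ⟨hv.1, fun z hz => ?_⟩
  rw [inner_add_left, inner_add_left]
  exact add_le_add (hv.2 z hz) (hw.2 z hz)

lemma minFace_smul_subset {P : Set E} {v y : E} (hv : y ∈ minFace P v) {c : ℝ} (hc : 0 ≤ c) :
    y ∈ minFace P (c • v) := by
  refine ⟨hv.1, fun z hz => ?_⟩
  rw [real_inner_smul_left, real_inner_smul_left]
  exact mul_le_mul_of_nonneg_left (hv.2 z hz) hc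

lemma mem_minFace_zero {P : Set E} {y : E} (hy : y ∈ P) : y ∈ minFace P 0 :=
  ⟨hy, fun z _ => by simp⟩

lemma coneOn_subset_setOf_minFace {P : Set E} {s : Set E} {y : E} (hy : y ∈ P)
    (h : ∀ v ∈ s, y ∈ minFace P v) {w : E} (hw : w ∈ coneOn s) : y ∈ minFace P w :=
  coneOn_subset_of_convexCone (C := {w | y ∈ minFace P w}) h (mem_minFace_zero hy)
    (fun _ hx _ hy => minFace_add_subset hx hy) (fun _ hc _ hx => minFace_smul_subset hx hc) hw

lemma coneOn_subset_faceCone {P : Set E} {s : Set E} {v : E} (h : s ⊆ faceCone P v) :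
    coneOn s ⊆ faceCone P v := fun _ hw _ hy =>
  coneOn_subset_setOf_minFace hy.1 (fun _ hu => h hu hy) hw

variable [FiniteDimensional ℝ E]

/-- By the Riesz representation every nonempty exposed face is `minFace P v` for some `v`. This
turns membership in the fan into inclusions between faces. -/
lemma mem_normalFan_iff {P : Set E} (hc : IsCompact P) (hn : P.Nonempty) {C : Set E} :
    C ∈ normalFan P ↔ ∃ v, C = faceCone P v := by
  have key : ∀ v : E, {w | ∀ y ∈ minFace P v, supportFn P w = -⟪w, y⟫} = faceCone P v := by
    intro v
    ext w
    exact ⟨fun h y hy => (mem_minFace_iff hc).2 ⟨hy.1, h y hy⟩,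
      fun h y hy => supportFn_eq_of_mem_minFace (h hy)⟩
  constructor
  · rintro ⟨F, hF, hexp, rfl⟩
    obtain ⟨l, rfl⟩ := hexp hF
    -- Exposed faces are defined by maxima, `minFace` by minima, hence the sign.
    refine ⟨-(InnerProductSpace.toDual ℝ E).symm l, ?_⟩
    rw [← key]
    congr! 4 with w y
    simp [minFace]
  · rintro ⟨v, rfl⟩
    refine ⟨minFace P v, minFace_nonempty hc hn v, fun _ => ⟨-(InnerProductSpace.toDual ℝ E v), ?_⟩,
      (key v).symm⟩
    simp [minFace]

lemma sUnion_normalFan {P : Set E} (hc : IsCompact P) (hn : P.Nonempty) :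
    ⋃₀ normalFan P = Set.univ :=
  Set.eq_univ_of_forall fun v =>
    ⟨faceCone P v, (mem_normalFan_iff hc hn).2 ⟨v, rfl⟩, self_mem_faceCone P v⟩

/-- `faceCone P v` is the smallest cone of the fan that contains `v`, so the ray of `v` belongs to
the fan exactly when this cone is the ray. -/
lemma mem_rayGens_iff {P : Set E} (hc : IsCompact P) (hn : P.Nonempty) {v : E} :
    v ∈ rayGens (normalFan P) ↔
      ‖v‖ = 1 ∧ ∀ w, minFace P v ⊆ minFace P w → ∃ c : ℝ, 0 ≤ c ∧ w = c • v := by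
  refine and_congr_right fun _ => ?_
  rw [mem_normalFan_iff hc hn]
  constructor
  · rintro ⟨u, hu⟩ w hw
    have hv : v ∈ faceCone P u := hu ▸ subset_coneOn _ (Set.mem_singleton v)
    rw [← mem_coneOn_singleton, hu]
    exact hv.trans hw
  · intro h
    refine ⟨v, Set.Subset.antisymm
      (coneOn_subset_faceCone (by simpa using self_mem_faceCone P v)) fun w hw => ?_⟩
    rw [mem_coneOn_singleton]
    exact h w hw

lemma isExposed_minFace (P : Set E) (v : E) : IsExposed ℝ P (minFace P v) := fun _ =>
  ⟨-(InnerProductSpace.toDual ℝ E v), by simp [minFace]⟩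

/-- A face is the closed convex hull of its extreme points, and these lie in `s`. So a face is
determined by finite data. -/
lemma minFace_subset_iff {s : Finset E} {P : Set E} (hP : P = convexHull ℝ (s : Set E)) {v w : E} :
    minFace P v ⊆ minFace P w ↔ ∀ y ∈ s, y ∈ minFace P v → y ∈ minFace P w := by
  refine ⟨fun h y _ hy => h hy, fun h => ?_⟩
  have hc : IsCompact P := hP ▸ s.finite_toSet.isCompact_convexHull ℝ
  have hconv : Convex ℝ P := hP ▸ convex_convexHull ℝ _
  have hv := isExposed_minFace P v
  have hw := isExposed_minFace P w
  rw [← closure_convexHull_extremePoints (hv.isCompact hc) (hv.convex hconv)]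
  refine closure_minimal (convexHull_min (fun y hy => h y ?_ hy.1) (hw.convex hconv))
    (hw.isCompact hc).isClosed
  have := hv.isExtreme.extremePoints_subset_extremePoints hy
  rw [hP] at this
  exact extremePoints_convexHull_subset this

lemma eq_of_mem_rayGens {P : Set E} (hc : IsCompact P) (hn : P.Nonempty) {v w : E}
    (hv : v ∈ rayGens (normalFan P)) (hw : ‖w‖ = 1) (h : minFace P v ⊆ minFace P w) : w = v := by
  rw [mem_rayGens_iff hc hn] at hv
  obtain ⟨c, hc0, rfl⟩ := hv.2 w h
  rw [norm_smul, hv.1, Real.norm_of_nonneg hc0, mul_one] at hw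
  rw [hw, one_smul]

/-- A ray generator is determined by its face, hence by the subset of `s` in that face. -/
lemma finite_rayGens {P : Set E} (hP : IsPolytope P) : (rayGens (normalFan P)).Finite := by
  classical
  have hc := hP.isCompact
  have hn := hP.nonempty
  obtain ⟨s, -, hs⟩ := hP
  refine Set.Finite.of_finite_image (f := fun v => s.filter (· ∈ minFace P v))
    (s.powerset.finite_toSet.subset ?_) ?_
  · rintro _ ⟨v, -, rfl⟩
    exact Finset.mem_coe.2 (Finset.mem_powerset.2 (Finset.filter_subset _ _))
  · intro v hv w hw h
    refine (eq_of_mem_rayGens hc hn hv hw.1 ((minFace_subset_iff hs).2 fun y hy hyv => ?_)).symm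
    have : y ∈ s.filter (· ∈ minFace P v) := by simp [hy, hyv]
    rw [show s.filter (· ∈ minFace P v) = s.filter (· ∈ minFace P w) from h] at this
    exact (Finset.mem_filter.1 this).2

end Faces

/-! ### Support functions of sums, multiples and intervals -/

section SupportFunctions

variable {E : Type*} [NormedAddCommGroup E] [InnerProductSpace ℝ E]

/-- Minimizing a linear form over a Minkowski sum decouples. This is why the normal fan of a sum
refines those of the summands. -/
lemma add_mem_minFace_add_iff {P Q : Set E} {y z v : E} (hy : y ∈ P) (hz : z ∈ Q) :
    y + z ∈ minFace (P + Q) v ↔ y ∈ minFace P v ∧ z ∈ minFace Q v := by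
  constructor
  · intro h
    refine ⟨⟨hy, fun y' hy' => ?_⟩, hz, fun z' hz' => ?_⟩
    · have := h.2 _ (Set.add_mem_add hy' hz)
      simpa [inner_add_right] using this
    · have := h.2 _ (Set.add_mem_add hy hz')
      simpa [inner_add_right] using this
  · rintro ⟨h1, h2⟩
    refine ⟨Set.add_mem_add hy hz, ?_⟩
    rintro _ ⟨y', hy', z', hz', rfl⟩
    simp only [inner_add_right]
    exact add_le_add (h1.2 y' hy') (h2.2 z' hz')

lemma supportFn_add {P Q : Set E} (hP : IsCompact P) (hP' : P.Nonempty) (hQ : IsCompact Q)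
    (hQ' : Q.Nonempty) (v : E) : supportFn (P + Q) v = supportFn P v + supportFn Q v := by
  obtain ⟨y, hy⟩ := minFace_nonempty hP hP' v
  obtain ⟨z, hz⟩ := minFace_nonempty hQ hQ' v
  rw [supportFn_eq_of_mem_minFace hy, supportFn_eq_of_mem_minFace hz,
    supportFn_eq_of_mem_minFace ((add_mem_minFace_add_iff hy.1 hz.1).2 ⟨hy, hz⟩), inner_add_right]
  ring

lemma smul_mem_minFace_smul_iff {P : Set E} {y v : E} {c : ℝ} (hc : 0 < c) :
    c • y ∈ minFace (c • P) v ↔ y ∈ minFace P v := by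
  simp only [minFace, Set.mem_ofPred_eq, Set.smul_mem_smul_set_iff₀ hc.ne']
  refine and_congr_right fun _ => ⟨fun h z hz => ?_, ?_⟩
  · have := h _ (Set.smul_mem_smul_set hz)
    rw [real_inner_smul_right, real_inner_smul_right] at this
    exact le_of_mul_le_mul_left this hc
  · rintro h _ ⟨z, hz, rfl⟩
    simp only [real_inner_smul_right]
    exact mul_le_mul_of_nonneg_left (h z hz) hc.le

lemma supportFn_smul {P : Set E} (hP : IsCompact P) (hP' : P.Nonempty) {c : ℝ} (hc : 0 < c)
    (v : E) : supportFn (c • P) v = c * supportFn P v := by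
  obtain ⟨y, hy⟩ := minFace_nonempty hP hP' v
  rw [supportFn_eq_of_mem_minFace hy,
    supportFn_eq_of_mem_minFace ((smul_mem_minFace_smul_iff hc).2 hy), real_inner_smul_right]
  ring

lemma sub_mem_minFace_iff {P : Set E} {y v z : E} :
    y ∈ minFace (P - {z}) v ↔ y + z ∈ minFace P v := by
  simp only [minFace, Set.sub_singleton, Set.mem_ofPred_eq, Set.forall_mem_image]
  refine and_congr ⟨?_, fun h => ⟨y + z, h, by simp⟩⟩ (forall₂_congr fun w _ => ?_)
  · rintro ⟨w, hw, rfl⟩; simpa using hw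
  · rw [inner_sub_right, inner_add_right, le_sub_iff_add_le]

lemma supportFn_sub_singleton {P : Set E} (hP : IsCompact P) (hP' : P.Nonempty) (z v : E) :
    supportFn (P - {z}) v = supportFn P v + ⟪v, z⟫ := by
  obtain ⟨y, hy⟩ := minFace_nonempty hP hP' v
  rw [supportFn_eq_of_mem_minFace hy,
    supportFn_eq_of_mem_minFace (sub_mem_minFace_iff.2 (by simpa using hy) :
      y - z ∈ minFace (P - {z}) v), inner_sub_right]
  ring

lemma interval_nonempty (p : E) : (interval p).Nonempty := ⟨p, right_mem_segment ℝ _ _⟩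

lemma isPolytope_interval (p : E) : IsPolytope (interval p) := by
  classical
  exact ⟨{-p, p}, by simp, by simp [interval, convexHull_pair]⟩

lemma mem_interval {p y : E} : y ∈ interval p ↔ ∃ c : ℝ, -1 ≤ c ∧ c ≤ 1 ∧ y = c • p := by
  constructor
  · rintro ⟨a, b, ha, hb, hab, rfl⟩
    exact ⟨b - a, by linarith, by linarith, by rw [sub_smul, smul_neg]; abel⟩
  · rintro ⟨c, h1, h2, rfl⟩
    refine ⟨(1 - c) / 2, (1 + c) / 2, by linarith, by linarith, by ring, ?_⟩
    rw [smul_neg, ← neg_smul, ← add_smul]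
    congr 1; ring

lemma supportFn_interval (p v : E) : supportFn (interval p) v = |⟪p, v⟫| := by
  have hc := (isPolytope_interval p).isCompact
  apply le_antisymm
  · obtain ⟨y, hy⟩ := minFace_nonempty hc (interval_nonempty p) v
    rw [supportFn_eq_of_mem_minFace hy]
    obtain ⟨c, h1, h2, rfl⟩ := mem_interval.1 hy.1
    rw [real_inner_smul_right, real_inner_comm, ← neg_mul]
    refine (le_abs_self _).trans ?_
    rw [abs_mul]
    exact mul_le_of_le_one_left (abs_nonneg _) (abs_le.2 ⟨by linarith, by linarith⟩)
  · refine abs_le'.2 ⟨?_, ?_⟩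
    · refine le_trans (le_of_eq ?_) (neg_inner_le_supportFn hc (left_mem_segment ℝ (-p) p) v)
      rw [inner_neg_right, neg_neg, real_inner_comm]
    · refine le_trans (le_of_eq ?_) (neg_inner_le_supportFn hc (right_mem_segment ℝ (-p) p) v)
      rw [real_inner_comm]

lemma IsPolytope.add {P Q : Set E} (hP : IsPolytope P) (hQ : IsPolytope Q) :
    IsPolytope (P + Q) := by
  classical
  obtain ⟨s, hs, rfl⟩ := hP
  obtain ⟨t, ht, rfl⟩ := hQ
  exact ⟨s + t, hs.add ht, by rw [Finset.coe_add, convexHull_add]⟩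

lemma IsPolytope.image {F : Type*} [NormedAddCommGroup F] [InnerProductSpace ℝ F] {P : Set E}
    (hP : IsPolytope P) (f : E →ₗ[ℝ] F) : IsPolytope (f '' P) := by
  classical
  obtain ⟨s, hs, rfl⟩ := hP
  exact ⟨s.image f, hs.image f, by rw [Finset.coe_image, LinearMap.image_convexHull]⟩

lemma IsPolytope.smul {P : Set E} (hP : IsPolytope P) (c : ℝ) : IsPolytope (c • P) :=
  hP.image (LinearMap.lsmul ℝ E c)

lemma isPolytope_singleton (z : E) : IsPolytope ({z} : Set E) := ⟨{z}, by simp, by simp⟩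

lemma isPolytope_sum {ι : Type*} (s : Finset ι) {Q : ι → Set E} (hQ : ∀ i, IsPolytope (Q i)) :
    IsPolytope (∑ i ∈ s, Q i) := by
  classical
  induction s using Finset.induction with
  | empty => exact isPolytope_singleton 0
  | insert i s hi ih => rw [Finset.sum_insert hi]; exact (hQ i).add ih

lemma supportFn_sum {ι : Type*} (s : Finset ι) {Q : ι → Set E} (hQ : ∀ i, IsPolytope (Q i))
    (v : E) : supportFn (∑ i ∈ s, Q i) v = ∑ i ∈ s, supportFn (Q i) v := by
  classical
  induction s using Finset.induction with
  | empty =>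
    have : (0 : E) ∈ minFace (∑ i ∈ (∅ : Finset ι), Q i) v := by
      rw [Finset.sum_empty]
      exact ⟨rfl, by simp⟩
    rw [supportFn_eq_of_mem_minFace this]; simp
  | insert i s hi ih =>
    have h := isPolytope_sum s hQ
    rw [Finset.sum_insert hi, Finset.sum_insert hi, supportFn_add (hQ i).isCompact (hQ i).nonempty
      h.isCompact h.nonempty, ih]

/-- A small step from `z` against `v` stays in `P` and strictly lowers `⟪v, ·⟫`. Hence all
denominators are positive at interior points of `P`. -/
lemma supportFn_pos_of_mem_interior {P : Set E} (hc : IsCompact P) {z v : E}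
    (hz : z ∈ interior P) (hv : v ≠ 0) : 0 < supportFn P v + ⟪v, z⟫ := by
  have : Filter.Tendsto (fun t : ℝ => z - t • v) (𝓝[>] 0) (𝓝 z) := by
    refine tendsto_nhdsWithin_of_tendsto_nhds ?_
    have : Continuous fun t : ℝ => z - t • v := by fun_prop
    simpa using this.tendsto 0
  obtain ⟨t, ht, ht0⟩ := ((this.eventually (mem_interior_iff_mem_nhds.1 hz)).and
    self_mem_nhdsWithin).exists
  have h := neg_inner_le_supportFn hc ht v
  rw [inner_sub_right, real_inner_smul_right, real_inner_self_eq_norm_sq] at h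
  have : 0 < t * ‖v‖ ^ 2 := mul_pos ht0 (by positivity)
  linarith

end SupportFunctions

/-! ### A full-dimensional polytope is cut out by the inequalities of its rays -/

section FacetDescription

variable {E : Type*} [NormedAddCommGroup E] [InnerProductSpace ℝ E]

lemma minFace_smul {P : Set E} (v : E) {c : ℝ} (hc : 0 < c) :
    minFace P (c • v) = minFace P v := by
  refine Set.Subset.antisymm (fun y hy => ?_) fun y hy => minFace_smul_subset hy hc.le
  have := minFace_smul_subset hy (inv_pos.2 hc).le
  rwa [inv_smul_smul₀ hc.ne'] at this

lemma inner_le_of_mem_convexHull {s : Finset E} {u y : E} {a : ℝ}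
    (h : ∀ y ∈ s, a ≤ ⟪u, y⟫) (hy : y ∈ convexHull ℝ (s : Set E)) : a ≤ ⟪u, y⟫ := by
  have hconv : Convex ℝ {y : E | a ≤ ⟪u, y⟫} :=
    convex_halfSpace_ge (f := fun y => ⟪u, y⟫) (innerₗ E u).isLinear a
  exact convexHull_min (t := {y : E | a ≤ ⟪u, y⟫}) (fun y hy => h y hy) hconv hy

/-- On vertices in the face of `v` both forms are constant, so there is a tie; at the other vertices
the strict gap of `⟪v, ·⟫` survives a small perturbation. -/
lemma exists_mem_minFace_sub_smul {s : Finset E} {P : Set E} (hP : P = convexHull ℝ (s : Set E))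
    {v w y : E} (hvw : minFace P v ⊆ minFace P w) (hy : y ∈ minFace P v) :
    ∀ᶠ t in 𝓝[>] (0 : ℝ), y ∈ minFace P (v - t • w) := by
  have key : ∀ᶠ t in 𝓝[>] (0 : ℝ), ∀ z ∈ s, ⟪v - t • w, y⟫ ≤ ⟪v - t • w, z⟫ := by
    refine (Filter.eventually_all_finset s).2 fun z hz => ?_
    have hzP : z ∈ P := hP ▸ subset_convexHull ℝ _ hz
    by_cases hzv : z ∈ minFace P v
    · refine Filter.Eventually.of_forall fun t => le_of_eq ?_
      have h1 := le_antisymm (hy.2 z hzP) (hzv.2 y hy.1)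
      have h2 := le_antisymm ((hvw hy).2 z hzP) ((hvw hzv).2 y hy.1)
      simp only [inner_sub_left, real_inner_smul_left, h1, h2]
    · have hlt : ⟪v, y⟫ < ⟪v, z⟫ := by
        by_contra hle
        exact hzv ⟨hzP, fun x hx => (not_lt.1 hle).trans (hy.2 x hx)⟩
      have hcont : Continuous fun t : ℝ => ⟪v - t • w, z⟫ - ⟪v - t • w, y⟫ := by fun_prop
      have := (hcont.tendsto 0).eventually (lt_mem_nhds (a := 0) (by simpa using hlt))
      filter_upwards [nhdsWithin_le_nhds this] with t ht
      linarith
  filter_upwards [key] with t ht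
  exact ⟨hy.1, fun z hz => inner_le_of_mem_convexHull ht (hP ▸ hz)⟩

/-- The polar body of `Q` with respect to an interior point `c`. -/
def polarAt (Q : Set E) (c : E) : Set E := {v | ∀ y ∈ Q, ⟪v, c - y⟫ ≤ 1}

lemma convex_polarAt (Q : Set E) (c : E) : Convex ℝ (polarAt Q c) := by
  have : polarAt Q c = ⋂ y ∈ Q, {v : E | ⟪v, c - y⟫ ≤ 1} := by ext; simp [polarAt]
  rw [this]
  exact convex_iInter₂ fun y _ => convex_halfSpace_le
    (f := fun v => ⟪v, c - y⟫) ⟨fun _ _ => inner_add_left .., fun _ _ => real_inner_smul_left ..⟩ 1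

variable [FiniteDimensional ℝ E]

lemma isCompact_polarAt {Q : Set E} {c : E} (hc : c ∈ interior Q) : IsCompact (polarAt Q c) := by
  have h : polarAt Q c = ⋂ y ∈ Q, {v : E | ⟪v, c - y⟫ ≤ 1} := by ext; simp [polarAt]
  have hclosed : IsClosed (polarAt Q c) := by
    rw [h]
    exact isClosed_biInter fun y _ => isClosed_le (by fun_prop) continuous_const
  obtain ⟨r, hr, hball⟩ := Metric.nhds_basis_closedBall.mem_iff.1 (mem_interior_iff_mem_nhds.1 hc)
  refine (isCompact_closedBall (0 : E) r⁻¹).of_isClosed_subset hclosed fun v hv => ?_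
  rw [mem_closedBall_zero_iff]
  rcases eq_or_ne v 0 with rfl | hv0
  · simpa using hr.le
  have hn : 0 < ‖v‖ := norm_pos_iff.2 hv0
  have := hv (c - (r / ‖v‖) • v) (hball (by
    rw [mem_closedBall_iff_norm, sub_sub_cancel_left, norm_neg, norm_smul, norm_div, norm_norm,
      Real.norm_of_nonneg hr.le, div_mul_cancel₀ _ hn.ne']))
  rw [sub_sub_cancel, real_inner_smul_right, real_inner_self_eq_norm_sq] at this
  rw [← one_div, le_div_iff₀ hr]
  calc ‖v‖ * r = r / ‖v‖ * ‖v‖ ^ 2 := by field_simp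
    _ ≤ 1 := this

/-- If `w` lies in the normal cone of the face of `v`, then `v` is a convex combination of suitable
multiples of `v - t • w` and of `w`, both in the polar body. Extremality makes `w` a multiple of
`v`. -/
lemma mem_rayGens_of_mem_extremePoints {Q : Set E} (hQ : IsPolytope Q) {c : E}
    (hc : c ∈ interior Q) {v : E} (hv : v ∈ (polarAt Q c).extremePoints ℝ) (hv0 : v ≠ 0) :
    ‖v‖⁻¹ • v ∈ rayGens (normalFan Q) := by
  have hcQ : c ∈ Q := interior_subset hc
  have hcomp := hQ.isCompact
  have hn : 0 < ‖v‖ := norm_pos_iff.2 hv0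
  rw [mem_rayGens_iff hcomp hQ.nonempty]
  refine ⟨by rw [norm_smul, norm_inv, norm_norm, inv_mul_cancel₀ hn.ne'], fun w hw => ?_⟩
  rw [minFace_smul v (inv_pos.2 hn)] at hw
  suffices h : ∃ a : ℝ, 0 ≤ a ∧ w = a • v by
    obtain ⟨a, ha, rfl⟩ := h
    exact ⟨a * ‖v‖, by positivity, by rw [smul_smul, mul_assoc, mul_inv_cancel₀ hn.ne', mul_one]⟩
  rcases eq_or_ne w 0 with rfl | hw0
  · exact ⟨0, le_rfl, by simp⟩
  obtain ⟨y, hy⟩ := minFace_nonempty hcomp hQ.nonempty v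
  have hyw := hw hy
  have hgen : ∀ {u : E}, y ∈ minFace Q u → ∀ {a : ℝ}, 0 < a → ⟪u, c - y⟫ ≤ a →
      -- For `u` minimal at `y`, the number `⟪u, c - y⟫` is the gauge of `u` with respect to the
      -- polar body.
      a⁻¹ • u ∈ polarAt Q c := by
    intro u hu a ha hle z hz
    rw [real_inner_smul_left, inv_mul_le_iff₀ ha, mul_one]
    refine le_trans ?_ hle
    rw [inner_sub_right, inner_sub_right]
    linarith [hu.2 z hz]
  have hpos : ∀ {u : E}, u ≠ 0 → y ∈ minFace Q u → 0 < ⟪u, c - y⟫ := by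
    intro u hu0 hu
    have := supportFn_pos_of_mem_interior hcomp hc hu0
    rw [supportFn_eq_of_mem_minFace hu] at this
    rw [inner_sub_right]; linarith
  have hgw := hpos hw0 hyw
  have hgv := hpos hv0 hy
  have hgv1 : ⟪v, c - y⟫ ≤ 1 := hv.1 y hy.1
  have hQ' := hQ
  obtain ⟨s, -, hs⟩ := hQ'
  set b := ⟪w, c - y⟫ with hb
  have hcont : Continuous fun t : ℝ => 1 - t * b := by fun_prop
  have h1 := (hcont.tendsto 0).eventually (lt_mem_nhds (a := 0) (by simp))
  obtain ⟨t, ⟨ht, ht1⟩, ht0⟩ := (((exists_mem_minFace_sub_smul hs hw hy).and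
    (nhdsWithin_le_nhds h1)).and self_mem_nhdsWithin).exists
  have ht0 : 0 < t := ht0
  have hA := hgen ht (a := 1 - t * b) ht1 (by
    rw [inner_sub_left, real_inner_smul_left]; linarith)
  have hB := hgen hyw hgw le_rfl
  have := mem_extremePoints.1 hv
  -- The weights are the scaling factors of the two points: `v = (v - t • w) + t • w`.
  have := (this.2 _ hA _ hB ⟨1 - t * b, t * b, ht1, by positivity, by ring, by
    rw [smul_inv_smul₀ ht1.ne', smul_smul, mul_assoc, mul_inv_cancel₀ hgw.ne', mul_one]; abel⟩).2
  exact ⟨b, hgw.le, by rw [← this, smul_inv_smul₀ hgw.ne']⟩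

/-- The ray inequalities control the extreme points of the polar body, hence by Krein–Milman the
whole polar body. A point that satisfies all polar inequalities cannot be separated from `Q`. -/
lemma mem_of_forall_rayGens {Q : Set E} (hQ : IsPolytope Q) (hint : (interior Q).Nonempty) {y : E}
    (h : ∀ v ∈ rayGens (normalFan Q), -⟪v, y⟫ ≤ supportFn Q v) : y ∈ Q := by
  obtain ⟨c, hc⟩ := hint
  have hcomp := hQ.isCompact
  have hpolar : ∀ v ∈ polarAt Q c, ⟪v, c - y⟫ ≤ 1 := by
    have hconv : Convex ℝ {v : E | ⟪v, c - y⟫ ≤ 1} := convex_halfSpace_le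
      (f := fun v => ⟪v, c - y⟫) ⟨fun _ _ => inner_add_left .., fun _ _ => real_inner_smul_left ..⟩ 1
    have hclosed : IsClosed {v : E | ⟪v, c - y⟫ ≤ 1} :=
      isClosed_le (by fun_prop) continuous_const
    intro v hv
    rw [← closure_convexHull_extremePoints (isCompact_polarAt hc) (convex_polarAt Q c)] at hv
    refine closure_minimal (convexHull_min (fun v hv => ?_) hconv) hclosed hv
    show ⟪v, c - y⟫ ≤ 1
    rcases eq_or_ne v 0 with rfl | hv0
    · simp
    have hn : 0 < ‖v‖ := norm_pos_iff.2 hv0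
    have h1 := h _ (mem_rayGens_of_mem_extremePoints hQ hc hv hv0)
    obtain ⟨z, hz⟩ := minFace_nonempty hcomp hQ.nonempty v
    rw [supportFn_eq_of_mem_minFace (minFace_smul_subset hz (inv_pos.2 hn).le),
      real_inner_smul_left, real_inner_smul_left, neg_le_neg_iff,
      mul_le_mul_iff_right₀ (inv_pos.2 hn)] at h1
    refine le_trans ?_ (hv.1 z hz.1)
    rw [inner_sub_right, inner_sub_right]
    linarith
  by_contra hy
  obtain ⟨f, a, hf, hay⟩ := geometric_hahn_banach_closed_point hQ.convex hcomp.isClosed hy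
  set w := -(InnerProductSpace.toDual ℝ E).symm f with hw
  have hwf : ∀ z, ⟪w, z⟫ = -f z := fun z => by simp [hw]
  obtain ⟨z, hz⟩ := minFace_nonempty hcomp hQ.nonempty w
  have hw0 : w ≠ 0 := by
    intro h0
    have h1 := hwf y
    have h2 := hwf z
    rw [h0, inner_zero_left] at h1 h2
    linarith [hf z hz.1]
  have hpos := supportFn_pos_of_mem_interior hcomp hc hw0
  rw [supportFn_eq_of_mem_minFace hz] at hpos
  have hpos' : 0 < ⟪w, c - z⟫ := by rw [inner_sub_right]; linarith
  -- The separating form is scaled to lie on the boundary of the polar body.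
  have := hpolar (⟪w, c - z⟫⁻¹ • w) (fun x hx => by
    rw [real_inner_smul_left, inv_mul_le_iff₀ hpos', mul_one, inner_sub_right, inner_sub_right]
    linarith [hz.2 x hx])
  rw [real_inner_smul_left, inv_mul_le_iff₀ hpos', mul_one, inner_sub_right, inner_sub_right,
    hwf y, hwf z] at this
  linarith [hf z hz.1]

end FacetDescription

/-! ### Existence of a triangulation without new rays -/

section Triangulations

variable {E : Type*} [NormedAddCommGroup E] [InnerProductSpace ℝ E] [FiniteDimensional ℝ E]

lemma exists_inner_eq {S : Finset E} (hS : LinearIndepOn ℝ id (S : Set E)) (f : E → ℝ) :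
    ∃ y : E, ∀ v ∈ S, ⟪v, y⟫ = f v := by
  let b := Module.Basis.extend hS
  let φ : E →ₗ[ℝ] ℝ := b.constr ℝ fun i => f i
  refine ⟨(InnerProductSpace.toDual ℝ E).symm (LinearMap.toContinuousLinearMap φ), fun v hv => ?_⟩
  rw [real_inner_comm, InnerProductSpace.toDual_symm_apply]
  have hv' : v ∈ hS.extend (Set.subset_univ _) := hS.subset_extend _ hv
  have : b ⟨v, hv'⟩ = v := Module.Basis.extend_apply_self hS _
  show φ v = f v
  conv_lhs => rw [← this]
  rw [Module.Basis.constr_basis]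

lemma span_eq_top {S : Finset E} (hS : LinearIndepOn ℝ id (S : Set E))
    (hcard : S.card = Module.finrank ℝ E) : Submodule.span ℝ (S : Set E) = ⊤ := by
  have h : LinearIndependent ℝ ((↑) : S → E) := hS
  have := h.span_eq_top_of_card_eq_finrank' (by simpa using hcard)
  simpa using this

lemma exists_repr {S : Finset E} (hS : LinearIndepOn ℝ id (S : Set E))
    (hcard : S.card = Module.finrank ℝ E) (v : E) : ∃ c : E → ℝ, v = ∑ u ∈ S, c u • u := by
  have : v ∈ Submodule.span ℝ (S : Set E) := by rw [span_eq_top hS hcard]; trivial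
  obtain ⟨c, -, hc⟩ := Submodule.mem_span_finset.1 this
  exact ⟨c, hc.symm⟩

omit [FiniteDimensional ℝ E] in
-- The sum of the generators is interior to their cone: whatever minimizes the sum must minimize
-- each summand, since `y` minimizes all of them at once.
lemma subset_faceCone_sum {Q : Set E} {S : Finset E} {y : E} (hy : y ∈ Q)
    (h : ∀ v ∈ S, y ∈ minFace Q v) : (S : Set E) ⊆ faceCone Q (∑ v ∈ S, v) := by
  intro v hv z hz
  have h1 := hz.2 y hy
  rw [sum_inner, sum_inner] at h1
  have h2 : ∀ u ∈ S, ⟪u, y⟫ ≤ ⟪u, z⟫ := fun u hu => (h u hu).2 z hz.1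
  have h3 := (Finset.sum_eq_sum_iff_of_le h2).1 (le_antisymm (Finset.sum_le_sum h2) h1) v hv
  exact ⟨hz.1, fun x hx => h3 ▸ (h v hv).2 x hx⟩

omit [NormedAddCommGroup E] [InnerProductSpace ℝ E] [FiniteDimensional ℝ E] in
-- The difference of the two sides is a polynomial in `t` in which `t ^ k v` has coefficient 1,
-- because the exponents are distinct and positive. So it has finitely many roots.
lemma eventually_add_pow_ne {R S : Finset E} {k : E → ℕ} (hk : Set.InjOn k R) (hk0 : ∀ v, k v ≠ 0)
    (hS : S ⊆ R) {v : E} (hv : v ∈ R) (hvS : v ∉ S) (h c : E → ℝ) :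
    ∀ᶠ t in 𝓝[>] (0 : ℝ), h v + t ^ k v ≠ ∑ u ∈ S, c u * (h u + t ^ k u) := by
  let q : Polynomial ℝ := Polynomial.C (h v - ∑ u ∈ S, c u * h u) + Polynomial.X ^ k v -
    ∑ u ∈ S, Polynomial.C (c u) * Polynomial.X ^ k u
  have hq : q ≠ 0 := by
    intro h0
    have h1 : q.coeff (k v) = 1 := by
      have h2 : ∑ u ∈ S, (if k v = k u then c u else 0) = 0 := by
        refine Finset.sum_eq_zero fun u hu => if_neg fun he => hvS ?_
        rwa [hk hv (hS hu) he]
      simp [q, Polynomial.coeff_X_pow, Polynomial.coeff_C, hk0, h2]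
    rw [h0] at h1
    simp at h1
  have h1 : ∀ᶠ t in 𝓝[>] (0 : ℝ), t ∉ {t | q.IsRoot t} :=
    ((Polynomial.finite_setOfPred_isRoot hq).eventually_cofinite_notMem).filter_mono
      ((nhdsGT_le_nhdsNE 0).trans (nhdsNE_le_cofinite 0))
  filter_upwards [h1] with t ht he
  apply ht
  simp only [q, Polynomial.IsRoot, Polynomial.eval_sub, Polynomial.eval_add,
    Polynomial.eval_C, Polynomial.eval_pow, Polynomial.eval_X, Polynomial.eval_finsetSum,
    Polynomial.eval_mul]
  simp only [mul_add, Finset.sum_add_distrib] at he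
  linarith

/-- The vectors `y` with `- g v ≤ ⟪v, y⟫` for all `v` in `R`. -/
def halfSpaces (R : Finset E) (g : E → ℝ) : Set E := {y | ∀ v ∈ R, -g v ≤ ⟪v, y⟫}

omit [FiniteDimensional ℝ E] in
-- For small steps only the active inequalities restrict the direction.
lemma eventually_add_smul_mem_halfSpaces {R : Finset E} {g : E → ℝ} {y u : E}
    (hy : y ∈ halfSpaces R g) (hu : ∀ v ∈ R, ⟪v, y⟫ = -g v → 0 ≤ ⟪v, u⟫) :
    ∀ᶠ t in 𝓝[>] (0 : ℝ), y + t • u ∈ halfSpaces R g := by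
  refine (Filter.eventually_all_finset R).2 fun v hv => ?_
  rcases (hy v hv).eq_or_lt with h | h
  · filter_upwards [self_mem_nhdsWithin] with t ht
    rw [inner_add_right, real_inner_smul_right, ← h]
    linarith [mul_nonneg (le_of_lt ht) (hu v hv h.symm)]
  · have hcont : Continuous fun t : ℝ => ⟪v, y + t • u⟫ := by fun_prop
    have := (hcont.tendsto 0).eventually (lt_mem_nhds (a := -g v) (by simpa using h))
    filter_upwards [nhdsWithin_le_nhds this] with t ht
    exact ht.le

omit [FiniteDimensional ℝ E] in
lemma isClosed_halfSpaces (R : Finset E) (g : E → ℝ) : IsClosed (halfSpaces R g) := by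
  have : halfSpaces R g = ⋂ v ∈ R, {y : E | -g v ≤ ⟪v, y⟫} := by ext; simp [halfSpaces]
  rw [this]
  exact isClosed_biInter fun v _ => isClosed_le continuous_const (by fun_prop)

/-- For a generic right hand side, every linear form is minimized on a bounded system of linear
inequalities at a point whose active inequalities form a basis, and the linear form is a
nonnegative combination of these. -/
lemma exists_optimal_basis {R : Finset E} {g : E → ℝ} (hc : IsCompact (halfSpaces R g))
    (hn : (halfSpaces R g).Nonempty)
    (hgen : ∀ S ⊆ R, LinearIndepOn ℝ id (S : Set E) → S.card = Module.finrank ℝ E →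
      ∀ v ∈ R, v ∉ S → ∀ y, (∀ u ∈ S, ⟪u, y⟫ = -g u) → ⟪v, y⟫ ≠ -g v) (w : E) :
    ∃ S ⊆ R, LinearIndepOn ℝ id (S : Set E) ∧ S.card = Module.finrank ℝ E ∧
      (∃ y, (∀ v ∈ S, ⟪v, y⟫ = -g v) ∧ ∀ v ∈ R, v ∉ S → -g v < ⟪v, y⟫) ∧
      w ∈ coneOn (S : Set E) := by
  classical
  have hexp := isExposed_minFace (halfSpaces R g) w
  obtain ⟨y, hy⟩ := (hexp.isCompact hc).extremePoints_nonempty (minFace_nonempty hc hn w)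
  have hymin := hy.1
  have hyext := hexp.isExtreme.extremePoints_subset_extremePoints hy
  have hyQ := hyext.1
  let A := R.filter fun v => ⟪v, y⟫ = -g v
  -- Otherwise one could move from `y` both ways along a direction orthogonal to all active normals,
  -- against extremality.
  have hspan : Submodule.span ℝ (A : Set E) = ⊤ := by
    by_contra hne
    have hbot : (Submodule.span ℝ (A : Set E))ᗮ ≠ ⊥ := fun h =>
      hne (Submodule.orthogonal_eq_bot_iff.1 h)
    obtain ⟨u, hu, hu0⟩ := Submodule.exists_mem_ne_zero_of_ne_bot hbot
    have horth : ∀ v ∈ R, ⟪v, y⟫ = -g v → ⟪v, u⟫ = 0 := fun v hv h =>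
      hu v (Submodule.subset_span (Finset.mem_coe.2 (Finset.mem_filter.2 ⟨hv, h⟩)))
    have h1 := eventually_add_smul_mem_halfSpaces hyQ fun v hv h => (horth v hv h).ge
    have h2 := eventually_add_smul_mem_halfSpaces (u := -u) hyQ fun v hv h => by
      rw [inner_neg_right, horth v hv h, neg_zero]
    obtain ⟨t, ⟨ht1, ht2⟩, ht⟩ := ((h1.and h2).and self_mem_nhdsWithin).exists
    have := ((mem_extremePoints.1 hyext).2 _ ht1 _ ht2 ⟨1 / 2, 1 / 2, by norm_num, by norm_num,
      by norm_num, by module⟩).1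
    have ht0 : t ≠ 0 := (show 0 < t from ht).ne'
    simp [ht0, hu0] at this
  obtain ⟨b, hbA, hbspan, hb⟩ := exists_linearIndependent ℝ (A : Set E)
  obtain ⟨S, rfl⟩ := (A.finite_toSet.subset hbA).exists_finset_coe
  have hli : LinearIndepOn ℝ id (S : Set E) := hb
  have hSA : S ⊆ A := Finset.coe_subset.1 hbA
  have hSR : S ⊆ R := hSA.trans (Finset.filter_subset _ _)
  have hcard : S.card = Module.finrank ℝ E := by
    have h := finrank_span_finset_eq_card hli
    rw [hbspan, hspan, finrank_top] at h
    exact h.symm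
  have hSy : ∀ v ∈ S, ⟪v, y⟫ = -g v := fun v hv => (Finset.mem_filter.1 (hSA hv)).2
  -- Genericity: no inequality outside the chosen basis is active.
  have hactive : ∀ v ∈ R, ⟪v, y⟫ = -g v → v ∈ S := fun v hv h => by
    by_contra hvS
    exact hgen S hSR hli hcard v hv hvS y hSy h
  refine ⟨S, hSR, hli, hcard, ⟨y, hSy, fun v hv hvS => lt_of_le_of_ne (hyQ v hv) fun h =>
    hvS (hactive v hv h.symm)⟩, ?_⟩
  obtain ⟨a, ha⟩ := exists_repr hli hcard w
  refine mem_coneOn_finset.2 ⟨a, fun v hv => ?_, ha⟩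
  -- `u` is the edge direction that leaves the inequality of `v` and keeps the others of `S` active.
  -- Optimality of `y` along it says `0 ≤ ⟪w, u⟫ = a v`.
  obtain ⟨u, hu⟩ := exists_inner_eq hli fun x => if x = v then 1 else 0
  obtain ⟨t, ht1, ht⟩ := ((eventually_add_smul_mem_halfSpaces (u := u) hyQ fun x hx h => by
    rw [hu x (hactive x hx h)]; split_ifs <;> norm_num).and self_mem_nhdsWithin).exists
  have h1 := hymin.2 _ ht1
  have h2 : ⟪w, u⟫ = a v := by
    rw [ha, sum_inner, Finset.sum_eq_single_of_mem v hv]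
    · rw [real_inner_smul_left, hu v hv]; simp
    · intro x hx hxv
      rw [real_inner_smul_left, hu x hx]; simp [hxv]
  rw [inner_add_right, real_inner_smul_right, h2] at h1
  exact nonneg_of_mul_nonneg_right (by linarith) (show 0 < t from ht)

omit [FiniteDimensional ℝ E] in
-- For `x` in both cones, its expansion in `S'` gives `⟪x, y'⟫ ≤ ⟪x, y⟫`, and the expansion in `S`
-- gives the reverse. Equality holds termwise, and strictness outside `S'` kills the coefficients
-- there.
lemma coneOn_inter_subset [DecidableEq E] {R S S' : Finset E} {g : E → ℝ} {y y' : E} (hS : S ⊆ R)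
    (hS' : S' ⊆ R) (hy : ∀ v ∈ S, ⟪v, y⟫ = -g v) (hy' : ∀ v ∈ S', ⟪v, y'⟫ = -g v)
    (hlt : ∀ v ∈ R, v ∉ S → -g v < ⟪v, y⟫) (hlt' : ∀ v ∈ R, v ∉ S' → -g v < ⟪v, y'⟫) :
    coneOn (S : Set E) ∩ coneOn (S' : Set E) ⊆ coneOn ((S ∩ S' : Finset E) : Set E) := by
  rintro x ⟨hx, hx'⟩
  obtain ⟨a, ha, hxa⟩ := mem_coneOn_finset.1 hx
  obtain ⟨b, hb, hxb⟩ := mem_coneOn_finset.1 hx'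
  have hle : ∀ v ∈ R, -g v ≤ ⟪v, y⟫ := fun v hv => by
    by_cases h : v ∈ S
    · exact (hy v h).ge
    · exact (hlt v hv h).le
  have hle' : ∀ v ∈ R, -g v ≤ ⟪v, y'⟫ := fun v hv => by
    by_cases h : v ∈ S'
    · exact (hy' v h).ge
    · exact (hlt' v hv h).le
  have h1 : ⟪x, y'⟫ ≤ ⟪x, y⟫ := by
    rw [hxb, sum_inner, sum_inner]
    refine Finset.sum_le_sum fun v hv => ?_
    rw [real_inner_smul_left, real_inner_smul_left, hy' v hv]
    exact mul_le_mul_of_nonneg_left (hle v (hS' hv)) (hb v hv)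
  have h2 : ∀ v ∈ S, a v * ⟪v, y⟫ ≤ a v * ⟪v, y'⟫ := fun v hv => by
    rw [hy v hv]
    exact mul_le_mul_of_nonneg_left (hle' v (hS hv)) (ha v hv)
  have h3 : ∑ v ∈ S, a v * ⟪v, y⟫ = ∑ v ∈ S, a v * ⟪v, y'⟫ := by
    refine le_antisymm (Finset.sum_le_sum h2) ?_
    rw [hxa, sum_inner, sum_inner] at h1
    simpa only [real_inner_smul_left] using h1
  have h4 := (Finset.sum_eq_sum_iff_of_le h2).1 h3
  refine mem_coneOn_finset.2 ⟨a, fun v hv => ha v (Finset.mem_inter.1 hv).1, ?_⟩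
  rw [hxa]
  symm
  refine Finset.sum_subset Finset.inter_subset_left fun v hv hv' => ?_
  have hvS' : v ∉ S' := fun h => hv' (Finset.mem_inter.2 ⟨hv, h⟩)
  have h5 := h4 v hv
  rw [hy v hv] at h5
  have h6 := hlt' v (hS hv) hvS'
  rcases mul_eq_mul_left_iff.1 h5 with h | h
  · exact absurd h h6.ne
  · rw [h, zero_smul]

/-- The facet inequalities are relaxed by distinct powers of a small `t`. The perturbed polyhedron
is bounded and simple, and the cones of its vertices form the triangulation. Their generators are
original rays because no new inequalities enter. -/
theorem exists_isTriangulation {Q : Set E} (hQ : IsPolytope Q) (hint : (interior Q).Nonempty) :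
    ∃ T, IsTriangulation (normalFan Q) T := by
  classical
  have hcomp := hQ.isCompact
  have hfin := finite_rayGens hQ
  obtain ⟨c, hc⟩ := id hint
  let R := hfin.toFinset
  have hR : ∀ {v}, v ∈ R ↔ v ∈ rayGens (normalFan Q) := hfin.mem_toFinset
  let h := supportFn Q
  let k : E → ℕ := fun v => if hv : v ∈ R then R.equivFin ⟨v, hv⟩ + 1 else 1
  have hk0 : ∀ v, k v ≠ 0 := fun v => by simp only [k]; split_ifs <;> omega
  have hk : Set.InjOn k R := by
    intro v hv w hw hvw
    have hv : v ∈ R := hv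
    have hw : w ∈ R := hw
    simp only [k, hv, hw, dif_pos, add_left_inj] at hvw
    simpa using R.equivFin.injective (Fin.ext hvw)
  let IsB : Finset E → Prop := fun S =>
    LinearIndepOn ℝ id (S : Set E) ∧ S.card = Module.finrank ℝ E
  choose! rep hrep using fun (S : Finset E) (hS : IsB S) => exists_repr hS.1 hS.2
  let B := R.powerset.filter IsB
  have hB : ∀ S ∈ B, S ⊆ R ∧ IsB S := fun S hS => by simpa [B] using hS
  -- Genericity: at the point determined by a basis no other inequality is active.
  have e1 : ∀ᶠ t in 𝓝[>] (0 : ℝ), ∀ S ∈ B, ∀ v ∈ R, v ∉ S →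
      h v + t ^ k v ≠ ∑ u ∈ S, rep S v u * (h u + t ^ k u) := by
    refine (Filter.eventually_all_finset B).2 fun S hS =>
      (Filter.eventually_all_finset R).2 fun v hv => ?_
    by_cases hvS : v ∈ S
    · exact Filter.Eventually.of_forall fun t h => absurd hvS h
    · filter_upwards [eventually_add_pow_ne hk hk0 (hB S hS).1 hv hvS h (rep S v)] with t ht _
        using ht
  -- A strict violation for the unperturbed right-hand side persists, so a basis feasible after
  -- perturbation is feasible before it.
  have e2 : ∀ᶠ t in 𝓝[>] (0 : ℝ), ∀ S ∈ B, ∀ v ∈ R, h v < ∑ u ∈ S, rep S v u * h u →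
      h v + t ^ k v < ∑ u ∈ S, rep S v u * (h u + t ^ k u) := by
    refine (Filter.eventually_all_finset B).2 fun S hS =>
      (Filter.eventually_all_finset R).2 fun v hv => ?_
    by_cases hlt : h v < ∑ u ∈ S, rep S v u * h u
    · have hcont : Continuous fun t : ℝ =>
          ∑ u ∈ S, rep S v u * (h u + t ^ k u) - (h v + t ^ k v) := by fun_prop
      have := (hcont.tendsto 0).eventually (lt_mem_nhds (a := 0) (by simpa [hk0] using hlt))
      filter_upwards [nhdsWithin_le_nhds this] with t ht _
      linarith
    · exact Filter.Eventually.of_forall fun t h => absurd h hlt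
  -- The relaxation is less than the distance term of the interior point `c`, which keeps the
  -- perturbed polyhedron inside `2 • Q - c`.
  have e3 : ∀ᶠ t in 𝓝[>] (0 : ℝ), ∀ v ∈ R, h v + t ^ k v + ⟪v, c⟫ < 2 * (h v + ⟪v, c⟫) := by
    refine (Filter.eventually_all_finset R).2 fun v hv => ?_
    have hv0 : v ≠ 0 := fun h0 => by
      have := (hR.1 hv).1
      rw [h0, norm_zero] at this
      norm_num at this
    have hpos := supportFn_pos_of_mem_interior hcomp hc hv0
    have hcont : Continuous fun t : ℝ => 2 * (h v + ⟪v, c⟫) - (h v + t ^ k v + ⟪v, c⟫) := by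
      fun_prop
    have := (hcont.tendsto 0).eventually (lt_mem_nhds (a := 0) (by
      simp only [h, ne_eq, hk0, not_false_eq_true, zero_pow]; linarith))
    filter_upwards [nhdsWithin_le_nhds this] with t ht
    linarith
  obtain ⟨t, ⟨⟨h1, h2⟩, h3⟩, ht⟩ := (((e1.and e2).and e3).and self_mem_nhdsWithin).exists
  have ht : 0 < t := ht
  let g : E → ℝ := fun v => h v + t ^ k v
  have hval : ∀ S ∈ B, ∀ (f : E → ℝ) (y : E), (∀ u ∈ S, ⟪u, y⟫ = -f u) →
      ∀ v, ⟪v, y⟫ = -∑ u ∈ S, rep S v u * f u := by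
    intro S hS f y hy v
    conv_lhs => rw [hrep S (hB S hS).2 v]
    rw [sum_inner, ← Finset.sum_neg_distrib]
    refine Finset.sum_congr rfl fun u hu => ?_
    rw [real_inner_smul_left, hy u hu, mul_neg]
  have hQsub : Q ⊆ halfSpaces R g := fun y hy v _ => by
    have h4 := neg_inner_le_supportFn hcomp hy v
    have h5 : 0 < t ^ k v := by positivity
    simp only [g, h]; linarith
  have hgcomp : IsCompact (halfSpaces R g) := by
    refine (hcomp.image (f := fun y => (2 : ℝ) • y - c) (by fun_prop)).of_isClosed_subset
      (isClosed_halfSpaces R g) fun y hy => ?_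
    refine ⟨(1 / 2 : ℝ) • (y + c), mem_of_forall_rayGens hQ hint fun v hv => ?_, by
      simp only []; module⟩
    have h4 := h3 v (hR.2 hv)
    have h5 := hy v (hR.2 hv)
    rw [real_inner_smul_right, inner_add_right]
    simp only [g, h] at h4 h5
    linarith
  let T := B.filter fun S => ∃ y, (∀ v ∈ S, ⟪v, y⟫ = -g v) ∧ ∀ v ∈ R, v ∉ S → -g v < ⟪v, y⟫
  have hT : ∀ S ∈ T, S ∈ B ∧
      ∃ y, (∀ v ∈ S, ⟪v, y⟫ = -g v) ∧ ∀ v ∈ R, v ∉ S → -g v < ⟪v, y⟫ :=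
    fun S hS => Finset.mem_filter.1 hS
  refine ⟨T, ⟨fun S hS v hv => hR.1 ((hB S (hT S hS).1).1 hv), fun S hS => (hB S (hT S hS).1).2.1,
    fun S hS => (hB S (hT S hS).1).2.2, fun S hS S' hS' => ?_, fun S hS => ?_, ?_⟩⟩
  · obtain ⟨hSB, y, hy, hlt⟩ := hT S hS
    obtain ⟨hSB', y', hy', hlt'⟩ := hT S' hS'
    convert Set.Subset.antisymm
      (coneOn_inter_subset (hB S hSB).1 (hB S' hSB').1 hy hy' hlt hlt')
      (Set.subset_inter (coneOn_mono (by simp)) (coneOn_mono (by simp))) using 3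
  · obtain ⟨hSB, y, hy, hlt⟩ := hT S hS
    -- `x` is the vertex of `Q` to which the perturbed vertex degenerates; the whole cone on `S` is
    -- normal to `Q` at `x`.
    obtain ⟨x, hx⟩ := exists_inner_eq (hB S hSB).2.1 fun v => -h v
    have hxQ : x ∈ Q := by
      refine mem_of_forall_rayGens hQ hint fun v hv => ?_
      have hvR := hR.2 hv
      by_cases hvS : v ∈ S
      · rw [hx v hvS, neg_neg]
      by_contra! hcon
      rw [hval S hSB h x hx v, neg_neg] at hcon
      have h4 := h2 S hSB v hvR hcon
      have h5 := hlt v hvR hvS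
      rw [hval S hSB g y hy v, neg_lt_neg_iff] at h5
      exact lt_asymm h4 h5
    exact ⟨faceCone Q (∑ v ∈ S, v), (mem_normalFan_iff hcomp hQ.nonempty).2 ⟨_, rfl⟩,
      coneOn_subset_faceCone (subset_faceCone_sum hxQ fun v hv =>
        (mem_minFace_iff hcomp).2 ⟨hxQ, by rw [hx v hv, neg_neg]⟩)⟩
  · rw [sUnion_normalFan hcomp hQ.nonempty]
    refine Set.eq_univ_of_forall fun w => ?_
    obtain ⟨S, hSR, hli, hcard, hy, hw⟩ := exists_optimal_basis hgcomp (hQ.nonempty.mono hQsub)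
      (fun S hSR hli hcard v hv hvS y hy he => by
        have hSB : S ∈ B := by simp only [B, Finset.mem_filter, Finset.mem_powerset]; exact ⟨hSR, hli, hcard⟩
        rw [hval S hSB g y hy v, neg_inj] at he
        exact h1 S hSB v hv hvS he.symm) w
    exact Set.mem_biUnion (x := S) (by
      simp only [T, B, Finset.mem_filter, Finset.mem_powerset, Finset.coe_filter, Set.mem_ofPred_eq]
      exact ⟨⟨hSR, hli, hcard⟩, hy⟩) hw

end Triangulations

/-! ### Triangulation sums as volumes -/

section Tilings

variable {E : Type*} [NormedAddCommGroup E] [InnerProductSpace ℝ E]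

/-- A family of simplicial cones with disjoint interiors that covers the space, up to finitely many
cones of smaller dimension. -/
structure IsTiling (T : Finset (Finset E)) : Prop where
  linearIndep : ∀ S ∈ T, LinearIndepOn ℝ id (S : Set E)
  fullDim : ∀ S ∈ T, S.card = Module.finrank ℝ E
  inter : ∀ S ∈ T, ∀ S' ∈ T, S ≠ S' →
    coneOn (S : Set E) ∩ coneOn (S' : Set E) ⊆ coneOn ((S : Set E) ∩ S')
  cover : ∃ T' : Finset (Finset E), (∀ S ∈ T', S.card < Module.finrank ℝ E) ∧
    ∀ x, ∃ S, (S ∈ T ∨ S ∈ T') ∧ x ∈ coneOn (S : Set E)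

/-- The function `u` is linear on each cone of `T`. -/
def ConewiseLinear (T : Finset (Finset E)) (u : E → ℝ) : Prop :=
  ∀ S ∈ T, ∃ y, ∀ v ∈ coneOn (S : Set E), u v = ⟪v, y⟫

open Classical in
/-- The function `δ` is the absolute value of a determinant, up to a constant factor. -/
def IsDet (δ : Finset E → ℝ) : Prop :=
  ∃ (b : Module.Basis (Fin (Module.finrank ℝ E)) ℝ E) (c : ℝ),
    ∀ e : Fin (Module.finrank ℝ E) → E, Function.Injective e →
      δ (Finset.univ.image e) = c * |b.det e|

variable {n : ℕ}

/-- The simplex spanned by the origin and a basis. -/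
def basisSimplex (b : Module.Basis (Fin n) ℝ E) : Set E :=
  {x | (∀ i, 0 ≤ b.repr x i) ∧ ∑ i, b.repr x i ≤ 1}

lemma continuous_repr (b : Module.Basis (Fin n) ℝ E) (i : Fin n) :
    Continuous fun x => b.repr x i := by
  have : FiniteDimensional ℝ E := b.finiteDimensional_of_finite
  exact LinearMap.continuous_of_finiteDimensional (b.coord i)

lemma isCompact_basisSimplex (b : Module.Basis (Fin n) ℝ E) : IsCompact (basisSimplex b) := by
  refine b.parallelepiped.isCompact.of_isClosed_subset ?_ ?_
  · have : basisSimplex b = (⋂ i, {x | 0 ≤ b.repr x i}) ∩ {x | ∑ i, b.repr x i ≤ 1} := by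
      ext; simp [basisSimplex]
    rw [this]
    exact (isClosed_iInter fun i => isClosed_le continuous_const (continuous_repr b i)).inter
      (isClosed_le (continuous_finsetSum _ fun i _ => continuous_repr b i) continuous_const)
  · intro x hx
    rw [Module.Basis.coe_parallelepiped, parallelepiped_basis_eq]
    exact fun i => ⟨hx.1 i,
      (Finset.single_le_sum (fun j _ => hx.1 j) (Finset.mem_univ i)).trans hx.2⟩

lemma interior_basisSimplex_nonempty (b : Module.Basis (Fin n) ℝ E) :
    (interior (basisSimplex b)).Nonempty := by
  let U : Set E := {x | (∀ i, 0 < b.repr x i) ∧ ∑ i, b.repr x i < 1}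
  have hU : IsOpen U := by
    have : U = (⋂ i, {x | 0 < b.repr x i}) ∩ {x | ∑ i, b.repr x i < 1} := by
      ext; simp [U]
    rw [this]
    exact (isOpen_iInter_of_finite fun i => isOpen_lt continuous_const (continuous_repr b i)).inter
      (isOpen_lt (continuous_finsetSum _ fun i _ => continuous_repr b i) continuous_const)
  -- Dividing by `n + 1` and not by `n` keeps the sum of the coordinates below 1.
  refine ⟨∑ i, ((n : ℝ) + 1)⁻¹ • b i, interior_maximal
    (show U ⊆ basisSimplex b from fun x hx => ⟨fun i => (hx.1 i).le, hx.2.le⟩) hU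
    (show _ ∈ U from ?_)⟩
  have hpos : (0 : ℝ) < n + 1 := by positivity
  have h : ∀ i, b.repr (∑ i, ((n : ℝ) + 1)⁻¹ • b i) i = ((n : ℝ) + 1)⁻¹ := fun i => by
    rw [← b.equivFun_symm_apply fun _ => ((n : ℝ) + 1)⁻¹, ← b.equivFun_apply,
      LinearEquiv.apply_symm_apply]
  refine ⟨fun i => by rw [h]; positivity, ?_⟩
  simp only [h, Finset.sum_const, Finset.card_univ, Fintype.card_fin, nsmul_eq_mul]
  rw [← div_eq_mul_inv, div_lt_one hpos]
  linarith

/-- The vertices of the truncated cone are the origin and the points `(u (e i))⁻¹ • e i`, as `u` is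
linear on the cone. -/
lemma image_basisSimplex (b : Module.Basis (Fin n) ℝ E) {e : Fin n → E}
    (he : Function.Injective e) {S : Finset E} (hS : (S : Set E) = Set.range e) {u : E → ℝ} {y : E}
    (hu : ∀ v ∈ coneOn (S : Set E), u v = ⟪v, y⟫) (hpos : ∀ v ∈ S, 0 < u v) :
    b.constr ℝ (fun i => (u (e i))⁻¹ • e i) '' basisSimplex b =
      {x | x ∈ coneOn (S : Set E) ∧ u x ≤ 1} := by
  classical
  have heS : ∀ i, e i ∈ S := fun i => by
    rw [← Finset.mem_coe, hS]; exact Set.mem_range_self i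
  have hSim : S = Finset.univ.image e := by
    rw [← Finset.coe_inj, hS]; simp
  have hue : ∀ i, ⟪e i, y⟫ = u (e i) := fun i => (hu _ (subset_coneOn _ (heS i))).symm
  have hcone : ∀ a : Fin n → ℝ, (∀ i, 0 ≤ a i) → ∑ i, a i • e i ∈ coneOn (S : Set E) := by
    intro a ha
    refine Submodule.sum_mem _ fun i _ => ?_
    exact PointedCone.smul_mem _ (ha i) (subset_coneOn _ (heS i))
  have hval : ∀ a : Fin n → ℝ, (∀ i, 0 ≤ a i) →
      u (∑ i, a i • e i) = ∑ i, a i * u (e i) := by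
    intro a ha
    rw [hu _ (hcone a ha), sum_inner]
    simp only [real_inner_smul_left, hue]
  have hL : ∀ z, b.constr ℝ (fun i => (u (e i))⁻¹ • e i) z =
      ∑ i, (b.repr z i * (u (e i))⁻¹) • e i := by
    intro z
    rw [Module.Basis.constr_apply_fintype]
    simp only [smul_smul, Module.Basis.equivFun_apply]
  ext x
  constructor
  · rintro ⟨z, hz, rfl⟩
    have h0 : ∀ i, 0 ≤ b.repr z i * (u (e i))⁻¹ := fun i =>
      mul_nonneg (hz.1 i) (inv_nonneg.2 (hpos _ (heS i)).le)
    refine ⟨by rw [hL]; exact hcone _ h0, ?_⟩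
    rw [hL, hval _ h0]
    refine le_trans (le_of_eq (Finset.sum_congr rfl fun i _ => ?_)) hz.2
    rw [mul_assoc, inv_mul_cancel₀ (hpos _ (heS i)).ne', mul_one]
  · rintro ⟨hx, hx1⟩
    obtain ⟨a, ha, rfl⟩ := mem_coneOn_finset.1 hx
    have hsum : ∑ v ∈ S, a v • v = ∑ i, a (e i) • e i := by
      rw [hSim, Finset.sum_image fun i _ j _ h => he h]
    rw [hsum, hval _ fun i => ha _ (heS i)] at hx1
    have hr : ∀ i, b.repr (∑ j, (a (e j) * u (e j)) • b j) i = a (e i) * u (e i) := fun i => by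
      rw [← b.equivFun_symm_apply, ← b.equivFun_apply, LinearEquiv.apply_symm_apply]
    refine ⟨∑ i, (a (e i) * u (e i)) • b i,
      ⟨fun i => by rw [hr]; exact mul_nonneg (ha _ (heS i)) (hpos _ (heS i)).le,
        by simpa only [hr] using hx1⟩, ?_⟩
    rw [hL, hsum]
    refine Finset.sum_congr rfl fun i _ => ?_
    rw [hr, mul_assoc, mul_inv_cancel₀ (hpos _ (heS i)).ne', mul_one]

open MeasureTheory

lemma measure_coneOn_eq_zero [FiniteDimensional ℝ E] [MeasurableSpace E] [BorelSpace E]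
    (μ : Measure E) [μ.IsAddHaarMeasure] {S : Finset E} (hS : S.card < Module.finrank ℝ E) :
    μ (coneOn (S : Set E)) = 0 := by
  refine measure_mono_null (PointedCone.hull_le_span (R := ℝ) (S : Set E))
    (Measure.addHaar_submodule μ _ fun h => ?_)
  have h1 := finrank_span_finset_le_card (R := ℝ) S
  rw [Set.finrank, h, finrank_top] at h1
  omega

/-- The linear map onto the truncated cone has determinant `b.det e / ∏ u`. So a term of the
triangulation sum is the volume of a truncated cone. -/
lemma measure_cone_simplex [MeasurableSpace E] [BorelSpace E] (b : Module.Basis (Fin n) ℝ E)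
    {e : Fin n → E} (he : Function.Injective e) {S : Finset E} (hS : (S : Set E) = Set.range e)
    {u : E → ℝ} {y : E} (hu : ∀ v ∈ coneOn (S : Set E), u v = ⟪v, y⟫) (hpos : ∀ v ∈ S, 0 < u v) :
    b.addHaar {x | x ∈ coneOn (S : Set E) ∧ u x ≤ 1} =
      ENNReal.ofReal (|b.det e| / ∏ v ∈ S, u v) * b.addHaar (basisSimplex b) := by
  classical
  have : FiniteDimensional ℝ E := b.finiteDimensional_of_finite
  have hSim : S = Finset.univ.image e := by
    rw [← Finset.coe_inj, hS]; simp
  rw [← image_basisSimplex b he hS hu hpos, Measure.addHaar_image_linearMap]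
  congr 2
  have h1 : LinearMap.det (b.constr ℝ (fun i => (u (e i))⁻¹ • e i)) =
      b.det (fun i => (u (e i))⁻¹ • e i) := by
    rw [← LinearMap.det_toMatrix b, Module.Basis.det_apply]
    congr 1
    ext i j
    simp [LinearMap.toMatrix_apply, Module.Basis.toMatrix_apply]
  rw [h1, AlternatingMap.map_smul_univ, smul_eq_mul, abs_mul, mul_comm, div_eq_mul_inv,
    Finset.prod_inv_distrib, abs_inv]
  congr 2
  rw [hSim, Finset.prod_image fun i _ j _ h => he h]
  refine abs_of_pos (Finset.prod_pos fun i _ => hpos _ ?_)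
  rw [hSim]; exact Finset.mem_image_of_mem e (Finset.mem_univ i)

omit [NormedAddCommGroup E] [InnerProductSpace ℝ E] in
lemma exists_enum {S : Finset E} (h : S.card = n) :
    ∃ e : Fin n → E, Function.Injective e ∧ (S : Set E) = Set.range e :=
  ⟨fun i => (S.equivFinOfCardEq h).symm i,
    fun i j hij => (S.equivFinOfCardEq h).symm.injective (Subtype.ext hij), by
      ext v
      exact ⟨fun hv => ⟨S.equivFinOfCardEq h ⟨v, hv⟩, by simp⟩, by rintro ⟨i, rfl⟩; simp⟩⟩

/-- The truncated cones fill the sublevel set of `u` up to null sets. The right-hand side involves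
no tiling, which is the whole reason for independence. -/
lemma triangulationSum_eq_measure [MeasurableSpace E] [BorelSpace E] {δ : Finset E → ℝ}
    {b : Module.Basis (Fin (Module.finrank ℝ E)) ℝ E} {c : ℝ}
    (hδ : ∀ e : Fin (Module.finrank ℝ E) → E, Function.Injective e → ∀ S : Finset E,
      (S : Set E) = Set.range e → δ S = c * |b.det e|)
    {T : Finset (Finset E)} (hT : IsTiling T) {u : E → ℝ} (hu : ConewiseLinear T u)
    (hpos : ∀ S ∈ T, ∀ v ∈ S, 0 < u v) :
    triangulationSum δ T u =
      c * ((b.addHaar {x | u x ≤ 1}).toReal / (b.addHaar (basisSimplex b)).toReal) := by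
  classical
  have : FiniteDimensional ℝ E := b.finiteDimensional_of_finite
  have hκ : b.addHaar (basisSimplex b) ≠ ⊤ := (isCompact_basisSimplex b).measure_lt_top.ne
  have hκ0 : 0 < (b.addHaar (basisSimplex b)).toReal :=
    ENNReal.toReal_pos (MeasureTheory.Measure.measure_pos_of_nonempty_interior _
      (interior_basisSimplex_nonempty b)).ne' hκ
  let A : Finset E → Set E := fun S => {x | x ∈ coneOn (S : Set E) ∧ u x ≤ 1}
  have hA : ∀ S ∈ T, IsCompact (A S) ∧ ∃ e : Fin (Module.finrank ℝ E) → E,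
      Function.Injective e ∧ (S : Set E) = Set.range e ∧
      b.addHaar (A S) =
        ENNReal.ofReal (|b.det e| / ∏ v ∈ S, u v) * b.addHaar (basisSimplex b) := by
    intro S hS
    obtain ⟨e, he, hSe⟩ := exists_enum (hT.fullDim S hS)
    obtain ⟨y, hy⟩ := hu S hS
    refine ⟨?_, e, he, hSe, measure_cone_simplex b he hSe hy (hpos S hS)⟩
    simp only [A]
    rw [← image_basisSimplex b he hSe hy (hpos S hS)]
    exact (isCompact_basisSimplex b).image (LinearMap.continuous_of_finiteDimensional _)
  have hdisj : (T : Set (Finset E)).Pairwise (Function.onFun (AEDisjoint b.addHaar) A) := by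
    intro S hS S' hS' hne
    -- Distinct cones share fewer generators than the dimension, so their intersection lies in a
    -- proper subspace.
    have hlt : (S ∩ S').card < Module.finrank ℝ E := by
      rw [← hT.fullDim S hS]
      refine Finset.card_lt_card (Finset.inter_subset_left.ssubset_of_ne fun h => hne ?_)
      exact Finset.eq_of_subset_of_card_le (Finset.inter_eq_left.1 h)
        (by rw [hT.fullDim S hS, hT.fullDim S' hS'])
    exact measure_mono_null (fun x hx => by
      rw [Finset.coe_inter]
      exact hT.inter S hS S' hS' hne ⟨hx.1.1, hx.2.1⟩) (measure_coneOn_eq_zero _ hlt)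
  have hunion : b.addHaar {x | u x ≤ 1} = ∑ S ∈ T, b.addHaar (A S) := by
    rw [← measure_biUnion_finset₀ hdisj fun S hS => (hA S hS).1.measurableSet.nullMeasurableSet]
    refine le_antisymm ?_ (measure_mono (Set.iUnion₂_subset fun S _ x hx => hx.2))
    obtain ⟨T', hT', hcov⟩ := hT.cover
    have h0 : b.addHaar (⋃ S ∈ T', coneOn (S : Set E)) = 0 :=
      (measure_biUnion_null_iff T'.countable_toSet).2 fun S hS =>
        measure_coneOn_eq_zero _ (hT' S hS)
    calc b.addHaar {x | u x ≤ 1}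
        ≤ b.addHaar ((⋃ S ∈ T, A S) ∪ ⋃ S ∈ T', coneOn (S : Set E)) := measure_mono fun x hx => by
          obtain ⟨S, hS, hxS⟩ := hcov x
          rcases hS with h | h
          · exact Or.inl (Set.mem_biUnion (x := S) h ⟨hxS, hx⟩)
          · exact Or.inr (Set.mem_biUnion (x := S) h hxS)
      _ ≤ b.addHaar (⋃ S ∈ T, A S) + b.addHaar (⋃ S ∈ T', coneOn (S : Set E)) :=
          measure_union_le _ _
      _ = b.addHaar (⋃ S ∈ T, A S) := by rw [h0, add_zero]
  rw [hunion, ENNReal.toReal_sum fun S hS => (hA S hS).1.measure_lt_top.ne, Finset.sum_div,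
    Finset.mul_sum, triangulationSum]
  refine Finset.sum_congr rfl fun S hS => ?_
  obtain ⟨-, e, he, hSe, hm⟩ := hA S hS
  have h0 : 0 ≤ |b.det e| / ∏ v ∈ S, u v :=
    div_nonneg (abs_nonneg _) (Finset.prod_nonneg fun v hv => (hpos S hS v hv).le)
  rw [hm, ENNReal.toReal_mul, ENNReal.toReal_ofReal h0, mul_div_assoc, div_self hκ0.ne', mul_one,
    hδ e he S hSe, Algebra.algebraMap_self, RingHom.id_apply, mul_div_assoc]

theorem triangulationSum_eq_of_pos {δ : Finset E → ℝ} (hδ : IsDet δ) {T T' : Finset (Finset E)}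
    (hT : IsTiling T) (hT' : IsTiling T') {u : E → ℝ} (hu : ConewiseLinear T u)
    (hu' : ConewiseLinear T' u) (hpos : ∀ S ∈ T, ∀ v ∈ S, 0 < u v)
    (hpos' : ∀ S ∈ T', ∀ v ∈ S, 0 < u v) :
    triangulationSum δ T u = triangulationSum δ T' u := by
  classical
  obtain ⟨b, c, hb⟩ := hδ
  let _ : MeasurableSpace E := borel E
  have : BorelSpace E := ⟨rfl⟩
  have hδ' : ∀ e : Fin (Module.finrank ℝ E) → E, Function.Injective e → ∀ S : Finset E,
      (S : Set E) = Set.range e → δ S = c * |b.det e| := fun e he S hS => by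
    rw [← hb e he]
    congr 1
    rw [← Finset.coe_inj, hS]; simp
  rw [triangulationSum_eq_measure hδ' hT hu hpos, triangulationSum_eq_measure hδ' hT' hu' hpos']

end Tilings

/-! ### From numerical identities to rational functions -/

section RationalIdentities

lemma mvPolynomial_eq_of_eqOn_open {σ : Type*} [Finite σ] {a b : MvPolynomial σ ℝ}
    {U : Set (σ → ℝ)} (hU : IsOpen U) (hne : U.Nonempty)
    (h : ∀ x ∈ U, MvPolynomial.eval x a = MvPolynomial.eval x b) : a = b := by
  have := Fintype.ofFinite σ
  obtain ⟨x, hx⟩ := hne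
  obtain ⟨r, hr, hball⟩ := Metric.isOpen_iff.1 hU x hx
  refine MvPolynomial.funext_set (fun i => Metric.ball (x i) r)
    (fun i => (Real.ball_eq_Ioo (x i) r).symm ▸ Set.Ioo_infinite (by linarith)) fun y hy => ?_
  refine h y (hball ?_)
  rw [ball_pi x hr]
  exact hy

/-- The reduced denominator divides `b`, so it does not vanish at `φ` either, and any fraction with
nonvanishing denominator may be used. -/
lemma RatFn.subst_eq_div {σ L : Type*} [Field L] [Algebra ℝ L] {W : RatFn σ}
    {a b : MvPolynomial σ ℝ}
    (hW : W = algebraMap _ (RatFn σ) a / algebraMap _ (RatFn σ) b) {φ : σ → L}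
    (hb : MvPolynomial.aeval φ b ≠ 0) :
    W.subst φ = MvPolynomial.aeval φ a / MvPolynomial.aeval φ b := by
  have hinj := IsFractionRing.injective (MvPolynomial σ ℝ) (RatFn σ)
  have hb0 : b ≠ 0 := by rintro rfl; simp at hb
  set n := IsFractionRing.num (MvPolynomial σ ℝ) W with hn
  set m : MvPolynomial σ ℝ := (IsFractionRing.den (MvPolynomial σ ℝ) W : MvPolynomial σ ℝ) with hm
  have hm0 : m ≠ 0 := nonZeroDivisors.ne_zero (IsFractionRing.den (MvPolynomial σ ℝ) W).2
  have h1 : algebraMap _ (RatFn σ) n / algebraMap _ (RatFn σ) m = W := by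
    rw [hn, hm, ← IsFractionRing.mk'_eq_div, IsFractionRing.mk'_num_den]
  have h2 : n * b = a * m := by
    apply hinj
    rw [hW, div_eq_div_iff (by simpa using hm0) (by simpa using hb0)] at h1
    rw [map_mul, map_mul, h1]
  have h3 : m ∣ b := (IsFractionRing.num_den_reduced (MvPolynomial σ ℝ) W).symm.dvd_of_dvd_mul_left
    ⟨a, by rw [h2, mul_comm]⟩
  have h4 : MvPolynomial.aeval φ m ≠ 0 := by
    obtain ⟨k, hk⟩ := h3
    intro h0
    rw [hk, map_mul, h0, zero_mul] at hb
    exact hb rfl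
  rw [RatFn.subst, div_eq_div_iff h4 hb, ← map_mul, ← map_mul, h2]

lemma aeval_var {σ : Type*} (q : MvPolynomial σ ℝ) :
    MvPolynomial.aeval (var : σ → RatFn σ) q = algebraMap _ (RatFn σ) q := by
  have : MvPolynomial.aeval (var : σ → RatFn σ) =
      (Algebra.algHom ℝ (MvPolynomial σ ℝ) (RatFn σ)) :=
    MvPolynomial.algHom_ext fun i => by simp only [MvPolynomial.aeval_X]; rfl
  rw [this]; rfl

variable {E : Type*}

open Classical in
/-- All generators of the cones in `T`. -/
noncomputable def allGens (T : Finset (Finset E)) : Finset E := T.biUnion id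

lemma mem_allGens {T : Finset (Finset E)} {v : E} : v ∈ allGens T ↔ ∃ S ∈ T, v ∈ S := by
  simp [allGens]

lemma subset_allGens {T : Finset (Finset E)} {S : Finset E} (hS : S ∈ T) : S ⊆ allGens T :=
  fun _ hv => mem_allGens.2 ⟨S, hS, hv⟩

open Classical in
/-- The numerator of a triangulation sum for the common denominator `∏ v ∈ V, q v`. -/
noncomputable def sumNumerator {σ : Type*} (δ : Finset E → ℝ) (T : Finset (Finset E)) (V : Finset E)
    (q : E → MvPolynomial σ ℝ) : MvPolynomial σ ℝ :=
  ∑ S ∈ T, MvPolynomial.C (δ S) * ∏ v ∈ V \ S, q v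

/-- The same polynomial numerator serves every target `φ`, so a polynomial identity transfers to
numbers and to rational functions alike. -/
lemma triangulationSum_eq_div {σ L : Type*} [Field L] [Algebra ℝ L] (δ : Finset E → ℝ)
    {T : Finset (Finset E)} {V : Finset E} (hV : allGens T ⊆ V) (q : E → MvPolynomial σ ℝ)
    (φ : MvPolynomial σ ℝ →ₐ[ℝ] L) (hφ : ∀ v ∈ V, φ (q v) ≠ 0) :
    triangulationSum δ T (fun v => φ (q v)) =
      φ (sumNumerator δ T V q) / φ (∏ v ∈ V, q v) := by
  classical
  rw [triangulationSum, sumNumerator, map_sum, Finset.sum_div]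
  refine Finset.sum_congr rfl fun S hS => ?_
  have hSV := (subset_allGens hS).trans hV
  have h1 : φ (∏ v ∈ V \ S, q v) ≠ 0 := by
    rw [map_prod]
    exact Finset.prod_ne_zero_iff.2 fun v hv => hφ v (Finset.sdiff_subset hv)
  rw [← Finset.prod_sdiff hSV, map_mul, map_mul, mul_comm (φ (MvPolynomial.C _)),
    mul_div_mul_left _ _ h1, map_prod]
  congr 1
  rw [← MvPolynomial.algebraMap_eq, AlgHom.commutes]

/-- `RatFn.subst` is not a ring homomorphism; passing through a common denominator shows that it
acts term by term where no denominator vanishes. -/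
lemma subst_triangulationSum {σ L : Type*} [Field L] [Algebra ℝ L] (δ : Finset E → ℝ)
    {T : Finset (Finset E)} (q : E → MvPolynomial σ ℝ) (φ : σ → L)
    (hφ : ∀ S ∈ T, ∀ v ∈ S, MvPolynomial.aeval φ (q v) ≠ 0) :
    (triangulationSum δ T (fun v => MvPolynomial.aeval (var : σ → RatFn σ) (q v))).subst φ =
      triangulationSum δ T (fun v => MvPolynomial.aeval φ (q v)) := by
  have h1 : ∀ v ∈ allGens T, MvPolynomial.aeval φ (q v) ≠ 0 := fun v hv => by
    obtain ⟨S, hS, hvS⟩ := mem_allGens.1 hv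
    exact hφ S hS v hvS
  have h2 : ∀ v ∈ allGens T, MvPolynomial.aeval (var : σ → RatFn σ) (q v) ≠ 0 := fun v hv => by
    rw [aeval_var]
    intro h0
    have : q v = 0 := by simpa using h0
    exact h1 v hv (by rw [this, map_zero])
  rw [triangulationSum_eq_div δ subset_rfl q _ h1]
  refine RatFn.subst_eq_div ?_ (by rw [map_prod]; exact Finset.prod_ne_zero_iff.2 h1)
  rw [triangulationSum_eq_div δ subset_rfl q _ h2, aeval_var, aeval_var]

variable [NormedAddCommGroup E] [InnerProductSpace ℝ E]

/-- On `U` both sums are the same volume. Cleared of denominators this is a polynomial identity on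
an open set, hence everywhere, and it can be divided again after any `φ` that keeps the denominators
nonzero. -/
theorem triangulationSum_eq {σ L : Type*} [Finite σ] [Field L] [Algebra ℝ L] {δ : Finset E → ℝ}
    (hδ : IsDet δ) {T T' : Finset (Finset E)} (hT : IsTiling T) (hT' : IsTiling T')
    (q : E → MvPolynomial σ ℝ) {U : Set (σ → ℝ)} (hU : IsOpen U) (hne : U.Nonempty)
    (hlin : ∀ a ∈ U, ConewiseLinear T fun v => MvPolynomial.eval a (q v))
    (hlin' : ∀ a ∈ U, ConewiseLinear T' fun v => MvPolynomial.eval a (q v))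
    (hpos : ∀ a ∈ U, ∀ v ≠ 0, 0 < MvPolynomial.eval a (q v))
    (φ : MvPolynomial σ ℝ →ₐ[ℝ] L) (hφ : ∀ S ∈ T, ∀ v ∈ S, φ (q v) ≠ 0)
    (hφ' : ∀ S ∈ T', ∀ v ∈ S, φ (q v) ≠ 0) :
    triangulationSum δ T (fun v => φ (q v)) = triangulationSum δ T' (fun v => φ (q v)) := by
  have h0 : ∀ {T : Finset (Finset E)}, IsTiling T → ∀ S ∈ T, ∀ v ∈ S, v ≠ 0 := by
    rintro T hT S hS v hv rfl
    exact (hT.linearIndep S hS).ne_zero (show (0 : E) ∈ (S : Set E) from hv) rfl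
  have hall : ∀ {M : Type _} [Field M] [Algebra ℝ M] (T : Finset (Finset E))
      (φ : MvPolynomial σ ℝ →ₐ[ℝ] M), (∀ S ∈ T, ∀ v ∈ S, φ (q v) ≠ 0) →
      ∀ v ∈ allGens T, φ (q v) ≠ 0 := fun T φ h v hv => by
    obtain ⟨S, hS, hvS⟩ := mem_allGens.1 hv
    exact h S hS v hvS
  have key : sumNumerator δ T (allGens T) q * ∏ v ∈ allGens T', q v =
      sumNumerator δ T' (allGens T') q * ∏ v ∈ allGens T, q v := by
    refine mvPolynomial_eq_of_eqOn_open hU hne fun a ha => ?_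
    have hev : ∀ p, MvPolynomial.aeval a p = MvPolynomial.eval a p := fun p => by
      rw [MvPolynomial.aeval_eq_eval]
    have hp : ∀ v ∈ allGens T, MvPolynomial.aeval a (q v) ≠ 0 := fun v hv => by
      obtain ⟨S, hS, hvS⟩ := mem_allGens.1 hv
      rw [hev]; exact (hpos a ha v (h0 hT S hS v hvS)).ne'
    have hp' : ∀ v ∈ allGens T', MvPolynomial.aeval a (q v) ≠ 0 := fun v hv => by
      obtain ⟨S, hS, hvS⟩ := mem_allGens.1 hv
      rw [hev]; exact (hpos a ha v (h0 hT' S hS v hvS)).ne'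
    have h := triangulationSum_eq_of_pos hδ hT hT' (hlin a ha) (hlin' a ha)
      (fun S hS v hv => hpos a ha v (h0 hT S hS v hv))
      (fun S hS v hv => hpos a ha v (h0 hT' S hS v hv))
    simp only [← hev] at h
    rw [triangulationSum_eq_div δ subset_rfl q _ hp, triangulationSum_eq_div δ subset_rfl q _ hp',
      div_eq_div_iff (by rw [map_prod]; exact Finset.prod_ne_zero_iff.2 hp)
        (by rw [map_prod]; exact Finset.prod_ne_zero_iff.2 hp')] at h
    rw [← hev, ← hev, map_mul, map_mul, h]
  have hg := hall T φ hφ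
  have hg' := hall T' φ hφ'
  rw [triangulationSum_eq_div δ subset_rfl q φ hg, triangulationSum_eq_div δ subset_rfl q φ hg',
    div_eq_div_iff (by rw [map_prod]; exact Finset.prod_ne_zero_iff.2 hg)
      (by rw [map_prod]; exact Finset.prod_ne_zero_iff.2 hg'), ← map_mul, ← map_mul, key]

end RationalIdentities

/-! ### Affine forms and the determinant in coordinates -/

section Euclidean

variable {d : ℕ}

lemma sum_mul_eq_inner (v z : EuclideanSpace ℝ (Fin d)) : ∑ i, v i * z i = ⟪v, z⟫ := by
  rw [PiLp.inner_apply]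
  exact Finset.sum_congr rfl fun i _ => by simp [mul_comm]

lemma aeval_affForm {L : Type*} [Field L] [Algebra ℝ L] (P : Set (EuclideanSpace ℝ (Fin d)))
    (v : EuclideanSpace ℝ (Fin d)) (z : Fin d → L) :
    MvPolynomial.aeval z (affForm P v) =
      algebraMap ℝ L (supportFn P v) + ∑ i, algebraMap ℝ L (v i) * z i := by
  simp [affForm]

lemma eval_affForm (P : Set (EuclideanSpace ℝ (Fin d))) (v z : EuclideanSpace ℝ (Fin d)) :
    MvPolynomial.eval z (affForm P v) = supportFn P v + ⟪v, z⟫ := by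
  rw [← sum_mul_eq_inner]
  simp [affForm]

lemma affForm_ne_zero (P : Set (EuclideanSpace ℝ (Fin d))) {v : EuclideanSpace ℝ (Fin d)}
    (hv : v ≠ 0) : affForm P v ≠ 0 := by
  intro h
  have h1 := eval_affForm P v 0
  have h2 := eval_affForm P v v
  rw [h, map_zero, inner_zero_right] at h1
  rw [h, map_zero, real_inner_self_eq_norm_sq] at h2
  have := norm_pos_iff.2 hv
  nlinarith

/-- Two enumerations of `S` differ by a permutation, which changes the determinant only by its sign.
-/
lemma absDet_eq {S : Finset (EuclideanSpace ℝ (Fin d))} {e : Fin d → EuclideanSpace ℝ (Fin d)}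
    (he : Function.Injective e) (hS : (S : Set (EuclideanSpace ℝ (Fin d))) = Set.range e) :
    absDet S = |(Matrix.of fun i j => e i j).det| := by
  classical
  have hSim : S = Finset.univ.image e := by
    rw [← Finset.coe_inj, hS]; simp
  have hcard : S.card = d := by
    rw [hSim, Finset.card_image_of_injective _ he, Finset.card_univ, Fintype.card_fin]
  rw [absDet, dif_pos hcard]
  have hmem : ∀ i, ∃ j, e j = ((S.equivFinOfCardEq hcard).symm i : EuclideanSpace ℝ (Fin d)) :=
    fun i => by
      have : ((S.equivFinOfCardEq hcard).symm i : EuclideanSpace ℝ (Fin d)) ∈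
        (S : Set (EuclideanSpace ℝ (Fin d))) := ((S.equivFinOfCardEq hcard).symm i).2
      rwa [hS] at this
  choose f hf using hmem
  have hinj : Function.Injective f := fun i j h =>
    (S.equivFinOfCardEq hcard).symm.injective (Subtype.ext (by rw [← hf, ← hf, h]))
  let σ := Equiv.ofBijective f (Finite.injective_iff_bijective.1 hinj)
  have : (Matrix.of fun i j : Fin d =>
      ((S.equivFinOfCardEq hcard).symm i : EuclideanSpace ℝ (Fin d)) j) =
      (Matrix.of fun i j => e i j).submatrix σ id := by
    ext i j
    simp [σ, hf]
  rw [this, Matrix.det_permute, abs_mul]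
  rcases Int.units_eq_one_or (Equiv.Perm.sign σ) with h | h <;> simp [h]

lemma isDet_absDet : IsDet (absDet (d := d)) := by
  classical
  have hd : Module.finrank ℝ (EuclideanSpace ℝ (Fin d)) = d := finrank_euclideanSpace_fin
  refine ⟨(EuclideanSpace.basisFun (Fin d) ℝ).toBasis.reindex (finCongr hd.symm), 1,
    fun e he => ?_⟩
  rw [one_mul, Module.Basis.det_reindex, absDet_eq (e := e ∘ finCongr hd.symm)
    (he.comp (finCongr hd.symm).injective) (by
      rw [Function.Surjective.range_comp (finCongr hd.symm).surjective]; simp),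
    Module.Basis.det_apply, ← Matrix.det_transpose]
  rfl

end Euclidean

/-! ### Cones subordinate to a polytope, and linearity of support functions -/

section Subordinate

variable {E : Type*} [NormedAddCommGroup E] [InnerProductSpace ℝ E]

/-- Each cone of `T` is contained in the normal cone of a point of `Q`. -/
def Subordinate (T : Finset (Finset E)) (Q : Set E) : Prop :=
  ∀ S ∈ T, ∃ y, ∀ v ∈ coneOn (S : Set E), y ∈ minFace Q v

lemma IsTriangulation.subordinate' [FiniteDimensional ℝ E] {T : Finset (Finset E)} {Q : Set E}
    (hQ : IsPolytope Q) (hT : IsTriangulation (normalFan Q) T) : Subordinate T Q := by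
  intro S hS
  obtain ⟨C, hC, hSC⟩ := hT.subordinate S hS
  obtain ⟨w, rfl⟩ := (mem_normalFan_iff hQ.isCompact hQ.nonempty).1 hC
  obtain ⟨y, hy⟩ := minFace_nonempty hQ.isCompact hQ.nonempty w
  exact ⟨y, fun v hv => hSC hv hy⟩

lemma IsTriangulation.exists_mem [FiniteDimensional ℝ E] {T : Finset (Finset E)} {Q : Set E}
    (hQ : IsPolytope Q) (hT : IsTriangulation (normalFan Q) T) (x : E) :
    ∃ S ∈ T, x ∈ coneOn (S : Set E) := by
  have : x ∈ ⋃ S ∈ T, coneOn (S : Set E) := by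
    rw [hT.cover, sUnion_normalFan hQ.isCompact hQ.nonempty]; trivial
  simpa using this

lemma IsTriangulation.isTiling [FiniteDimensional ℝ E] {T : Finset (Finset E)} {Q : Set E}
    (hQ : IsPolytope Q) (hT : IsTriangulation (normalFan Q) T) : IsTiling T where
  linearIndep := hT.linearIndep
  fullDim := hT.fullDim
  inter S hS S' hS' _ := by
    classical
    rw [hT.inter S hS S' hS', Finset.coe_inter]
  cover := ⟨∅, by simp, fun x => by simpa using hT.exists_mem hQ x⟩

lemma Subordinate.add_left {T : Finset (Finset E)} {A B : Set E} (h : Subordinate T (A + B)) :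
    Subordinate T A := by
  intro S hS
  obtain ⟨y, hy⟩ := h S hS
  -- The vector 0 is in every cone; it is used only to see that `y` lies in `A + B`.
  obtain ⟨a, ha, b, hb, rfl⟩ := (hy 0 (Submodule.zero_mem _)).1
  exact ⟨a, fun v hv => ((add_mem_minFace_add_iff ha hb).1 (hy v hv)).1⟩

lemma Subordinate.add_right {T : Finset (Finset E)} {A B : Set E} (h : Subordinate T (A + B)) :
    Subordinate T B := by
  rw [add_comm] at h
  exact h.add_left

lemma Subordinate.sum {ι : Type*} [Fintype ι] {T : Finset (Finset E)} {Q : ι → Set E}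
    (h : Subordinate T (∑ i, Q i)) (i : ι) : Subordinate T (Q i) := by
  classical
  rw [← Finset.add_sum_erase _ _ (Finset.mem_univ i)] at h
  exact h.add_left

/-- On the normal cone of a point `y` the support function is `-⟪·, y⟫`. -/
lemma Subordinate.conewiseLinear {T : Finset (Finset E)} {Q : Set E} (h : Subordinate T Q) :
    ConewiseLinear T (supportFn Q) := by
  intro S hS
  obtain ⟨y, hy⟩ := h S hS
  exact ⟨-y, fun v hv => by rw [supportFn_eq_of_mem_minFace (hy v hv), inner_neg_right]⟩

lemma conewiseLinear_inner (T : Finset (Finset E)) (z : E) : ConewiseLinear T fun v => ⟪v, z⟫ :=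
  fun _ _ => ⟨z, fun _ _ => rfl⟩

lemma ConewiseLinear.add {T : Finset (Finset E)} {u w : E → ℝ} (hu : ConewiseLinear T u)
    (hw : ConewiseLinear T w) : ConewiseLinear T fun v => u v + w v := by
  intro S hS
  obtain ⟨y, hy⟩ := hu S hS
  obtain ⟨z, hz⟩ := hw S hS
  exact ⟨y + z, fun v hv => by simp only [hy v hv, hz v hv, inner_add_right]⟩

lemma ConewiseLinear.const_mul {T : Finset (Finset E)} {u : E → ℝ} (hu : ConewiseLinear T u)
    (c : ℝ) : ConewiseLinear T fun v => c * u v := by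
  intro S hS
  obtain ⟨y, hy⟩ := hu S hS
  exact ⟨c • y, fun v hv => by simp only [hy v hv, real_inner_smul_right]⟩

lemma ConewiseLinear.sum {ι : Type*} {T : Finset (Finset E)} (s : Finset ι) {u : ι → E → ℝ}
    (hu : ∀ i, ConewiseLinear T (u i)) : ConewiseLinear T fun v => ∑ i ∈ s, u i v := by
  intro S hS
  choose y hy using fun i => hu i S hS
  exact ⟨∑ i ∈ s, y i, fun v hv => by
    rw [inner_sum]; exact Finset.sum_congr rfl fun i _ => hy i v hv⟩

omit [NormedAddCommGroup E] [InnerProductSpace ℝ E] in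
lemma triangulationSum_congr {L : Type*} [Field L] [Algebra ℝ L] {δ : Finset E → ℝ}
    {T : Finset (Finset E)} {u w : E → L} (h : ∀ S ∈ T, ∀ v ∈ S, u v = w v) :
    triangulationSum δ T u = triangulationSum δ T w :=
  Finset.sum_congr rfl fun S hS => by rw [Finset.prod_congr rfl (h S hS)]

open Classical in
-- A triangulation exists, so the default value 0 does not occur. The same `T` serves all `u`.
lemma exists_fanVolume_eq [FiniteDimensional ℝ E] {L : Type*} [Field L] [Algebra ℝ L]
    (δ : Finset E → ℝ) {Q : Set E} (hQ : IsPolytope Q) (hint : (interior Q).Nonempty) :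
    ∃ T, IsTriangulation (normalFan Q) T ∧
      ∀ u : E → L, fanVolume δ (normalFan Q) u = triangulationSum δ T u := by
  have h := exists_isTriangulation hQ hint
  exact ⟨h.choose, h.choose_spec, fun u => by rw [fanVolume, dif_pos h]⟩

lemma IsTriangulation.ne_zero {F : Set (Set E)} {T : Finset (Finset E)} (hT : IsTriangulation F T)
    {S : Finset E} (hS : S ∈ T) {v : E} (hv : v ∈ S) : v ≠ 0 := by
  rintro rfl
  have := (hT.gens S hS hv).1
  simp at this

end Subordinate

/-! ### The normal fan of P + [-p, p] -/

section Thickening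

variable {E : Type*} [NormedAddCommGroup E] [InnerProductSpace ℝ E]

lemma minFace_interval_subset {p v w y : E} {r : ℝ} (hr : 0 ≤ r) (h : ⟪p, w⟫ = r * ⟪p, v⟫)
    (hy : y ∈ minFace (interval p) v) : y ∈ minFace (interval p) w := by
  refine ⟨hy.1, fun z hz => ?_⟩
  have key : ∀ x ∈ interval p, ⟪w, x⟫ = r * ⟪v, x⟫ := by
    intro x hx
    obtain ⟨c, -, -, rfl⟩ := mem_interval.1 hx
    rw [real_inner_smul_right, real_inner_smul_right, real_inner_comm, h, real_inner_comm p v]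
    ring
  rw [key y hy.1, key z hz]
  exact mul_le_mul_of_nonneg_left (hy.2 z hz) hr

lemma minFace_add_interval_subset {P : Set E} {p v w : E} {r : ℝ} (hr : 0 ≤ r)
    (h : ⟪p, w⟫ = r * ⟪p, v⟫) (hP : minFace P v ⊆ minFace P w) :
    minFace (P + interval p) v ⊆ minFace (P + interval p) w := by
  rintro y hy
  obtain ⟨a, ha, b, hb, rfl⟩ := hy.1
  obtain ⟨h1, h2⟩ := (add_mem_minFace_add_iff ha hb).1 hy
  exact (add_mem_minFace_add_iff ha hb).2 ⟨hP h1, minFace_interval_subset hr h h2⟩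

variable [FiniteDimensional ℝ E]

/-- Let `w` be in the normal cone of the face of `v` in `P`. For small `t` the form `v + t • w` has
the same sign on `p` as `v`, so it selects the same end of the interval and lies in the normal cone
of `v` for the thickened polytope. That cone is a ray, so `w` is a multiple of `v`. -/
lemma mem_rayGens_of_inner_ne_zero {P : Set E} (hP : IsPolytope P) (hint : (interior P).Nonempty)
    {p v : E} (hv : v ∈ rayGens (normalFan (P + interval p))) (hpv : ⟪p, v⟫ ≠ 0) :
    v ∈ rayGens (normalFan P) := by
  have hQ := hP.add (isPolytope_interval p)
  rw [mem_rayGens_iff hQ.isCompact hQ.nonempty] at hv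
  refine (mem_rayGens_iff hP.isCompact hP.nonempty).2 ⟨hv.1, fun w hw => ?_⟩
  rcases eq_or_ne w 0 with rfl | hw0
  · exact ⟨0, le_rfl, by simp⟩
  have hcont : Continuous fun t : ℝ => 1 + t * (⟪p, w⟫ / ⟪p, v⟫) := by fun_prop
  have hev := (hcont.tendsto 0).eventually (lt_mem_nhds (a := 0) (by simp))
  have hev' := hev.filter_mono (nhdsWithin_le_nhds (s := Set.Ioi 0))
  obtain ⟨t, ht1, ht⟩ := (hev'.and self_mem_nhdsWithin).exists
  have ht : 0 < t := ht
  obtain ⟨c, hc, hcv⟩ := hv.2 (v + t • w) (minFace_add_interval_subset ht1.le (by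
    rw [inner_add_right, real_inner_smul_right]; field_simp) fun y hy =>
      minFace_add_subset hy (minFace_smul_subset (hw hy) ht.le))
  have hwv : w = ((c - 1) / t) • v := by
    have h1 : t • w = (c - 1) • v := by rw [sub_smul, one_smul, ← hcv]; abel
    rw [div_eq_inv_mul, mul_smul, ← h1, inv_smul_smul₀ ht.ne']
  refine ⟨(c - 1) / t, ?_, hwv⟩
  -- A negative factor would make the support function, centred at an interior point, negative at
  -- `w`, since it is linear on the normal cone.
  by_contra! hneg
  obtain ⟨z, hz⟩ := hint
  obtain ⟨y, hy⟩ := minFace_nonempty hP.isCompact hP.nonempty v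
  have h1 := supportFn_pos_of_mem_interior hP.isCompact hz hw0
  have hv0 : v ≠ 0 := by rintro rfl; simp at hpv
  have h2 := supportFn_pos_of_mem_interior hP.isCompact hz hv0
  rw [supportFn_eq_of_mem_minFace (hw hy), hwv, real_inner_smul_left, real_inner_smul_left] at h1
  rw [supportFn_eq_of_mem_minFace hy] at h2
  nlinarith

omit [FiniteDimensional ℝ E] in
-- On a subordinate cone `|⟪p, ·⟫|` equals `-c * ⟪p, ·⟫` with one constant `c`. Generators of both
-- signs would need `c = 1` and `c = -1`.
lemma inner_sign_of_subordinate {P : Set E} {p : E} {T : Finset (Finset E)}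
    (hT : Subordinate T (P + interval p)) {S : Finset E} (hS : S ∈ T) :
    (∀ v ∈ S, 0 ≤ ⟪p, v⟫) ∨ ∀ v ∈ S, ⟪p, v⟫ ≤ 0 := by
  obtain ⟨y, hy⟩ := hT.add_right S hS
  obtain ⟨c, hc1, hc2, rfl⟩ := mem_interval.1 (hy 0 (Submodule.zero_mem _)).1
  have key : ∀ v ∈ S, |⟪p, v⟫| = -c * ⟪p, v⟫ := fun v hv => by
    rw [← supportFn_interval, supportFn_eq_of_mem_minFace (hy v (subset_coneOn _ hv)),
      real_inner_smul_right, real_inner_comm]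
    ring
  by_contra! h
  obtain ⟨⟨v, hv, hv0⟩, w, hw, hw0⟩ := h
  have h1 := key v hv
  have h2 := key w hw
  rw [abs_of_neg hv0] at h1
  rw [abs_of_pos hw0] at h2
  nlinarith

end Thickening

/-! ### The projection of P along p -/

section Projection

variable {d : ℕ}

lemma isPolytope_projAlong {P : Set (EuclideanSpace ℝ (Fin d))} (hP : IsPolytope P)
    (p : EuclideanSpace ℝ (Fin d)) : IsPolytope (projAlong p P) :=
  hP.image ((ℝ ∙ p)ᗮ.orthogonalProjectionOnto).toLinearMap

lemma inner_proj (p y : EuclideanSpace ℝ (Fin d))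
    (v : ((ℝ ∙ p)ᗮ : Submodule ℝ (EuclideanSpace ℝ (Fin d)))) :
    ⟪v, (ℝ ∙ p)ᗮ.orthogonalProjectionOnto y⟫ = ⟪(v : EuclideanSpace ℝ (Fin d)), y⟫ := by
  rw [real_inner_comm, Submodule.inner_orthogonalProjectionOnto_eq_of_mem_right, real_inner_comm]

lemma proj_mem_minFace_iff {P : Set (EuclideanSpace ℝ (Fin d))} {p y : EuclideanSpace ℝ (Fin d)}
    (hy : y ∈ P) (v : ((ℝ ∙ p)ᗮ : Submodule ℝ (EuclideanSpace ℝ (Fin d)))) :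
    (ℝ ∙ p)ᗮ.orthogonalProjectionOnto y ∈ minFace (projAlong p P) v ↔
      y ∈ minFace P (v : EuclideanSpace ℝ (Fin d)) := by
  simp only [minFace, projAlong, Set.mem_ofPred_eq, Set.forall_mem_image, inner_proj, hy, true_and,
    Set.mem_image_of_mem]

lemma supportFn_projAlong {P : Set (EuclideanSpace ℝ (Fin d))} (hP : IsPolytope P)
    (p : EuclideanSpace ℝ (Fin d)) (v : ((ℝ ∙ p)ᗮ : Submodule ℝ (EuclideanSpace ℝ (Fin d)))) :
    supportFn (projAlong p P) v = supportFn P (v : EuclideanSpace ℝ (Fin d)) := by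
  obtain ⟨y, hy⟩ := minFace_nonempty hP.isCompact hP.nonempty (v : EuclideanSpace ℝ (Fin d))
  rw [supportFn_eq_of_mem_minFace hy,
    supportFn_eq_of_mem_minFace ((proj_mem_minFace_iff hy.1 v).2 hy), inner_proj]

lemma interior_projAlong_nonempty {P : Set (EuclideanSpace ℝ (Fin d))}
    (hint : (interior P).Nonempty) (p : EuclideanSpace ℝ (Fin d)) :
    (interior (projAlong p P)).Nonempty := by
  have hopen : IsOpenMap ((ℝ ∙ p)ᗮ.orthogonalProjectionOnto) :=
    ((ℝ ∙ p)ᗮ.orthogonalProjectionOnto).isOpenMap fun x =>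
      ⟨x, Submodule.orthogonalProjectionOnto_mem_subspace_eq_self x⟩
  exact (hint.image _).mono (interior_maximal (Set.image_mono interior_subset)
    (hopen _ isOpen_interior))

/-- For forms in the hyperplane the interval contributes nothing (factor `r = 0`), so normal cones
of the projection embed in those of the thickened polytope. Hence the conditions on `z₀` cover all
generators that occur in the limit. -/
lemma mem_rayGens_projAlong {P : Set (EuclideanSpace ℝ (Fin d))} (hP : IsPolytope P)
    {p : EuclideanSpace ℝ (Fin d)} {v : ((ℝ ∙ p)ᗮ : Submodule ℝ (EuclideanSpace ℝ (Fin d)))}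
    (hv : (v : EuclideanSpace ℝ (Fin d)) ∈ rayGens (normalFan (P + interval p))) :
    v ∈ rayGens (normalFan (projAlong p P)) := by
  have hQ := hP.add (isPolytope_interval p)
  have hH := isPolytope_projAlong hP p
  rw [mem_rayGens_iff hQ.isCompact hQ.nonempty] at hv
  refine (mem_rayGens_iff hH.isCompact hH.nonempty).2 ⟨hv.1, fun w hw => ?_⟩
  obtain ⟨c, hc, hcv⟩ := hv.2 w (minFace_add_interval_subset le_rfl (by
    rw [zero_mul]; exact Submodule.mem_orthogonal_singleton_iff_inner_right.1 w.2) fun y hy =>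
      (proj_mem_minFace_iff hy.1 w).1 (hw ((proj_mem_minFace_iff hy.1 v).2 hy)))
  exact ⟨c, hc, Subtype.ext hcv⟩

lemma normalFan_sub_singleton {E : Type*} [NormedAddCommGroup E] [InnerProductSpace ℝ E]
    [FiniteDimensional ℝ E] {Q : Set E} (hQ : IsPolytope Q) (z : E) :
    normalFan (Q - {z}) = normalFan Q := by
  have hQ' : IsPolytope (Q - {z}) := by
    rw [sub_eq_add_neg, Set.neg_singleton]
    exact hQ.add (isPolytope_singleton _)
  ext C
  rw [mem_normalFan_iff hQ'.isCompact hQ'.nonempty, mem_normalFan_iff hQ.isCompact hQ.nonempty]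
  refine exists_congr fun v => ?_
  have : faceCone (Q - {z}) v = faceCone Q v := by
    ext w
    constructor
    · intro h y hy
      have := h (sub_mem_minFace_iff.2 (by simpa using hy) : y - z ∈ minFace (Q - {z}) v)
      simpa using sub_mem_minFace_iff.1 this
    · intro h y hy
      exact sub_mem_minFace_iff.2 (h (sub_mem_minFace_iff.1 hy))
  rw [this]

end Projection

/-! ### Determinants in the hyperplane normal to p -/

section PerpDeterminant

variable {m : ℕ}

/-- The determinant of a list of vectors of `ℝ^d`. -/
noncomputable def vecDet {d : ℕ} : EuclideanSpace ℝ (Fin d) [⋀^Fin d]→ₗ[ℝ] ℝ :=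
  (EuclideanSpace.basisFun (Fin d) ℝ).toBasis.det

lemma abs_vecDet {d : ℕ} {S : Finset (EuclideanSpace ℝ (Fin d))}
    {e : Fin d → EuclideanSpace ℝ (Fin d)} (he : Function.Injective e)
    (hS : (S : Set (EuclideanSpace ℝ (Fin d))) = Set.range e) : absDet S = |vecDet e| := by
  rw [absDet_eq he hS, vecDet, Module.Basis.det_apply, ← Matrix.det_transpose]
  rfl

lemma finrank_perp {p : EuclideanSpace ℝ (Fin (m + 1))} (hp : p ≠ 0) :
    Module.finrank ℝ ((ℝ ∙ p)ᗮ : Submodule ℝ (EuclideanSpace ℝ (Fin (m + 1)))) = m := by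
  have : Fact (Module.finrank ℝ (EuclideanSpace ℝ (Fin (m + 1))) = m + 1) :=
    ⟨finrank_euclideanSpace_fin⟩
  exact Submodule.finrank_orthogonal_span_singleton hp

lemma self_notMem_perp {d : ℕ} {p : EuclideanSpace ℝ (Fin d)} (hp : p ≠ 0) : p ∉ (ℝ ∙ p)ᗮ := by
  rw [Submodule.mem_orthogonal_singleton_iff_inner_right]
  simpa using hp

lemma cons_injective {E : Type*} {a : E} {e : Fin m → E} (he : Function.Injective e)
    (ha : a ∉ Set.range e) : Function.Injective (Fin.cons a e : Fin (m + 1) → E) :=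
  Fin.cons_injective_iff.2 ⟨ha, he⟩

open Classical in
lemma absDet_insert {S : Finset (EuclideanSpace ℝ (Fin (m + 1)))}
    {e : Fin m → EuclideanSpace ℝ (Fin (m + 1))} (he : Function.Injective e)
    (hS : (S : Set (EuclideanSpace ℝ (Fin (m + 1)))) = Set.range e)
    {a : EuclideanSpace ℝ (Fin (m + 1))} (ha : a ∉ S) :
    absDet (insert a S) = |vecDet (Fin.cons a e)| := by
  refine abs_vecDet (cons_injective he (by rwa [← hS])) ?_
  rw [Finset.coe_insert, hS, Fin.range_cons]

/-- Inserting `p` into the determinant gives an alternating form of top degree on the hyperplane,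
and such a form is a multiple of the determinant in a basis. -/
lemma isDet_absDetPerp {d : ℕ} {p : EuclideanSpace ℝ (Fin d)} (hp : p ≠ 0) :
    IsDet (absDetPerp p) := by
  classical
  obtain _ | m := d
  · exact absurd (Subsingleton.elim p 0) hp
  have hm := finrank_perp hp
  let b := Module.finBasisOfFinrankEq ℝ ((ℝ ∙ p)ᗮ : Submodule ℝ _) hm
  let D : ((ℝ ∙ p)ᗮ : Submodule ℝ (EuclideanSpace ℝ (Fin (m + 1)))) [⋀^Fin m]→ₗ[ℝ] ℝ :=
    (AlternatingMap.curryLeft vecDet p).compLinearMap ((ℝ ∙ p)ᗮ).subtype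
  refine ⟨b.reindex (finCongr hm.symm), |D b|, fun e he => ?_⟩
  rw [Module.Basis.det_reindex]
  set e' : Fin m → ((ℝ ∙ p)ᗮ : Submodule ℝ (EuclideanSpace ℝ (Fin (m + 1)))) :=
    e ∘ finCongr hm.symm with he'
  have hinj : Function.Injective e' := he.comp (finCongr hm.symm).injective
  have h1 : D e' = D b * b.det e' := by
    conv_lhs => rw [D.eq_smul_basis_det b]
    rfl
  rw [← abs_mul, ← h1, absDetPerp]
  have h2 : D e' = vecDet (Fin.cons p fun i => (e' i : EuclideanSpace ℝ (Fin (m + 1)))) := rfl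
  rw [h2]
  convert absDet_insert (e := fun i => (e' i : EuclideanSpace ℝ (Fin (m + 1))))
    (fun i j h => hinj (Subtype.ext h)) ?_ ?_ using 2
  · ext x
    simp only [Finset.coe_map, Set.mem_image, Finset.mem_coe, Finset.mem_image, Finset.mem_univ,
      true_and, Set.mem_range]
    constructor
    · rintro ⟨_, ⟨i, rfl⟩, rfl⟩
      exact ⟨finCongr hm i, rfl⟩
    · rintro ⟨i, rfl⟩
      exact ⟨_, ⟨_, rfl⟩, rfl⟩
  · intro h
    obtain ⟨x, -, hx⟩ := Finset.mem_map.1 h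
    exact self_notMem_perp hp (Eq.subst (motive := fun y => y ∈ (ℝ ∙ p)ᗮ) hx x.2)

/-- As a linear form in `v` the determinant vanishes on the hyperplane, where its arguments
outnumber the dimension. So only the component of `v` along `p` counts. -/
lemma vecDet_cons_mul {p : EuclideanSpace ℝ (Fin (m + 1))} (hp : p ≠ 0)
    (e : Fin m → ((ℝ ∙ p)ᗮ : Submodule ℝ (EuclideanSpace ℝ (Fin (m + 1)))))
    (v : EuclideanSpace ℝ (Fin (m + 1))) :
    vecDet (Fin.cons v fun i => (e i : EuclideanSpace ℝ (Fin (m + 1)))) * ‖p‖ ^ 2 =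
      ⟪p, v⟫ * vecDet (Fin.cons p fun i => (e i : EuclideanSpace ℝ (Fin (m + 1)))) := by
  have hn : ‖p‖ ^ 2 ≠ 0 := by simpa using hp
  let f : EuclideanSpace ℝ (Fin (m + 1)) →ₗ[ℝ] ℝ :=
    { toFun := fun v => vecDet (Fin.cons v fun i => (e i : EuclideanSpace ℝ (Fin (m + 1))))
      map_add' := fun x y => by
        have := (vecDet (d := m + 1)).toMultilinearMap.cons_add
          (fun i => (e i : EuclideanSpace ℝ (Fin (m + 1)))) x y
        exact this
      map_smul' := fun c x => by
        have := (vecDet (d := m + 1)).toMultilinearMap.cons_smul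
          (fun i => (e i : EuclideanSpace ℝ (Fin (m + 1)))) c x
        exact this }
  have hperp : ∀ w ∈ (ℝ ∙ p)ᗮ, f w = 0 := by
    intro w hw
    let g : Fin (m + 1) → ((ℝ ∙ p)ᗮ : Submodule ℝ (EuclideanSpace ℝ (Fin (m + 1)))) :=
      Fin.cons ⟨w, hw⟩ e
    have hg : f w = vecDet.compLinearMap ((ℝ ∙ p)ᗮ).subtype g := by
      show vecDet _ = vecDet _
      congr 1
      ext i : 1
      refine Fin.cases rfl (fun j => rfl) i
    rw [hg]
    refine AlternatingMap.map_linearDependent _ g fun hli => ?_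
    have := hli.fintype_card_le_finrank
    rw [finrank_perp hp, Fintype.card_fin] at this
    omega
  have hw : v - (⟪p, v⟫ / ‖p‖ ^ 2) • p ∈ (ℝ ∙ p)ᗮ := by
    rw [Submodule.mem_orthogonal_singleton_iff_inner_right, inner_sub_right, real_inner_smul_right,
      real_inner_self_eq_norm_sq, div_mul_cancel₀ _ hn, sub_self]
  have h := hperp _ hw
  rw [map_sub, map_smul, sub_eq_zero, smul_eq_mul] at h
  show f v * _ = _ * f p
  rw [h]
  field_simp

open Classical in
-- This is the source of the factor `1 / ‖p‖ ^ 2` in the limits; `|⟪p, v⟫|` will cancel against the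
-- slope of the factor of `v`.
lemma absDet_insert_mul {d : ℕ} {p : EuclideanSpace ℝ (Fin d)} (hp : p ≠ 0)
    {K : Finset ((ℝ ∙ p)ᗮ : Submodule ℝ (EuclideanSpace ℝ (Fin d)))} (hK : K.card + 1 = d)
    {v : EuclideanSpace ℝ (Fin d)} (hv : v ∉ (ℝ ∙ p)ᗮ) :
    absDet (insert v (K.map (Function.Embedding.subtype _))) * ‖p‖ ^ 2 =
      |⟪p, v⟫| * absDetPerp p K := by
  obtain _ | m := d
  · omega
  obtain ⟨e, he, hKe⟩ := exists_enum (S := K) (n := m) (by omega)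
  have hinj : Function.Injective fun i => (e i : EuclideanSpace ℝ (Fin (m + 1))) :=
    fun i j h => he (Subtype.ext h)
  have hrange : ((K.map (Function.Embedding.subtype _) : Finset _) :
      Set (EuclideanSpace ℝ (Fin (m + 1)))) =
      Set.range fun i => (e i : EuclideanSpace ℝ (Fin (m + 1))) := by
    rw [Finset.coe_map, hKe, ← Set.range_comp]
    rfl
  have hnot : ∀ {a}, a ∉ (ℝ ∙ p)ᗮ → a ∉ K.map (Function.Embedding.subtype _) := fun ha h => by
    obtain ⟨x, -, hx⟩ := Finset.mem_map.1 h
    exact ha (hx ▸ x.2)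
  have h2 := absDet_insert hinj hrange (hnot (self_notMem_perp hp))
  have h3 := absDet_insert hinj hrange (hnot hv)
  rw [absDetPerp, h3]
  have : |vecDet (Fin.cons p fun i => (e i : EuclideanSpace ℝ (Fin (m + 1))))| =
      absDet (insert p (K.map (Function.Embedding.subtype _))) := h2.symm
  rw [← abs_of_nonneg (sq_nonneg ‖p‖), ← abs_mul, vecDet_cons_mul hp, abs_mul, this]

end PerpDeterminant

/-! ### The cones on one side of a hyperplane -/

section Halves

variable {E : Type*} [NormedAddCommGroup E] [InnerProductSpace ℝ E]

open Classical in
/-- The cones of `T` that lie in the half-space `0 ≤ ⟪q, ·⟫`. -/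
noncomputable def half (T : Finset (Finset E)) (q : E) : Finset (Finset E) :=
  T.filter fun S => ∀ v ∈ S, 0 ≤ ⟪q, v⟫

lemma mem_half {T : Finset (Finset E)} {q : E} {S : Finset E} :
    S ∈ half T q ↔ S ∈ T ∧ ∀ v ∈ S, 0 ≤ ⟪q, v⟫ := by
  simp [half]

lemma inner_nonneg_of_mem_coneOn {s : Set E} {q x : E} (hS : ∀ v ∈ s, 0 ≤ ⟪q, v⟫)
    (hx : x ∈ coneOn s) : 0 ≤ ⟪q, x⟫ :=
  coneOn_subset_of_convexCone (C := {x | 0 ≤ ⟪q, x⟫}) hS (by simp)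
    (fun x hx y hy => by
      show 0 ≤ ⟪q, x + y⟫
      rw [inner_add_right]; exact add_nonneg hx hy)
    (fun c hc x hx => by
      show 0 ≤ ⟪q, c • x⟫
      rw [real_inner_smul_right]; exact mul_nonneg hc hx) hx

variable [FiniteDimensional ℝ E]

/-- A simplicial cone is the intersection of the half-spaces given by the dual basis. -/
lemma isClosed_coneOn {S : Finset E} (hS : LinearIndepOn ℝ id (S : Set E))
    (hcard : S.card = Module.finrank ℝ E) : IsClosed (coneOn (S : Set E)) := by
  classical
  choose y hy using fun v : E => exists_inner_eq hS fun u => if u = v then 1 else 0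
  have hval : ∀ a : E → ℝ, ∀ v ∈ S, ⟪∑ u ∈ S, a u • u, y v⟫ = a v := fun a v hv => by
    rw [sum_inner, Finset.sum_eq_single_of_mem v hv]
    · rw [real_inner_smul_left, hy v v hv]; simp
    · intro u hu huv
      rw [real_inner_smul_left, hy v u hu]; simp [huv]
  have : coneOn (S : Set E) = ⋂ v ∈ S, {x | 0 ≤ ⟪x, y v⟫} := by
    ext x
    simp only [Set.mem_iInter, Set.mem_ofPred_eq]
    constructor
    · intro hx v hv
      obtain ⟨a, ha, rfl⟩ := mem_coneOn_finset.1 hx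
      rw [hval a v hv]
      exact ha v hv
    · intro h
      obtain ⟨a, rfl⟩ := exists_repr hS hcard x
      exact mem_coneOn_finset.2 ⟨a, fun v hv => by rw [← hval a v hv]; exact h v hv, rfl⟩
  rw [this]
  exact isClosed_biInter fun v _ => isClosed_le continuous_const (by fun_prop)

lemma exists_inner_ne_zero {S : Finset E} (hS : LinearIndepOn ℝ id (S : Set E))
    (hcard : S.card = Module.finrank ℝ E) {q : E} (hq : q ≠ 0) : ∃ v ∈ S, ⟪q, v⟫ ≠ 0 := by
  by_contra! h
  obtain ⟨a, ha⟩ := exists_repr hS hcard q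
  have : ⟪q, q⟫ = 0 := by
    conv_lhs => rw [show ⟪q, q⟫ = ⟪q, ∑ u ∈ S, a u • u⟫ from congrArg _ ha, inner_sum]
    exact Finset.sum_eq_zero fun v hv => by rw [real_inner_smul_right, h v hv, mul_zero]
  exact hq (inner_self_eq_zero.1 this)

/-- The cones of `T` split into those on the two sides of the hyperplane normal to `q`. -/
lemma triangulationSum_half_add {L : Type*} [Field L] [Algebra ℝ L] (δ : Finset E → ℝ)
    {T : Finset (Finset E)} (hT : IsTiling T) {q : E} (hq : q ≠ 0)
    (hsign : ∀ S ∈ T, (∀ v ∈ S, 0 ≤ ⟪q, v⟫) ∨ ∀ v ∈ S, ⟪q, v⟫ ≤ 0) (u : E → L) :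
    triangulationSum δ (half T q) u + triangulationSum δ (half T (-q)) u =
      triangulationSum δ T u := by
  classical
  have : half T (-q) = T.filter fun S => ¬ ∀ v ∈ S, 0 ≤ ⟪q, v⟫ := by
    ext S
    rw [mem_half, Finset.mem_filter]
    refine and_congr_right fun hS => ⟨fun h h' => ?_, fun h v hv => ?_⟩
    -- A full-dimensional cone has a generator off the hyperplane, so it is counted on one side
    -- only.
    · obtain ⟨v, hv, hne⟩ := exists_inner_ne_zero (hT.linearIndep S hS) (hT.fullDim S hS) hq
      have := h v hv
      rw [inner_neg_left] at this
      exact hne (le_antisymm (by linarith) (h' v hv))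
    · have := (hsign S hS).resolve_left h v hv
      rw [inner_neg_left]; linarith
  rw [this]
  exact Finset.sum_filter_add_sum_filter_not T _ _

/-- The points `x + t • q` with `t > 0` are strictly on the positive side, so only cones of that
half cover them. Their finite union is closed, so it contains the limit `x`. -/
lemma exists_mem_half {T : Finset (Finset E)} (hT : IsTiling T)
    (hcov : ∀ x, ∃ S ∈ T, x ∈ coneOn (S : Set E)) {q : E}
    (hsign : ∀ S ∈ T, (∀ v ∈ S, 0 ≤ ⟪q, v⟫) ∨ ∀ v ∈ S, ⟪q, v⟫ ≤ 0) (hq : q ≠ 0) {x : E}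
    (hx : ⟪q, x⟫ = 0) : ∃ S ∈ half T q, x ∈ coneOn (S : Set E) := by
  have hclosed : IsClosed (⋃ S ∈ half T q, coneOn (S : Set E)) :=
    (half T q).finite_toSet.isClosed_biUnion fun S hS =>
      have hS := (mem_half.1 hS).1
      isClosed_coneOn (hT.linearIndep S hS) (hT.fullDim S hS)
  have hlim : Filter.Tendsto (fun t : ℝ => x + t • q) (𝓝[>] 0) (𝓝 x) := by
    refine tendsto_nhdsWithin_of_tendsto_nhds ?_
    have : Continuous fun t : ℝ => x + t • q := by fun_prop
    simpa using this.tendsto 0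
  have hmem := hclosed.mem_of_tendsto hlim (by
    filter_upwards [self_mem_nhdsWithin] with t ht
    obtain ⟨S, hS, hxS⟩ := hcov (x + t • q)
    refine Set.mem_biUnion (x := S) (mem_half.2 ⟨hS, ?_⟩) hxS
    refine (hsign S hS).resolve_right fun h => ?_
    have h1 := inner_nonneg_of_mem_coneOn (q := -q) (fun v hv => by
      rw [inner_neg_left]; linarith [h v hv]) hxS
    rw [inner_neg_left, inner_add_right, hx, real_inner_smul_right, real_inner_self_eq_norm_sq]
      at h1
    have : 0 < t * ‖q‖ ^ 2 := mul_pos ht (by positivity)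
    linarith)
  simpa using hmem

end Halves

/-! ### Facets in the hyperplane and the tiling that they form -/

section Traces

variable {d : ℕ}

open Classical in
/-- The generators in the hyperplane normal to `p`. -/
noncomputable def trace (p : EuclideanSpace ℝ (Fin d)) (S : Finset (EuclideanSpace ℝ (Fin d))) :
    Finset ((ℝ ∙ p)ᗮ : Submodule ℝ (EuclideanSpace ℝ (Fin d))) :=
  S.subtype (· ∈ (ℝ ∙ p)ᗮ)

lemma mem_trace {p : EuclideanSpace ℝ (Fin d)} {S : Finset (EuclideanSpace ℝ (Fin d))}
    {v : ((ℝ ∙ p)ᗮ : Submodule ℝ (EuclideanSpace ℝ (Fin d)))} :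
    v ∈ trace p S ↔ (v : EuclideanSpace ℝ (Fin d)) ∈ S := by
  simp [trace]

open Classical in
lemma map_trace (p : EuclideanSpace ℝ (Fin d)) (S : Finset (EuclideanSpace ℝ (Fin d))) :
    (trace p S).map (Function.Embedding.subtype _) = S.filter (· ∈ (ℝ ∙ p)ᗮ) :=
  Finset.subtype_map _

lemma coe_mem_coneOn_of_trace {p : EuclideanSpace ℝ (Fin d)}
    {S : Finset (EuclideanSpace ℝ (Fin d))}
    {x : ((ℝ ∙ p)ᗮ : Submodule ℝ (EuclideanSpace ℝ (Fin d)))}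
    (hx : x ∈ coneOn (trace p S : Set ((ℝ ∙ p)ᗮ : Submodule ℝ (EuclideanSpace ℝ (Fin d))))) :
    (x : EuclideanSpace ℝ (Fin d)) ∈ coneOn (S : Set (EuclideanSpace ℝ (Fin d))) := by
  refine coneOn_subset_of_convexCone
    (s := (trace p S : Set ((ℝ ∙ p)ᗮ : Submodule ℝ (EuclideanSpace ℝ (Fin d)))))
    (C := {x | (x : EuclideanSpace ℝ (Fin d)) ∈ coneOn (S : Set (EuclideanSpace ℝ (Fin d)))})
    (fun v hv => subset_coneOn _ (mem_trace.1 hv)) (Submodule.zero_mem _)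
    (fun x hx y hy => Submodule.add_mem _ hx hy)
    (fun c hc x hx => PointedCone.smul_mem _ hc hx) hx

lemma mem_perp_iff {p v : EuclideanSpace ℝ (Fin d)} : v ∈ (ℝ ∙ p)ᗮ ↔ ⟪p, v⟫ = 0 :=
  Submodule.mem_orthogonal_singleton_iff_inner_right

/-- As `⟪q, ·⟫` is nonnegative on the generators and zero at `x`, every generator off the hyperplane
has coefficient zero. -/
lemma mem_coneOn_trace {p q : EuclideanSpace ℝ (Fin d)} {c : ℝ} (hc : c ≠ 0) (hq : q = c • p)
    {S : Finset (EuclideanSpace ℝ (Fin d))} (hS : ∀ v ∈ S, 0 ≤ ⟪q, v⟫)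
    {x : ((ℝ ∙ p)ᗮ : Submodule ℝ (EuclideanSpace ℝ (Fin d)))}
    (hx : (x : EuclideanSpace ℝ (Fin d)) ∈ coneOn (S : Set (EuclideanSpace ℝ (Fin d)))) :
    x ∈ coneOn (trace p S : Set ((ℝ ∙ p)ᗮ : Submodule ℝ (EuclideanSpace ℝ (Fin d)))) := by
  classical
  have hperp : ∀ v, ⟪q, v⟫ = 0 ↔ v ∈ (ℝ ∙ p)ᗮ := fun v => by
    rw [mem_perp_iff, hq, real_inner_smul_left, mul_eq_zero, or_iff_right hc]
  obtain ⟨a, ha, hxa⟩ := mem_coneOn_finset.1 hx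
  have h0 : ∑ v ∈ S, a v * ⟪q, v⟫ = 0 := by
    rw [← (hperp x).2 x.2, hxa, inner_sum]
    simp only [real_inner_smul_right]
  have h1 := (Finset.sum_eq_zero_iff_of_nonneg fun v hv => mul_nonneg (ha v hv) (hS v hv)).1 h0
  refine mem_coneOn_finset.2 ⟨fun v => a v, fun v hv => ha v (mem_trace.1 hv), Subtype.ext ?_⟩
  rw [Submodule.coe_sum]
  have h2 : ∑ v ∈ trace p S, ((a v • v :
      ((ℝ ∙ p)ᗮ : Submodule ℝ (EuclideanSpace ℝ (Fin d)))) : EuclideanSpace ℝ (Fin d)) =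
      ∑ v ∈ (trace p S).map (Function.Embedding.subtype _), a v • v := by
    rw [Finset.sum_map]; rfl
  rw [hxa, h2, map_trace]
  symm
  refine Finset.sum_subset (Finset.filter_subset _ _) fun v hv hv' => ?_
  rcases mul_eq_zero.1 (h1 v hv) with h | h
  · rw [h, zero_smul]
  · exact absurd (Finset.mem_filter.2 ⟨hv, (hperp v).1 h⟩) hv'

lemma linearIndepOn_trace {p : EuclideanSpace ℝ (Fin d)} {S : Finset (EuclideanSpace ℝ (Fin d))}
    (hS : LinearIndepOn ℝ id (S : Set (EuclideanSpace ℝ (Fin d)))) :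
    LinearIndepOn ℝ id
      (trace p S : Set ((ℝ ∙ p)ᗮ : Submodule ℝ (EuclideanSpace ℝ (Fin d)))) := by
  have h : LinearIndependent ℝ ((↑) : S → EuclideanSpace ℝ (Fin d)) := hS
  have h2 := h.comp (fun v : trace p S => (⟨v, mem_trace.1 v.2⟩ : S)) fun v w hvw =>
    Subtype.ext (Subtype.ext (congrArg (fun x : S => (x : EuclideanSpace ℝ (Fin d))) hvw))
  exact LinearIndependent.of_comp ((ℝ ∙ p)ᗮ).subtype h2

lemma card_trace_le {p : EuclideanSpace ℝ (Fin d)} {S : Finset (EuclideanSpace ℝ (Fin d))}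
    (hS : LinearIndepOn ℝ id (S : Set (EuclideanSpace ℝ (Fin d)))) :
    (trace p S).card ≤
      Module.finrank ℝ ((ℝ ∙ p)ᗮ : Submodule ℝ (EuclideanSpace ℝ (Fin d))) := by
  have h : LinearIndependent ℝ (fun v : trace p S => v.1) := linearIndepOn_trace hS
  simpa using h.fintype_card_le_finrank

lemma finrank_perp_add_one {p : EuclideanSpace ℝ (Fin d)} (hp : p ≠ 0) :
    Module.finrank ℝ ((ℝ ∙ p)ᗮ : Submodule ℝ (EuclideanSpace ℝ (Fin d))) + 1 = d := by
  obtain _ | m := d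
  · exact absurd (Subsingleton.elim p 0) hp
  · rw [finrank_perp hp]

open Classical in
/-- The cones of `T` on one side of the hyperplane normal to `p` that have a facet in it. -/
noncomputable def adjacent (p q : EuclideanSpace ℝ (Fin d))
    (T : Finset (Finset (EuclideanSpace ℝ (Fin d)))) :
    Finset (Finset (EuclideanSpace ℝ (Fin d))) :=
  (half T q).filter fun S => (trace p S).card =
    Module.finrank ℝ ((ℝ ∙ p)ᗮ : Submodule ℝ (EuclideanSpace ℝ (Fin d)))

lemma mem_adjacent {p q : EuclideanSpace ℝ (Fin d)} {T : Finset (Finset (EuclideanSpace ℝ (Fin d)))}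
    {S : Finset (EuclideanSpace ℝ (Fin d))} : S ∈ adjacent p q T ↔ S ∈ half T q ∧
      (trace p S).card =
        Module.finrank ℝ ((ℝ ∙ p)ᗮ : Submodule ℝ (EuclideanSpace ℝ (Fin d))) := by
  simp [adjacent]

open Classical in
-- A count of generators leaves exactly one outside the hyperplane.
lemma exists_eq_insert_of_mem_adjacent {p q : EuclideanSpace ℝ (Fin d)} (hp : p ≠ 0)
    {T : Finset (Finset (EuclideanSpace ℝ (Fin d)))} (hT : IsTiling T)
    {S : Finset (EuclideanSpace ℝ (Fin d))} (hS : S ∈ adjacent p q T) :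
    ∃ v ∈ S, v ∉ (ℝ ∙ p)ᗮ ∧ S.filter (· ∉ (ℝ ∙ p)ᗮ) = {v} ∧
      S = insert v ((trace p S).map (Function.Embedding.subtype _)) := by
  obtain ⟨hSh, hcard⟩ := mem_adjacent.1 hS
  have h1 := Finset.card_filter_add_card_filter_not (s := S) (· ∈ (ℝ ∙ p)ᗮ)
  rw [← map_trace, Finset.card_map, hcard, hT.fullDim S (mem_half.1 hSh).1,
    finrank_euclideanSpace_fin] at h1
  have h2 := finrank_perp_add_one hp
  obtain ⟨v, hv⟩ := Finset.card_eq_one.1 (by omega : (S.filter (· ∉ (ℝ ∙ p)ᗮ)).card = 1)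
  have hmem : v ∈ S.filter (· ∉ (ℝ ∙ p)ᗮ) := by rw [hv]; exact Finset.mem_singleton_self v
  rw [Finset.mem_filter] at hmem
  refine ⟨v, hmem.1, hmem.2, hv, ?_⟩
  rw [map_trace, Finset.insert_eq, ← hv, Finset.union_comm]
  exact (Finset.filter_union_filter_not_eq _ S).symm

open Classical in
-- Two different cones on the same side of a common facet would overlap: they would share a point
-- strictly off the hyperplane, although they may meet only in the cone on their common generators.
lemma injOn_trace {p q : EuclideanSpace ℝ (Fin d)} (hp : p ≠ 0) {c : ℝ} (hc : c ≠ 0)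
    (hq : q = c • p) {T : Finset (Finset (EuclideanSpace ℝ (Fin d)))} (hT : IsTiling T) :
    Set.InjOn (trace p) (adjacent p q T : Set (Finset (EuclideanSpace ℝ (Fin d)))) := by
  intro S hS S' hS' htr
  obtain ⟨v, hvS, hvH, hv, hSv⟩ := exists_eq_insert_of_mem_adjacent hp hT hS
  obtain ⟨w, hwS, hwH, hw, hSw⟩ := exists_eq_insert_of_mem_adjacent hp hT hS'
  have hSh := mem_half.1 (mem_adjacent.1 hS).1
  have hSh' := mem_half.1 (mem_adjacent.1 hS').1
  by_contra hne
  have hperp : ∀ v, ⟪q, v⟫ = 0 ↔ v ∈ (ℝ ∙ p)ᗮ := fun v => by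
    rw [mem_perp_iff, hq, real_inner_smul_left, mul_eq_zero, or_iff_right hc]
  have hposv : 0 < ⟪q, v⟫ := lt_of_le_of_ne (hSh.2 v hvS) fun h => hvH ((hperp v).1 h.symm)
  have hposw : 0 < ⟪q, w⟫ := lt_of_le_of_ne (hSh'.2 w hwS) fun h => hwH ((hperp w).1 h.symm)
  set K := (trace p S).map (Function.Embedding.subtype _) with hK
  rw [← htr, ← hK] at hSw
  have hKH : ∀ u ∈ K, u ∈ (ℝ ∙ p)ᗮ := fun u hu => by
    rw [hK, map_trace] at hu; exact (Finset.mem_filter.1 hu).2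
  have hvK : v ∉ K := fun h => hvH (hKH v h)
  have hwK : w ∉ K := fun h => hwH (hKH w h)
  obtain ⟨a, ha⟩ := exists_repr (hT.linearIndep S hSh.1) (hT.fullDim S hSh.1) w
  rw [hSv, Finset.sum_insert hvK] at ha
  have hKq : ∀ b : EuclideanSpace ℝ (Fin d) → ℝ, ⟪q, ∑ u ∈ K, b u • u⟫ = 0 := fun b => by
    rw [inner_sum]
    exact Finset.sum_eq_zero fun u hu => by
      rw [real_inner_smul_right, (hperp u).2 (hKH u hu), mul_zero]
  have hav : 0 < a v := by
    rw [ha, inner_add_right, hKq, add_zero, real_inner_smul_right] at hposw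
    exact pos_of_mul_pos_left hposw hposv.le
  -- Adding `|a u|` times each facet generator makes all coefficients nonnegative in both bases at
  -- once.
  have hx1 : w + ∑ u ∈ K, |a u| • u ∈ coneOn (S : Set (EuclideanSpace ℝ (Fin d))) := by
    refine mem_coneOn_finset.2 ⟨fun u => if u = v then a v else a u + |a u|, fun u _ => ?_, ?_⟩
    · simp only []
      split_ifs
      · exact hav.le
      · linarith [neg_abs_le (a u)]
    · rw [hSv, Finset.sum_insert hvK]
      simp only [if_true]
      rw [ha, add_assoc, ← Finset.sum_add_distrib]
      congr 1
      refine Finset.sum_congr rfl fun u hu => ?_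
      rw [if_neg (fun h : u = v => hvK (h ▸ hu)), add_smul]
  have hx2 : w + ∑ u ∈ K, |a u| • u ∈ coneOn (S' : Set (EuclideanSpace ℝ (Fin d))) := by
    refine mem_coneOn_finset.2 ⟨fun u => if u = w then 1 else |a u|, fun u _ => ?_, ?_⟩
    · simp only []
      split_ifs
      · exact zero_le_one
      · exact abs_nonneg _
    · rw [hSw, Finset.sum_insert hwK]
      simp only [if_true, one_smul]
      congr 1
      refine Finset.sum_congr rfl fun u hu => ?_
      rw [if_neg (fun h : u = w => hwK (h ▸ hu))]
  have hx := hT.inter S hSh.1 S' hSh'.1 hne ⟨hx1, hx2⟩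
  have hvw : v ≠ w := fun h => hne (by rw [hSv, hSw, h])
  have hneg := inner_nonneg_of_mem_coneOn (q := -q) (fun u hu => by
    obtain ⟨huS, huS'⟩ := hu
    rw [Finset.mem_coe, hSv] at huS
    rw [Finset.mem_coe, hSw] at huS'
    have huK : u ∈ K := by
      rcases Finset.mem_insert.1 huS with rfl | h
      · exact (Finset.mem_insert.1 huS').resolve_left hvw
      · exact h
    rw [inner_neg_left, (hperp u).2 (hKH u huK), neg_zero]) hx
  rw [inner_neg_left, inner_add_right, hKq, add_zero] at hneg
  linarith

open Classical in
/-- The facets in the hyperplane normal to `p`, of the cones on one side, tile the hyperplane. -/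
lemma isTiling_image_trace {p q : EuclideanSpace ℝ (Fin d)} (hp : p ≠ 0) {c : ℝ} (hc : c ≠ 0)
    (hq : q = c • p) {T : Finset (Finset (EuclideanSpace ℝ (Fin d)))} (hT : IsTiling T)
    (hcov : ∀ x, ∃ S ∈ T, x ∈ coneOn (S : Set (EuclideanSpace ℝ (Fin d))))
    (hsign : ∀ S ∈ T, (∀ v ∈ S, 0 ≤ ⟪q, v⟫) ∨ ∀ v ∈ S, ⟪q, v⟫ ≤ 0) :
    IsTiling ((adjacent p q T).image (trace p)) := by
  have hmem : ∀ K ∈ (adjacent p q T).image (trace p), ∃ S, S ∈ T ∧ (∀ v ∈ S, 0 ≤ ⟪q, v⟫) ∧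
      (trace p S).card =
        Module.finrank ℝ ((ℝ ∙ p)ᗮ : Submodule ℝ (EuclideanSpace ℝ (Fin d))) ∧
      trace p S = K := by
    intro K hK
    obtain ⟨S, hS, rfl⟩ := Finset.mem_image.1 hK
    obtain ⟨hS, hcard⟩ := mem_adjacent.1 hS
    exact ⟨S, (mem_half.1 hS).1, (mem_half.1 hS).2, hcard, rfl⟩
  refine ⟨fun K hK => ?_, fun K hK => ?_, fun K hK K' hK' hne => ?_,
    -- Traces of smaller dimension are kept as the negligible part of the cover.
    ⟨((half T q).image (trace p)).filter fun K => K.card <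
      Module.finrank ℝ ((ℝ ∙ p)ᗮ : Submodule ℝ (EuclideanSpace ℝ (Fin d))),
      fun S hS => (Finset.mem_filter.1 hS).2, fun x => ?_⟩⟩
  · obtain ⟨S, hS, -, -, rfl⟩ := hmem K hK
    exact linearIndepOn_trace (hT.linearIndep S hS)
  · obtain ⟨S, -, -, h, rfl⟩ := hmem K hK
    exact h
  · obtain ⟨S, hS, hS0, -, rfl⟩ := hmem K hK
    obtain ⟨S', hS', -, -, rfl⟩ := hmem K' hK'
    rintro x ⟨hx, hx'⟩
    have hxx := hT.inter S hS S' hS' (fun h => hne (by rw [h]))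
      ⟨coe_mem_coneOn_of_trace hx, coe_mem_coneOn_of_trace hx'⟩
    rw [← Finset.coe_inter] at hxx
    have := mem_coneOn_trace hc hq (fun v hv => hS0 v (Finset.mem_inter.1 hv).1) hxx
    convert this using 2
    ext v
    simp [mem_trace]
  · have hq0 : q ≠ 0 := by rw [hq]; exact smul_ne_zero hc hp
    obtain ⟨S, hS, hxS⟩ := exists_mem_half hT hcov hsign hq0
      (x := x) (by rw [hq, real_inner_smul_left, mem_perp_iff.1 x.2, mul_zero])
    obtain ⟨hST, hS0⟩ := mem_half.1 hS
    refine ⟨trace p S, ?_, mem_coneOn_trace hc hq hS0 hxS⟩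
    rcases (card_trace_le (p := p) (hT.linearIndep S hST)).eq_or_lt with h | h
    · exact Or.inl (Finset.mem_image_of_mem _ (mem_adjacent.2 ⟨hS, h⟩))
    · exact Or.inr (Finset.mem_filter.2 ⟨Finset.mem_image_of_mem _ hS, h⟩)

end Traces

/-! ### Behaviour of the half sums in the direction p -/

section Limits

lemma tendsto_div_affine (α : ℝ) {β : ℝ} (hβ : β ≠ 0) :
    Filter.Tendsto (fun t : ℝ => t / (α + t * β)) Filter.atTop (𝓝 β⁻¹) := by
  have h1 : Filter.Tendsto (fun t : ℝ => (α * t⁻¹ + β)⁻¹) Filter.atTop (𝓝 β⁻¹) := by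
    have := ((tendsto_inv_atTop_zero (𝕜 := ℝ)).const_mul α).add_const β
    rw [mul_zero, zero_add] at this
    exact this.inv₀ hβ
  refine h1.congr' ?_
  filter_upwards [Filter.eventually_gt_atTop 0] with t ht
  have : α + t * β = t * (α * t⁻¹ + β) := by field_simp
  rw [this, div_mul_eq_div_div, div_self ht.ne', one_div]

lemma eventually_affine_ne_zero {α β : ℝ} (h : β = 0 → α ≠ 0) :
    ∀ᶠ t : ℝ in Filter.atTop, α + t * β ≠ 0 := by
  by_cases hβ : β = 0
  · exact Filter.Eventually.of_forall fun t => by simpa [hβ] using h hβ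
  · filter_upwards [Filter.eventually_gt_atTop (-α / β)] with t ht h0
    apply ht.ne'
    field_simp
    linarith

lemma tendsto_inv_affine (α β : ℝ) :
    Filter.Tendsto (fun t : ℝ => (α + t * β)⁻¹) Filter.atTop
      (𝓝 (if β = 0 then α⁻¹ else 0)) := by
  split_ifs with hβ
  · simp [hβ]
  · have h1 := (tendsto_div_affine α hβ).mul (tendsto_inv_atTop_zero (𝕜 := ℝ))
    rw [mul_zero] at h1
    refine h1.congr' ?_
    filter_upwards [Filter.eventually_gt_atTop 0] with t ht
    field_simp

/-- The factor `t` is absorbed by one growing factor of the denominator; any further growing factor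
sends the term to zero. -/
lemma tendsto_mul_div_prod_affine {E : Type*} [DecidableEq E] {S : Finset E} (D : ℝ)
    (α β : E → ℝ) {v : E} (hv : v ∈ S) (hβ : β v ≠ 0) :
    Filter.Tendsto (fun t : ℝ => t * (D / ∏ v ∈ S, (α v + t * β v))) Filter.atTop
      (𝓝 (D * (β v)⁻¹ * ∏ u ∈ S.erase v, if β u = 0 then (α u)⁻¹ else 0)) := by
  have h1 := ((tendsto_div_affine (α v) hβ).const_mul D).mul
    (tendsto_finsetProd (S.erase v) fun u _ =>
      tendsto_inv_affine (α u) (β u))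
  refine h1.congr fun t => ?_
  rw [← Finset.mul_prod_erase S _ hv, Finset.prod_inv_distrib, div_eq_mul_inv, div_eq_mul_inv,
    mul_inv]
  ring

variable {d : ℕ}

lemma aeval_affForm_add (P : Set (EuclideanSpace ℝ (Fin d))) (v z p : EuclideanSpace ℝ (Fin d))
    (t : ℝ) : MvPolynomial.aeval (fun i => z i + t * p i) (affForm P v) =
      supportFn P v + ⟪v, z⟫ + t * ⟪p, v⟫ := by
  have := eval_affForm P v (z + t • p)
  rw [inner_add_right, real_inner_smul_right, real_inner_comm p v, ← add_assoc] at this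
  rw [← this, MvPolynomial.aeval_eq_eval]
  rfl

/-- The part of the dual volume function that comes from the cones in a half-space. -/
noncomputable def halfVolume (P : Set (EuclideanSpace ℝ (Fin d)))
    (T : Finset (Finset (EuclideanSpace ℝ (Fin d)))) (q : EuclideanSpace ℝ (Fin d)) :
    RatFn (Fin d) :=
  triangulationSum absDet (half T q) fun v => MvPolynomial.aeval var (affForm P v)

lemma halfVolume_subst {L : Type*} [Field L] [Algebra ℝ L] (P : Set (EuclideanSpace ℝ (Fin d)))
    (T : Finset (Finset (EuclideanSpace ℝ (Fin d)))) (q : EuclideanSpace ℝ (Fin d)) (φ : Fin d → L)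
    (hφ : ∀ S ∈ half T q, ∀ v ∈ S, MvPolynomial.aeval φ (affForm P v) ≠ 0) :
    (halfVolume P T q).subst φ =
      triangulationSum absDet (half T q) fun v => MvPolynomial.aeval φ (affForm P v) :=
  subst_triangulationSum _ _ _ hφ

/-- Only cones with a single generator off the hyperplane survive. In those the slope of its factor
cancels the `⟪p, v⟫` of the determinant up to the sign `c` of the chosen side. -/
lemma tendsto_halfVolume {P : Set (EuclideanSpace ℝ (Fin d))} {p q : EuclideanSpace ℝ (Fin d)}
    (hp : p ≠ 0) {c : ℝ} (hc : c * c = 1) (hq : q = c • p)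
    {T : Finset (Finset (EuclideanSpace ℝ (Fin d)))} (hT : IsTiling T)
    (z : EuclideanSpace ℝ (Fin d))
    (hz : ∀ S ∈ T, ∀ v ∈ S, ⟪p, v⟫ = 0 → supportFn P v + ⟪v, z⟫ ≠ 0) :
    Filter.Tendsto
      (fun t : ℝ => t * (halfVolume P T q).subst fun i => z i + t * p i) Filter.atTop
      (𝓝 (c * ((∑ S ∈ adjacent p q T, absDetPerp p (trace p S) /
        ∏ v ∈ trace p S, (supportFn P (v : EuclideanSpace ℝ (Fin d)) +
          ⟪(v : EuclideanSpace ℝ (Fin d)), z⟫)) / ‖p‖ ^ 2))) := by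
  classical
  have hc0 : c ≠ 0 := by rintro rfl; simp at hc
  have hn : ‖p‖ ^ 2 ≠ 0 := by simpa using hp
  let α : EuclideanSpace ℝ (Fin d) → ℝ := fun v => supportFn P v + ⟪v, z⟫
  let β : EuclideanSpace ℝ (Fin d) → ℝ := fun v => ⟪p, v⟫
  have hαβ : ∀ S ∈ T, ∀ v ∈ S, β v = 0 → α v ≠ 0 := hz
  have hT' : ∀ S ∈ half T q, S ∈ T := fun S hS => (mem_half.1 hS).1
  have hev : ∀ᶠ t : ℝ in Filter.atTop, ∀ S ∈ half T q, ∀ v ∈ S, α v + t * β v ≠ 0 :=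
    (Filter.eventually_all_finset _).2 fun S hS => (Filter.eventually_all_finset _).2 fun v hv =>
      eventually_affine_ne_zero (hαβ S (hT' S hS) v hv)
  have hsum : ∀ᶠ t : ℝ in Filter.atTop,
      ∑ S ∈ half T q, t * (absDet S / ∏ v ∈ S, (α v + t * β v)) =
        t * (halfVolume P T q).subst fun i => z i + t * p i := by
    filter_upwards [hev] with t ht
    rw [halfVolume_subst _ _ _ _ (fun S hS v hv => by rw [aeval_affForm_add]; exact ht S hS v hv),
      triangulationSum, Finset.mul_sum]
    simp only [aeval_affForm_add]
    rfl
  -- In each cone a generator off the hyperplane is chosen, to absorb the factor `t`.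
  choose! v₀ hv₀ hβ₀ using fun S (hS : S ∈ half T q) =>
    exists_inner_ne_zero (hT.linearIndep S (hT' S hS)) (hT.fullDim S (hT' S hS)) hp
  have hlim := tendsto_finsetSum (half T q) fun S hS =>
    tendsto_mul_div_prod_affine (absDet S) α β (hv₀ S hS) (hβ₀ S hS)
  have heq : ∑ S ∈ half T q, (absDet S * (β (v₀ S))⁻¹ *
      ∏ u ∈ S.erase (v₀ S), if β u = 0 then (α u)⁻¹ else 0) =
      c * ((∑ S ∈ adjacent p q T, absDetPerp p (trace p S) /
        ∏ v ∈ trace p S, (supportFn P (v : EuclideanSpace ℝ (Fin d)) +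
          ⟪(v : EuclideanSpace ℝ (Fin d)), z⟫)) / ‖p‖ ^ 2) := by
    rw [Finset.sum_div, Finset.mul_sum, adjacent, Finset.sum_filter]
    refine Finset.sum_congr rfl fun S hS => ?_
    split_ifs with hadj
    · obtain ⟨v, hvS, hvH, hfil, hSv⟩ :=
        exists_eq_insert_of_mem_adjacent hp hT (mem_adjacent.2 ⟨hS, hadj⟩)
      have hv : v₀ S = v := by
        have : v₀ S ∈ S.filter (· ∉ (ℝ ∙ p)ᗮ) :=
          Finset.mem_filter.2 ⟨hv₀ S hS, fun h => hβ₀ S hS (mem_perp_iff.1 h)⟩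
        rw [hfil] at this
        exact Finset.mem_singleton.1 this
      have hvK : v ∉ (trace p S).map (Function.Embedding.subtype _) := fun h => by
        rw [map_trace] at h
        exact hvH (Finset.mem_filter.1 h).2
      have hβv : β v ≠ 0 := hv ▸ hβ₀ S hS
      have h1 := absDet_insert_mul hp (K := trace p S)
        (by rw [hadj]; exact finrank_perp_add_one hp) hvH
      have habs : |⟪p, v⟫| = c * β v := by
        have h2 := (mem_half.1 hS).2 v hvS
        rw [hq, real_inner_smul_left] at h2
        have h3 : |c| = 1 := by
          rw [← abs_mul_abs_self] at hc
          nlinarith [abs_nonneg c]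
        rw [← abs_of_nonneg h2, abs_mul, h3, one_mul]
      have hprod : (∏ u ∈ S.erase v, if β u = 0 then (α u)⁻¹ else 0) =
          (∏ v ∈ trace p S, α v)⁻¹ := by
        conv_lhs => rw [hSv]
        rw [Finset.erase_insert (by convert hvK), Finset.prod_map, ← Finset.prod_inv_distrib]
        refine Finset.prod_congr rfl fun u _ => ?_
        exact if_pos (mem_perp_iff.1 u.2)
      have h4 : absDet S * ‖p‖ ^ 2 = c * β v * absDetPerp p (trace p S) := by
        rw [← habs, ← h1]
        congr 2
      rw [hv, hprod]
      have h5 : absDet S * (β v)⁻¹ = c * (absDetPerp p (trace p S) / ‖p‖ ^ 2) := by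
        field_simp
        linarith
      rw [h5]
      simp only [α]
      ring
    -- In a cone without a facet in the hyperplane a second generator off it provides a zero factor
    -- in the limit.
    · have hcard : 1 < (S.filter (· ∉ (ℝ ∙ p)ᗮ)).card := by
        have h1 := Finset.card_filter_add_card_filter_not (s := S) (· ∈ (ℝ ∙ p)ᗮ)
        rw [← map_trace, Finset.card_map, hT.fullDim S (hT' S hS), finrank_euclideanSpace_fin] at h1
        have h2 := finrank_perp_add_one hp
        have h3 := card_trace_le (p := p) (hT.linearIndep S (hT' S hS))
        omega
      obtain ⟨u, hu, hne⟩ := Finset.exists_mem_ne hcard (v₀ S)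
      rw [Finset.mem_filter] at hu
      rw [Finset.prod_eq_zero (Finset.mem_erase.2 ⟨hne, hu.1⟩)
        (if_neg fun h => hu.2 (mem_perp_iff.2 h)), mul_zero]
  rw [← heq]
  exact hlim.congr' hsum

open Classical in
/-- The dual volume of the projection, computed from the facets of the cones on one side of the
hyperplane. -/
lemma dualVolume_projAlong {P : Set (EuclideanSpace ℝ (Fin d))} (hP : IsPolytope P)
    (hint : (interior P).Nonempty) {p q : EuclideanSpace ℝ (Fin d)} (hp : p ≠ 0) {c : ℝ}
    (hc : c ≠ 0) (hq : q = c • p) {T : Finset (Finset (EuclideanSpace ℝ (Fin d)))}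
    (hT : IsTriangulation (normalFan (P + interval p)) T)
    (z : ((ℝ ∙ p)ᗮ : Submodule ℝ (EuclideanSpace ℝ (Fin d))))
    (hz : ∀ v ∈ rayGens (normalFan (projAlong p P)), supportFn (projAlong p P - {z}) v ≠ 0) :
    dualVolume (absDetPerp p) (projAlong p P - {z}) =
      ∑ S ∈ adjacent p q T, absDetPerp p (trace p S) /
        ∏ v ∈ trace p S, (supportFn P (v : EuclideanSpace ℝ (Fin d)) +
          ⟪(v : EuclideanSpace ℝ (Fin d)), (z : EuclideanSpace ℝ (Fin d))⟫) := by
  have hQ := hP.add (isPolytope_interval p)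
  have hH := isPolytope_projAlong hP p
  have htil := hT.isTiling hQ
  have hsub := hT.subordinate' hQ
  have hsign : ∀ S ∈ T, (∀ v ∈ S, 0 ≤ ⟪q, v⟫) ∨ ∀ v ∈ S, ⟪q, v⟫ ≤ 0 := by
    intro S hS
    simp only [hq, real_inner_smul_left]
    rcases inner_sign_of_subordinate hsub hS with h | h <;> rcases hc.lt_or_gt with h0 | h0
    · exact Or.inr fun v hv => mul_nonpos_of_nonpos_of_nonneg h0.le (h v hv)
    · exact Or.inl fun v hv => mul_nonneg h0.le (h v hv)
    · exact Or.inl fun v hv => mul_nonneg_of_nonpos_of_nonpos h0.le (h v hv)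
    · exact Or.inr fun v hv => mul_nonpos_of_nonneg_of_nonpos h0.le (h v hv)
  have htilH := isTiling_image_trace hp hc hq htil (hT.exists_mem hQ) hsign
  obtain ⟨T', hT', hvol⟩ := exists_fanVolume_eq (L := ℝ) (absDetPerp p) hH
    (interior_projAlong_nonempty hint p)
  have haff : ∀ v : ((ℝ ∙ p)ᗮ : Submodule ℝ (EuclideanSpace ℝ (Fin d))),
      MvPolynomial.aeval (z : EuclideanSpace ℝ (Fin d)) (affForm P v) =
        supportFn (projAlong p P - {z}) v := fun v => by
    rw [MvPolynomial.aeval_eq_eval, supportFn_sub_singleton hH.isCompact hH.nonempty,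
      supportFn_projAlong hP]
    exact eval_affForm P v z
  have hlinH : ∀ a : EuclideanSpace ℝ (Fin d), (fun v : ((ℝ ∙ p)ᗮ : Submodule ℝ _) =>
      MvPolynomial.eval a (affForm P v)) =
      fun v => supportFn (projAlong p P) v + ⟪v, (ℝ ∙ p)ᗮ.orthogonalProjectionOnto a⟫ :=
    fun a => funext fun v => by rw [eval_affForm, supportFn_projAlong hP, inner_proj]
  rw [dualVolume, normalFan_sub_singleton hH, hvol]
  -- The triangulation of the fan of the projection is compared with the tiling by facets. All `d`
  -- coordinates serve as variables, so the interior of `P` itself is the open set of positivity.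
  have key := triangulationSum_eq (isDet_absDetPerp hp) (hT'.isTiling hH) htilH
    (fun v => affForm P (v : EuclideanSpace ℝ (Fin d)))
    (U := WithLp.toLp 2 ⁻¹' interior P) (isOpen_interior.preimage (PiLp.continuous_toLp 2 _))
    (by
      obtain ⟨y, hy⟩ := hint
      exact ⟨y, hy⟩)
    (fun a _ => by
      have h := (hT'.subordinate' hH).conewiseLinear.add (conewiseLinear_inner T'
        ((ℝ ∙ p)ᗮ.orthogonalProjectionOnto (WithLp.toLp 2 a)))
      rw [← hlinH] at h
      exact h)
    (fun a _ K hK => by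
      obtain ⟨S, hS, rfl⟩ := Finset.mem_image.1 hK
      obtain ⟨y, hy⟩ := hsub.add_left.conewiseLinear S (mem_half.1 (mem_adjacent.1 hS).1).1
      refine ⟨(ℝ ∙ p)ᗮ.orthogonalProjectionOnto (y + WithLp.toLp 2 a), fun v hv => ?_⟩
      have h1 := eval_affForm P (v : EuclideanSpace ℝ (Fin d)) (WithLp.toLp 2 a)
      rw [hy _ (coe_mem_coneOn_of_trace hv), ← inner_add_right, ← inner_proj p] at h1
      exact h1)
    (fun a ha v hv => by
      have h1 := eval_affForm P (v : EuclideanSpace ℝ (Fin d)) (WithLp.toLp 2 a)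
      have h2 := supportFn_pos_of_mem_interior hP.isCompact
        (show WithLp.toLp 2 a ∈ interior P from ha)
        (show (v : EuclideanSpace ℝ (Fin d)) ≠ 0 by simpa using hv)
      rw [← h1] at h2
      exact h2)
    (MvPolynomial.aeval (z : EuclideanSpace ℝ (Fin d)))
    (fun S hS v hv => by rw [haff]; exact hz v (hT'.gens S hS hv))
    (fun K hK v hv => by
      obtain ⟨S, hS, rfl⟩ := Finset.mem_image.1 hK
      rw [haff]
      exact hz v (mem_rayGens_projAlong hP
        (hT.gens S (mem_half.1 (mem_adjacent.1 hS).1).1 (mem_trace.1 hv))))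
  simp only [haff] at key
  rw [key, triangulationSum, Finset.sum_image (injOn_trace hp hc hq htil)]
  refine Finset.sum_congr rfl fun S _ => ?_
  rw [Algebra.algebraMap_self, RingHom.id_apply]
  congr 1
  refine Finset.prod_congr rfl fun v _ => ?_
  rw [supportFn_sub_singleton hH.isCompact hH.nonempty, supportFn_projAlong hP]
  rfl

end Limits

/-! ### Uniqueness of the splitting -/

section Uniqueness

variable {d : ℕ}

lemma coeff_affForm (P : Set (EuclideanSpace ℝ (Fin d))) (v : EuclideanSpace ℝ (Fin d))
    (i : Fin d) : (affForm P v).coeff (Finsupp.single i 1) = v i := by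
  have h : (0 : Fin d →₀ ℕ) ≠ Finsupp.single i 1 := fun h => by
    have := DFunLike.congr_fun h i
    simp at this
  simp [affForm, MvPolynomial.coeff_sum, MvPolynomial.coeff_C, MvPolynomial.coeff_X, h,
    Finsupp.single_left_inj]

lemma irreducible_affForm (P : Set (EuclideanSpace ℝ (Fin d))) {v : EuclideanSpace ℝ (Fin d)}
    (hv : v ≠ 0) : Irreducible (affForm P v) := by
  obtain ⟨i, hi⟩ : ∃ i, v i ≠ 0 := by
    by_contra! h
    exact hv (PiLp.ext h)
  refine MvPolynomial.irreducible_of_totalDegree_eq_one (le_antisymm ?_ ?_) fun x hx => ?_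
  · refine (MvPolynomial.totalDegree_add _ _).trans (max_le (by simp) ?_)
    refine (MvPolynomial.totalDegree_finsetSum _ _).trans (Finset.sup_le fun j _ => ?_)
    refine (MvPolynomial.totalDegree_mul _ _).trans (by simp)
  · have := MvPolynomial.le_totalDegree (p := affForm P v) (s := Finsupp.single i 1)
      (by rw [MvPolynomial.mem_support_iff, coeff_affForm]; exact hi)
    simpa using this
  · have := hx (Finsupp.single i 1)
    rw [coeff_affForm] at this
    exact isUnit_of_dvd_unit this (isUnit_iff_ne_zero.2 hi)

/-- If the form of `v` divided that of `w`, the latter would vanish on the face of `v`. So `w` would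
lie in the normal cone of that face, which is the ray of `v`. -/
lemma isRelPrime_affForm {P : Set (EuclideanSpace ℝ (Fin d))} (hP : IsPolytope P)
    {v w : EuclideanSpace ℝ (Fin d)} (hv : v ∈ rayGens (normalFan P))
    (hw : ‖w‖ = 1) (hvw : w ≠ v) : IsRelPrime (affForm P v) (affForm P w) := by
  have hv0 : v ≠ 0 := by
    rintro rfl
    simpa using hv.1
  refine (irreducible_affForm P hv0).isRelPrime_iff_not_dvd.2 fun ⟨k, hk⟩ => hvw ?_
  refine eq_of_mem_rayGens hP.isCompact hP.nonempty hv hw fun y hy => ?_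
  rw [mem_minFace_iff hP.isCompact]
  refine ⟨hy.1, ?_⟩
  have h1 := eval_affForm P w y
  have h2 := eval_affForm P v y
  rw [supportFn_eq_of_mem_minFace hy, neg_add_cancel] at h2
  rw [hk, map_mul, h2, zero_mul] at h1
  linarith

lemma eval_prod_affForm_add (P : Set (EuclideanSpace ℝ (Fin d)))
    (V : Finset (EuclideanSpace ℝ (Fin d))) (z p : EuclideanSpace ℝ (Fin d)) (t : ℝ)
    (hV : ∀ v ∈ V, ⟪p, v⟫ = 0) :
    MvPolynomial.eval (z + t • p) (∏ v ∈ V, affForm P v) =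
      MvPolynomial.eval z (∏ v ∈ V, affForm P v) := by
  rw [map_prod, map_prod]
  refine Finset.prod_congr rfl fun v hv => ?_
  rw [eval_affForm, eval_affForm, inner_add_right, real_inner_smul_right, real_inner_comm p v, hV v hv,
    mul_zero, add_zero]

/-- A polynomial is constantly zero on a line if its product with the parameter tends to zero. -/
lemma eval_line_eq_zero {N : MvPolynomial (Fin d) ℝ} {z p : EuclideanSpace ℝ (Fin d)}
    (h : Filter.Tendsto (fun t : ℝ => t * MvPolynomial.eval (z + t • p) N) Filter.atTop (𝓝 0))
    (t : ℝ) : MvPolynomial.eval (z + t • p) N = 0 := by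
  let q : Polynomial ℝ :=
    MvPolynomial.aeval (fun i => Polynomial.C (z i) + Polynomial.X * Polynomial.C (p i)) N
  have hq : ∀ t, q.eval t = MvPolynomial.eval (z + t • p) N := fun t => by
    have h1 : (Polynomial.aeval t).comp (MvPolynomial.aeval
        (fun i => Polynomial.C (z i) + Polynomial.X * Polynomial.C (p i))) =
        MvPolynomial.aeval (R := ℝ) (z + t • p) :=
      MvPolynomial.algHom_ext fun i => by simp; ring
    have h2 := DFunLike.congr_fun h1 N
    rw [MvPolynomial.aeval_eq_eval] at h2
    rw [← Polynomial.coe_aeval_eq_eval]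
    exact h2
  have h1 : Filter.Tendsto (fun t => (Polynomial.X * q).eval t) Filter.atTop (𝓝 0) := by
    simpa only [Polynomial.eval_mul, Polynomial.eval_X, hq] using h
  -- A univariate polynomial with a finite limit at infinity has that limit as leading coefficient,
  -- so `X * q` is zero.
  have h2 := (Polynomial.tendsto_nhds_iff _).1 h1
  have h3 := (mul_eq_zero.1 (Polynomial.leadingCoeff_eq_zero.1 h2.1)).resolve_left Polynomial.X_ne_zero
  rw [← hq, h3, Polynomial.eval_zero]

lemma finite_rays_pos {P : Set (EuclideanSpace ℝ (Fin d))} (hP : IsPolytope P)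
    (p : EuclideanSpace ℝ (Fin d)) : {v ∈ rayGens (normalFan P) | 0 < ⟪p, v⟫}.Finite :=
  (finite_rayGens hP).subset fun _ h => h.1

lemma finite_rays_neg {P : Set (EuclideanSpace ℝ (Fin d))} (hP : IsPolytope P)
    (p : EuclideanSpace ℝ (Fin d)) : {v ∈ rayGens (normalFan P) | ⟪p, v⟫ < 0}.Finite :=
  (finite_rayGens hP).subset fun _ h => h.1

lemma finite_rays_zero {P : Set (EuclideanSpace ℝ (Fin d))} (hP : IsPolytope P)
    (p : EuclideanSpace ℝ (Fin d)) : {v ∈ rayGens (normalFan P) | ⟪p, v⟫ = 0}.Finite :=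
  (finite_rayGens hP).subset fun _ h => h.1

lemma finite_rays_new {P : Set (EuclideanSpace ℝ (Fin d))} (hP : IsPolytope P)
    (p : EuclideanSpace ℝ (Fin d)) :
    (rayGens (normalFan (P + interval p)) \ rayGens (normalFan P)).Finite :=
  (finite_rayGens (hP.add (isPolytope_interval p))).subset Set.sdiff_subset

lemma finite_rays_level {P : Set (EuclideanSpace ℝ (Fin d))} (hP : IsPolytope P)
    (p : EuclideanSpace ℝ (Fin d)) :
    ({v ∈ rayGens (normalFan P) | ⟪p, v⟫ = 0} ∪
      (rayGens (normalFan (P + interval p)) \ rayGens (normalFan P))).Finite :=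
  (finite_rays_zero hP p).union (finite_rays_new hP p)

lemma Bzero_mul_Dnew {P : Set (EuclideanSpace ℝ (Fin d))} (hP : IsPolytope P)
    (p : EuclideanSpace ℝ (Fin d)) :
    Bzero P p * Dnew P p = ∏ v ∈ (finite_rays_level hP p).toFinset, affForm P v := by
  rw [Bzero, Dnew, ← finprod_mem_union (Set.disjoint_left.2 fun v hv hv' => hv'.2 hv.1)
    (finite_rays_zero hP p) (finite_rays_new hP p), finprod_mem_eq_finite_toFinset_prod]

/-- New rays are normal to `p`, so `B_0 D` is constant in the direction `p`. -/
lemma inner_eq_zero_of_level {P : Set (EuclideanSpace ℝ (Fin d))} (hP : IsPolytope P)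
    (hint : (interior P).Nonempty) {p v : EuclideanSpace ℝ (Fin d)}
    (hv : v ∈ (finite_rays_level hP p).toFinset) : ⟪p, v⟫ = 0 := by
  rw [Set.Finite.mem_toFinset] at hv
  rcases hv with h | h
  · exact h.2
  · by_contra hne
    exact h.2 (mem_rayGens_of_inner_ne_zero hP hint h.1 hne)

lemma ne_zero_of_norm {E : Type*} [NormedAddCommGroup E] {v : E} (hv : ‖v‖ = 1) : v ≠ 0 := by
  rintro rfl
  simp at hv

lemma prod_affForm_ne_zero {P : Set (EuclideanSpace ℝ (Fin d))}
    {V : Finset (EuclideanSpace ℝ (Fin d))} (hV : ∀ v ∈ V, ‖v‖ = 1) :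
    ∏ v ∈ V, affForm P v ≠ 0 :=
  Finset.prod_ne_zero_iff.2 fun v hv => affForm_ne_zero P (ne_zero_of_norm (hV v hv))

lemma norm_of_level {P : Set (EuclideanSpace ℝ (Fin d))} (hP : IsPolytope P)
    {p v : EuclideanSpace ℝ (Fin d)} (hv : v ∈ (finite_rays_level hP p).toFinset) : ‖v‖ = 1 := by
  rw [Set.Finite.mem_toFinset] at hv
  rcases hv with h | h
  · exact h.1.1
  · exact h.1.1

theorem IsSplitting.unique {P : Set (EuclideanSpace ℝ (Fin d))} {p : EuclideanSpace ℝ (Fin d)}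
    (hP : IsPolytope P) (hint : (interior P).Nonempty)
    {Wpos Wneg Wpos' Wneg' : RatFn (Fin d)} (h : IsSplitting P p Wpos Wneg)
    (h' : IsSplitting P p Wpos' Wneg') : Wpos' = Wpos ∧ Wneg' = Wneg := by
  classical
  suffices hpos : Wpos' = Wpos by
    refine ⟨hpos, ?_⟩
    have := h'.add_eq.trans h.add_eq.symm
    rw [hpos] at this
    exact add_left_cancel this
  obtain ⟨A, hA⟩ := h.denom_pos
  obtain ⟨A', hA'⟩ := h'.denom_pos
  obtain ⟨C, hC⟩ := h.denom_neg
  obtain ⟨C', hC'⟩ := h'.denom_neg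
  set Vz := (finite_rays_level hP p).toFinset with hVz
  set Vp := (finite_rays_pos hP p).toFinset with hVp
  set Vn := (finite_rays_neg hP p).toFinset with hVn
  have hBp : Bpos P p = ∏ v ∈ Vp, affForm P v := finprod_mem_eq_finite_toFinset_prod _ _
  have hBn : Bneg P p = ∏ v ∈ Vn, affForm P v := finprod_mem_eq_finite_toFinset_prod _ _
  have hmemp : ∀ v ∈ Vp, v ∈ rayGens (normalFan P) ∧ 0 < ⟪p, v⟫ := fun v hv => by
    rw [hVp, Set.Finite.mem_toFinset] at hv; exact hv
  have hmemn : ∀ v ∈ Vn, v ∈ rayGens (normalFan P) ∧ ⟪p, v⟫ < 0 := fun v hv => by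
    rw [hVn, Set.Finite.mem_toFinset] at hv; exact hv
  have hBp0 : Bpos P p ≠ 0 := hBp ▸ prod_affForm_ne_zero fun v hv => (hmemp v hv).1.1
  have hBn0 : Bneg P p ≠ 0 := hBn ▸ prod_affForm_ne_zero fun v hv => (hmemn v hv).1.1
  set Z := Bzero P p * Dnew P p with hZ
  have hZprod : Z = ∏ v ∈ Vz, affForm P v := Bzero_mul_Dnew hP p
  have hZ0 : Z ≠ 0 := hZprod ▸ prod_affForm_ne_zero fun v hv => norm_of_level hP hv
  rw [mul_assoc, ← hZ] at hA hA' hC hC'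
  let ι := algebraMap (MvPolynomial (Fin d) ℝ) (RatFn (Fin d))
  have hinj : Function.Injective ι := IsFractionRing.injective _ _
  have hne : ∀ {q}, q ≠ 0 → ι q ≠ 0 := fun hq => by simpa [ι] using hq
  -- The difference of the positive parts is the opposite of the difference of the negative parts,
  -- so it has both denominators.
  have hcross : (A' - A) * Bneg P p = (C - C') * Bpos P p := by
    have h1 : Wpos' - Wpos = Wneg - Wneg' := by
      linear_combination h'.add_eq - h.add_eq
    rw [hA, hA', hC, hC', ← sub_div, ← sub_div, ← map_sub, ← map_sub,
      div_eq_div_iff (hne (mul_ne_zero hBp0 hZ0)) (hne (mul_ne_zero hBn0 hZ0))] at h1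
    rw [← map_mul, ← map_mul] at h1
    have h2 := hinj h1
    refine mul_right_cancel₀ hZ0 ?_
    linear_combination h2
  have hrel : IsRelPrime (Bpos P p) (Bneg P p) := by
    rw [hBp, hBn]
    refine IsRelPrime.prod_left fun v hv => IsRelPrime.prod_right fun w hw =>
      isRelPrime_affForm hP (hmemp v hv).1 (hmemn w hw).1.1 fun he => ?_
    have h1 := (hmemp v hv).2
    have h2 := (hmemn w hw).2
    rw [he] at h2
    exact lt_asymm h1 h2
  obtain ⟨N, hN⟩ : Bpos P p ∣ A' - A :=
    hrel.dvd_of_dvd_mul_right ⟨C - C', by rw [hcross, mul_comm]⟩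
  suffices hN0 : N = 0 by
    rw [hN0, mul_zero, sub_eq_zero] at hN
    rw [hA, hA', hN]
  have hfinH := finite_rayGens (isPolytope_projAlong hP p)
  let VH := hfinH.toFinset.map (Function.Embedding.subtype _)
  have hVH : ∀ v ∈ VH, ∃ hv : v ∈ (ℝ ∙ p)ᗮ, (⟨v, hv⟩ :
      ((ℝ ∙ p)ᗮ : Submodule ℝ (EuclideanSpace ℝ (Fin d)))) ∈ rayGens (normalFan (projAlong p P)) := by
    intro v hv
    obtain ⟨w, hw, rfl⟩ := Finset.mem_map.1 hv
    exact ⟨w.2, hfinH.mem_toFinset.1 hw⟩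
  have hG0 : ∏ v ∈ VH, affForm P v ≠ 0 := prod_affForm_ne_zero fun v hv => by
    obtain ⟨_, h1⟩ := hVH v hv
    exact h1.1
  -- The limit condition is available only on lines where the dual volume of the projection is
  -- defined. The extra nonzero factors vanish on the excluded lines and on those where `B_0 D`
  -- vanishes.
  have hprod : N * (Z * ∏ v ∈ VH, affForm P v) = 0 := by
    refine MvPolynomial.funext fun x => ?_
    rw [map_zero]
    set z : EuclideanSpace ℝ (Fin d) := WithLp.toLp 2 x with hz
    have hzx : x = z := rfl
    set z₀ := (ℝ ∙ p)ᗮ.orthogonalProjectionOnto z with hz₀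
    obtain ⟨t, ht⟩ : ∃ t : ℝ, z = (z₀ : EuclideanSpace ℝ (Fin d)) + t • p := by
      refine ⟨⟪p, z⟫ / ‖p‖ ^ 2, ?_⟩
      have h1 := (ℝ ∙ p).starProjection_add_starProjection_orthogonal z
      rw [Submodule.starProjection_singleton] at h1
      conv_lhs => rw [← h1]
      rw [add_comm]
      rfl
    rw [hzx, ht, map_mul, map_mul, hZprod,
      eval_prod_affForm_add P Vz _ p t fun v hv => inner_eq_zero_of_level hP hint hv,
      eval_prod_affForm_add P VH _ p t fun v hv => mem_perp_iff.1 (hVH v hv).1]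
    by_cases hZz : MvPolynomial.eval (z₀ : EuclideanSpace ℝ (Fin d)) (∏ v ∈ Vz, affForm P v) = 0
    · rw [hZz, zero_mul, mul_zero]
    by_cases hGz : MvPolynomial.eval (z₀ : EuclideanSpace ℝ (Fin d)) (∏ v ∈ VH, affForm P v) = 0
    · rw [hGz, mul_zero, mul_zero]
    have hallowed : ∀ v ∈ rayGens (normalFan (projAlong p P)),
        supportFn (projAlong p P - {z₀}) v ≠ 0 := by
      intro v hv
      have hH := isPolytope_projAlong hP p
      rw [supportFn_sub_singleton hH.isCompact hH.nonempty, supportFn_projAlong hP]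
      have hGz' := hGz
      rw [map_prod, Finset.prod_eq_zero_iff] at hGz'
      push Not at hGz'
      have := hGz' v (Finset.mem_map.2 ⟨v, hfinH.mem_toFinset.2 hv, rfl⟩)
      rwa [eval_affForm] at this
    -- Both candidates have the same limit. Multiplied by the value of `Z`, constant on the line,
    -- their difference becomes `t` times `N`.
    have hlim := ((h'.lim_pos z₀ hallowed).sub (h.lim_pos z₀ hallowed)).mul_const
      (MvPolynomial.eval (z₀ : EuclideanSpace ℝ (Fin d)) (∏ v ∈ Vz, affForm P v))
    rw [sub_self, zero_mul] at hlim
    rw [eval_line_eq_zero (hlim.congr' ?_), zero_mul]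
    have hev : ∀ᶠ s : ℝ in Filter.atTop, ∀ v ∈ Vp,
        supportFn P v + ⟪v, (z₀ : EuclideanSpace ℝ (Fin d))⟫ + s * ⟪p, v⟫ ≠ 0 :=
      (Filter.eventually_all_finset _).2 fun v hv =>
        eventually_affine_ne_zero fun h0 => absurd h0 (hmemp v hv).2.ne'
    filter_upwards [hev] with s hs
    have hφ : ∀ q, MvPolynomial.aeval
        (fun i => (z₀ : EuclideanSpace ℝ (Fin d)) i + s * p i) q =
        MvPolynomial.eval ((z₀ : EuclideanSpace ℝ (Fin d)) + s • p) q := fun q => by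
      rw [MvPolynomial.aeval_eq_eval]; rfl
    have hZs : MvPolynomial.eval ((z₀ : EuclideanSpace ℝ (Fin d)) + s • p) Z =
        MvPolynomial.eval (z₀ : EuclideanSpace ℝ (Fin d)) (∏ v ∈ Vz, affForm P v) := by
      rw [hZprod, eval_prod_affForm_add P Vz _ p s fun v hv => inner_eq_zero_of_level hP hint hv]
    have hBs : MvPolynomial.eval ((z₀ : EuclideanSpace ℝ (Fin d)) + s • p) (Bpos P p) ≠ 0 := by
      rw [hBp, map_prod]
      refine Finset.prod_ne_zero_iff.2 fun v hv => ?_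
      rw [← hφ, aeval_affForm_add]
      exact hs v hv
    have hden : MvPolynomial.aeval (fun i => (z₀ : EuclideanSpace ℝ (Fin d)) i + s * p i)
        (Bpos P p * Z) ≠ 0 := by
      rw [hφ, map_mul, hZs]
      exact mul_ne_zero hBs hZz
    rw [RatFn.subst_eq_div hA hden, RatFn.subst_eq_div hA' hden, ← mul_sub, ← sub_div, ← map_sub,
      hN, hφ, hφ, map_mul, map_mul, hZs]
    field_simp
  exact (mul_eq_zero.1 hprod).resolve_right (mul_ne_zero hZ0 hG0)

end Uniqueness

/-! ### Denominators of the half sums -/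

section Denominators

variable {d : ℕ}

lemma interval_neg {E : Type*} [AddCommGroup E] [Module ℝ E] (p : E) :
    interval (-p) = interval p := by
  rw [interval, interval, neg_neg, segment_symm]

/-- Replacing `p` by `-p` exchanges the two sides, so `W_-` is obtained from the results for `W_+`.
-/
lemma Bpos_neg (P : Set (EuclideanSpace ℝ (Fin d))) (p : EuclideanSpace ℝ (Fin d)) :
    Bpos P (-p) = Bneg P p := by
  simp only [Bpos, Bneg, inner_neg_left, Left.neg_pos_iff]

lemma Bzero_neg (P : Set (EuclideanSpace ℝ (Fin d))) (p : EuclideanSpace ℝ (Fin d)) :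
    Bzero P (-p) = Bzero P p := by
  simp only [Bzero, inner_neg_left, neg_eq_zero]

lemma Dnew_neg (P : Set (EuclideanSpace ℝ (Fin d))) (p : EuclideanSpace ℝ (Fin d)) :
    Dnew P (-p) = Dnew P p := by
  rw [Dnew, Dnew, interval_neg]

/-- A generator on the nonnegative side is either a ray of the fan of `P`, counted in `B_+` or `B_0`
by its sign on `p`, or a new ray, counted in `D`. -/
lemma exists_halfVolume_eq {P : Set (EuclideanSpace ℝ (Fin d))} (hP : IsPolytope P)
    {p : EuclideanSpace ℝ (Fin d)} {T : Finset (Finset (EuclideanSpace ℝ (Fin d)))}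
    (hT : IsTriangulation (normalFan (P + interval p)) T) :
    ∃ A : MvPolynomial (Fin d) ℝ, halfVolume P T p = algebraMap _ (RatFn (Fin d)) A /
      algebraMap _ (RatFn (Fin d)) (Bpos P p * Bzero P p * Dnew P p) := by
  classical
  have hVp : ∀ v ∈ (finite_rays_pos hP p).toFinset, v ∈ rayGens (normalFan P) ∧ 0 < ⟪p, v⟫ :=
    fun v hv => by rw [Set.Finite.mem_toFinset] at hv; exact hv
  have hdisj : Disjoint (finite_rays_pos hP p).toFinset (finite_rays_level hP p).toFinset := by
    refine Finset.disjoint_left.2 fun v hv hv' => ?_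
    rw [Set.Finite.mem_toFinset] at hv'
    rcases hv' with h | h
    · exact (hVp v hv).2.ne' h.2
    · exact h.2 (hVp v hv).1
  have hprod : Bpos P p * Bzero P p * Dnew P p =
      ∏ v ∈ (finite_rays_pos hP p).toFinset ∪ (finite_rays_level hP p).toFinset, affForm P v := by
    rw [Finset.prod_union hdisj, ← Bzero_mul_Dnew hP p, ← mul_assoc, Bpos,
      finprod_mem_eq_finite_toFinset_prod _ (finite_rays_pos hP p)]
  refine ⟨sumNumerator absDet (half T p)
    ((finite_rays_pos hP p).toFinset ∪ (finite_rays_level hP p).toFinset) (affForm P), ?_⟩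
  rw [hprod, ← aeval_var, ← aeval_var]
  refine triangulationSum_eq_div absDet (fun v hv => ?_) (affForm P) _ fun v hv => ?_
  · obtain ⟨S, hS, hvS⟩ := mem_allGens.1 hv
    obtain ⟨hST, hpos⟩ := mem_half.1 hS
    have hgen := hT.gens S hST hvS
    rw [Finset.mem_union, Set.Finite.mem_toFinset, Set.Finite.mem_toFinset]
    by_cases hvP : v ∈ rayGens (normalFan P)
    · rcases (hpos v hvS).eq_or_lt with h | h
      · exact Or.inr (Or.inl ⟨hvP, h.symm⟩)
      · exact Or.inl ⟨hvP, h⟩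
    · exact Or.inr (Or.inr ⟨hgen, hvP⟩)
  · have hnorm : ‖v‖ = 1 := by
      rcases Finset.mem_union.1 hv with h | h
      · exact (hVp v h).1.1
      · exact norm_of_level hP h
    rw [aeval_var]
    simpa using affForm_ne_zero P (ne_zero_of_norm hnorm)

end Denominators

/-! ### Independence of the tiling, and thickening as translation -/

section Identities

variable {d : ℕ}

lemma aeval_var_affForm_ne_zero (P : Set (EuclideanSpace ℝ (Fin d)))
    {v : EuclideanSpace ℝ (Fin d)} (hv : v ≠ 0) :
    MvPolynomial.aeval (var : Fin d → RatFn (Fin d)) (affForm P v) ≠ 0 := by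
  rw [aeval_var]
  simpa using affForm_ne_zero P hv

lemma algebraMap_ratFn {σ : Type*} (r : ℝ) :
    algebraMap ℝ (RatFn σ) r = algebraMap (MvPolynomial σ ℝ) (RatFn σ) (MvPolynomial.C r) :=
  IsScalarTower.algebraMap_apply ℝ (MvPolynomial σ ℝ) (RatFn σ) r

lemma shiftedVolume_eq {P Q : Set (EuclideanSpace ℝ (Fin d))} (hQ : IsPolytope Q)
    (hint : (interior Q).Nonempty) : ∃ T, IsTriangulation (normalFan Q) T ∧
      shiftedVolume (normalFan Q) (fun v => algebraMap ℝ _ (supportFn P v)) var =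
        triangulationSum absDet T
          fun v => MvPolynomial.aeval (var : Fin d → RatFn (Fin d)) (affForm P v) := by
  obtain ⟨T, hT, h⟩ := exists_fanVolume_eq (L := RatFn (Fin d)) absDet hQ hint
  refine ⟨T, hT, ?_⟩
  rw [shiftedVolume, h]
  simp only [aeval_affForm]

/-- The dual volume function can be computed from any tiling by simplicial cones on which the
support function is linear. -/
lemma triangulationSum_affForm_eq {P : Set (EuclideanSpace ℝ (Fin d))} (hP : IsPolytope P)
    (hint : (interior P).Nonempty) {T T' : Finset (Finset (EuclideanSpace ℝ (Fin d)))}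
    (hT : IsTiling T) (hT' : IsTiling T') (hlin : ConewiseLinear T (supportFn P))
    (hlin' : ConewiseLinear T' (supportFn P)) :
    triangulationSum absDet T
        (fun v => MvPolynomial.aeval (var : Fin d → RatFn (Fin d)) (affForm P v)) =
      triangulationSum absDet T'
        (fun v => MvPolynomial.aeval (var : Fin d → RatFn (Fin d)) (affForm P v)) := by
  have h0 : ∀ {T : Finset (Finset (EuclideanSpace ℝ (Fin d)))}, IsTiling T →
      ∀ S ∈ T, ∀ v ∈ S, v ≠ 0 := by
    rintro T hT S hS v hv rfl
    exact (hT.linearIndep S hS).ne_zero (Finset.mem_coe.2 hv) rfl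
  have hl : ∀ {T : Finset (Finset (EuclideanSpace ℝ (Fin d)))}, ConewiseLinear T (supportFn P) →
      ∀ a : EuclideanSpace ℝ (Fin d),
      ConewiseLinear T fun v => MvPolynomial.eval a (affForm P v) := by
    intro T hlin a
    simp only [eval_affForm]
    exact hlin.add (conewiseLinear_inner T a)
  refine triangulationSum_eq isDet_absDet hT hT' (affForm P) (U := WithLp.toLp 2 ⁻¹' interior P)
    (isOpen_interior.preimage (PiLp.continuous_toLp 2 _)) ?_
    (fun a _ => hl hlin (WithLp.toLp 2 a)) (fun a _ => hl hlin' (WithLp.toLp 2 a))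
    (fun a ha v hv => ?_) _ (fun S hS v hv => aeval_var_affForm_ne_zero P (h0 hT S hS v hv))
    (fun S hS v hv => aeval_var_affForm_ne_zero P (h0 hT' S hS v hv))
  · obtain ⟨y, hy⟩ := hint
    exact ⟨y, hy⟩
  · have h1 := eval_affForm P v (WithLp.toLp 2 a)
    have h2 := supportFn_pos_of_mem_interior hP.isCompact
      (show WithLp.toLp 2 a ∈ interior P from ha) hv
    rw [← h1] at h2
    exact h2

/-- The tiling may come from a finer fan: one triangulation for P + [-p, p] computes the dual
volumes of P and of all thickenings. -/
lemma dualVolumeFn_eq {P : Set (EuclideanSpace ℝ (Fin d))} (hP : IsPolytope P)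
    (hint : (interior P).Nonempty) {T : Finset (Finset (EuclideanSpace ℝ (Fin d)))}
    (hT : IsTiling T) (hlin : ConewiseLinear T (supportFn P)) :
    dualVolumeFn P = triangulationSum absDet T
      fun v => MvPolynomial.aeval (var : Fin d → RatFn (Fin d)) (affForm P v) := by
  obtain ⟨T', hT', h⟩ := shiftedVolume_eq (P := P) hP hint
  rw [dualVolumeFn, h]
  exact triangulationSum_affForm_eq hP hint (hT'.isTiling hP) hT
    (hT'.subordinate' hP).conewiseLinear hlin

lemma supportFn_smul_interval {E : Type*} [NormedAddCommGroup E] [InnerProductSpace ℝ E] {x : ℝ}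
    (hx : 0 ≤ x) (p v : E) : supportFn (x • interval p) v = x * |⟪p, v⟫| := by
  rcases hx.eq_or_lt with rfl | hx
  · have : (0 : E) ∈ minFace ((0 : ℝ) • interval p) v := by
      rw [Set.zero_smul_set (interval_nonempty p)]
      exact ⟨rfl, by simp⟩
    rw [supportFn_eq_of_mem_minFace this]; simp
  · rw [supportFn_smul (isPolytope_interval p).isCompact (interval_nonempty p) hx,
      supportFn_interval]

lemma supportFn_add_smul_interval {P : Set (EuclideanSpace ℝ (Fin d))} (hP : IsPolytope P) {x : ℝ}
    (hx : 0 ≤ x) (p v : EuclideanSpace ℝ (Fin d)) :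
    supportFn (P + x • interval p) v = supportFn P v + x * |⟪p, v⟫| := by
  have h := (isPolytope_interval p).smul x
  rw [supportFn_add hP.isCompact hP.nonempty h.isCompact h.nonempty, supportFn_smul_interval hx]

lemma interior_add_smul_interval {P : Set (EuclideanSpace ℝ (Fin d))}
    (hint : (interior P).Nonempty) (x : ℝ) (p : EuclideanSpace ℝ (Fin d)) :
    (interior (P + x • interval p)).Nonempty := by
  obtain ⟨y, hy⟩ := (interval_nonempty p).smul_set (a := x)
  obtain ⟨z, hz⟩ := hint
  exact ⟨z + y, (subset_interior_add_left (s := P)) (Set.add_mem_add hz hy)⟩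

lemma sum_algebraMap_mul {L : Type*} [Field L] [Algebra ℝ L] (v p : EuclideanSpace ℝ (Fin d)) :
    ∑ i, algebraMap ℝ L (v i) * algebraMap ℝ L (p i) = algebraMap ℝ L ⟪p, v⟫ := by
  rw [real_inner_comm, ← sum_mul_eq_inner, map_sum]
  simp only [map_mul]

/-- Translation of the argument by a multiple of `p` is the same as thickening, on the half-space
where the support function of the interval is the linear form `⟪p, ·⟫`. -/
lemma aeval_affForm_translate {P : Set (EuclideanSpace ℝ (Fin d))} (hP : IsPolytope P) {x : ℝ}
    (hx : 0 ≤ x) {p v : EuclideanSpace ℝ (Fin d)} (hv : 0 ≤ ⟪p, v⟫) :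
    MvPolynomial.aeval (fun i => var i + algebraMap ℝ (RatFn (Fin d)) (x * p i)) (affForm P v) =
      MvPolynomial.aeval (var : Fin d → RatFn (Fin d)) (affForm (P + x • interval p) v) := by
  rw [aeval_affForm, aeval_affForm, supportFn_add_smul_interval hP hx, abs_of_nonneg hv, map_add,
    map_mul, ← sum_algebraMap_mul, Finset.mul_sum, add_assoc, ← Finset.sum_add_distrib]
  congr 1
  refine Finset.sum_congr rfl fun i _ => ?_
  rw [map_mul]
  ring

lemma halfVolume_translate {P : Set (EuclideanSpace ℝ (Fin d))} (hP : IsPolytope P) {x : ℝ}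
    (hx : 0 ≤ x) (p : EuclideanSpace ℝ (Fin d)) {T : Finset (Finset (EuclideanSpace ℝ (Fin d)))}
    (hT : ∀ S ∈ T, ∀ v ∈ S, v ≠ 0) :
    (halfVolume P T p).subst (fun i => var i + algebraMap ℝ (RatFn (Fin d)) (x * p i)) =
      triangulationSum absDet (half T p) fun v =>
        MvPolynomial.aeval (var : Fin d → RatFn (Fin d)) (affForm (P + x • interval p) v) := by
  have key : ∀ S ∈ half T p, ∀ v ∈ S, MvPolynomial.aeval
      (fun i => var i + algebraMap ℝ (RatFn (Fin d)) (x * p i)) (affForm P v) =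
      MvPolynomial.aeval (var : Fin d → RatFn (Fin d)) (affForm (P + x • interval p) v) :=
    fun S hS v hv => aeval_affForm_translate hP hx ((mem_half.1 hS).2 v hv)
  rw [halfVolume_subst _ _ _ _ fun S hS v hv => by
    rw [key S hS v hv]; exact aeval_var_affForm_ne_zero _ (hT S (mem_half.1 hS).1 v hv)]
  exact triangulationSum_congr key

/-- A substitution with a left inverse is injective on polynomials, so it creates no zero
denominators. -/
lemma aeval_ne_zero_of_retraction {σ τ : Type*} {q : MvPolynomial τ ℝ} (hq : q ≠ 0)
    (ψ : τ → MvPolynomial σ ℝ) (θ : σ → MvPolynomial τ ℝ)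
    (h : ∀ i, MvPolynomial.aeval θ (ψ i) = MvPolynomial.X i) :
    MvPolynomial.aeval (fun i => algebraMap _ (RatFn σ) (ψ i)) q ≠ 0 := by
  have h1 : MvPolynomial.aeval (fun i => algebraMap _ (RatFn σ) (ψ i)) q =
      algebraMap _ (RatFn σ) (MvPolynomial.aeval ψ q) := by
    have : MvPolynomial.aeval (fun i => algebraMap _ (RatFn σ) (ψ i)) =
        (Algebra.algHom ℝ (MvPolynomial σ ℝ) (RatFn σ)).comp (MvPolynomial.aeval ψ) :=
      MvPolynomial.algHom_ext fun i => by
        rw [AlgHom.comp_apply, MvPolynomial.aeval_X, MvPolynomial.aeval_X]; rfl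
    rw [this]; rfl
  have h2 : (MvPolynomial.aeval θ).comp (MvPolynomial.aeval ψ) = AlgHom.id ℝ (MvPolynomial τ ℝ) :=
    MvPolynomial.algHom_ext fun i => by rw [AlgHom.comp_apply, MvPolynomial.aeval_X, h]; rfl
  rw [h1]
  intro h0
  have h3 : MvPolynomial.aeval ψ q = 0 := by simpa using h0
  have h4 := DFunLike.congr_fun h2 q
  rw [AlgHom.comp_apply, h3, map_zero] at h4
  exact hq h4.symm

lemma halfVolume_thickened {P : Set (EuclideanSpace ℝ (Fin d))}
    {T : Finset (Finset (EuclideanSpace ℝ (Fin d)))} (hT : ∀ S ∈ T, ∀ v ∈ S, v ≠ 0)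
    (p : EuclideanSpace ℝ (Fin d)) :
    (halfVolume P T p).subst
        (fun i => var (some i) + var none * algebraMap ℝ (RatFn (Option (Fin d))) (p i)) =
      triangulationSum absDet (half T p) fun v =>
        (algebraMap ℝ (RatFn (Option (Fin d))) (supportFn P v) +
          var none * algebraMap ℝ _ (supportFn (interval p) v)) +
        ∑ i, algebraMap ℝ _ (v i) * var (some i) := by
  have hφ : (fun i => var (some i) + var none * algebraMap ℝ (RatFn (Option (Fin d))) (p i)) =
      fun i => algebraMap (MvPolynomial (Option (Fin d)) ℝ) (RatFn (Option (Fin d)))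
        (MvPolynomial.X (some i) + MvPolynomial.X none * MvPolynomial.C (p i)) := by
    funext i
    rw [algebraMap_ratFn, map_add, map_mul, var, var]
  rw [halfVolume_subst _ _ _ _ fun S hS v hv => by
    rw [hφ]
    exact aeval_ne_zero_of_retraction (affForm_ne_zero P (hT S (mem_half.1 hS).1 v hv)) _
      -- The left inverse of `z ↦ z + x p` sets `x = 0`.
      (fun o => o.elim 0 MvPolynomial.X) fun i => by simp]
  refine triangulationSum_congr fun S hS v hv => ?_
  rw [aeval_affForm, supportFn_interval, abs_of_nonneg ((mem_half.1 hS).2 v hv),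
    ← sum_algebraMap_mul, Finset.mul_sum, add_assoc, ← Finset.sum_add_distrib]
  congr 1
  refine Finset.sum_congr rfl fun i _ => ?_
  ring

end Identities

/-! ### Mixed volume functions of zonotopes -/

section Zonotopes

variable {d : ℕ}

/-- The dual mixed volume function at constant parameters is the dual volume function of the
weighted sum. -/
lemma dualMixedVolumeFn_subst {ι : Type} [Fintype ι] {Q : ι → Set (EuclideanSpace ℝ (Fin d))}
    (hQ : ∀ j, IsPolytope (Q j)) (hint : (interior (∑ j, Q j)).Nonempty) (a : ι → ℝ)
    {P : Set (EuclideanSpace ℝ (Fin d))} (hP : IsPolytope P) (hintP : (interior P).Nonempty)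
    (hsupp : ∀ v, supportFn P v = ∑ j, a j * supportFn (Q j) v) :
    (dualMixedVolumeFn Q).subst (Sum.elim (fun j => algebraMap ℝ (RatFn (Fin d)) (a j)) var) =
      dualVolumeFn P := by
  have hsum := isPolytope_sum Finset.univ hQ
  obtain ⟨T, hT, h⟩ := exists_fanVolume_eq (L := RatFn (ι ⊕ Fin d)) absDet hsum hint
  -- The fan of the unweighted sum refines that of each summand, so any weighted sum of the support
  -- functions is linear on the cones of `T`.
  have hlin : ConewiseLinear T (supportFn P) := by
    have : supportFn P = fun v => ∑ j, a j * supportFn (Q j) v := funext hsupp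
    rw [this]
    exact ConewiseLinear.sum _ fun j =>
      ((hT.subordinate' hsum).sum j).conewiseLinear.const_mul (a j)
  let q : EuclideanSpace ℝ (Fin d) → MvPolynomial (ι ⊕ Fin d) ℝ := fun v =>
    ∑ j, MvPolynomial.X (Sum.inl j) * MvPolynomial.C (supportFn (Q j) v) +
      ∑ i, MvPolynomial.C (v i) * MvPolynomial.X (Sum.inr i)
  have hq : dualMixedVolumeFn Q = triangulationSum absDet T
      fun v => MvPolynomial.aeval (var : ι ⊕ Fin d → RatFn (ι ⊕ Fin d)) (q v) := by
    rw [dualMixedVolumeFn, shiftedVolume, h]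
    refine triangulationSum_congr fun S _ v _ => ?_
    simp only [q, map_add, map_sum, map_mul, MvPolynomial.aeval_X, MvPolynomial.aeval_C]
  have hφ : ∀ v, MvPolynomial.aeval
      (Sum.elim (fun j => algebraMap ℝ (RatFn (Fin d)) (a j)) var) (q v) =
      MvPolynomial.aeval (var : Fin d → RatFn (Fin d)) (affForm P v) := fun v => by
    rw [aeval_affForm, hsupp]
    simp only [q, map_add, map_sum, map_mul, MvPolynomial.aeval_X, MvPolynomial.aeval_C,
      Sum.elim_inl, Sum.elim_inr]
  rw [hq, subst_triangulationSum _ _ _ fun S hS v hv => by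
    rw [hφ]; exact aeval_var_affForm_ne_zero P (hT.ne_zero hS hv)]
  simp only [hφ]
  exact (dualVolumeFn_eq hP hintP (hT.isTiling hsum) hlin).symm

lemma interior_sum_interval {ι : Type*} [Fintype ι] {q : ι → EuclideanSpace ℝ (Fin d)} {a : ι → ℝ}
    (ha : ∀ j, 0 < a j) (hint : (interior (∑ j, a j • interval (q j))).Nonempty) :
    (interior (∑ j, interval (q j))).Nonempty := by
  -- `M` bounds every weight, so the weighted sum lies in `M` times the unweighted one; the summand
  -- 1 keeps `M` positive when there are no zones.
  set M : ℝ := 1 + ∑ j, a j with hM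
  have hM0 : 0 < M := by
    have : 0 ≤ ∑ j, a j := Finset.sum_nonneg fun j _ => (ha j).le
    linarith
  have hsub : ∑ j, a j • interval (q j) ⊆ M • ∑ j, interval (q j) := by
    rw [Finset.smul_sum]
    refine Set.finsetSum_subset_finsetSum _ _ _ fun j hj => ?_
    rintro _ ⟨y, hy, rfl⟩
    obtain ⟨c, h1, h2, rfl⟩ := mem_interval.1 hy
    have haM : a j ≤ M := by
      have := Finset.single_le_sum (fun j _ => (ha j).le) hj
      linarith
    have h3 : a j / M ≤ 1 := (div_le_one hM0).2 haM
    have h4 : 0 < a j / M := div_pos (ha j) hM0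
    refine ⟨(a j / M * c) • q j, mem_interval.2 ⟨_, by nlinarith, by nlinarith, rfl⟩, ?_⟩
    simp only [smul_smul]
    congr 1
    field_simp
  have := hint.mono (interior_mono hsub)
  rw [interior_smul₀ hM0.ne'] at this
  exact this.of_image

lemma supportFn_zonotope {ι : Type*} [Fintype ι] {E : Type*} [NormedAddCommGroup E]
    [InnerProductSpace ℝ E] (q : ι → E) {a : ι → ℝ} (ha : ∀ j, 0 < a j) (v : E) :
    supportFn (∑ j, a j • interval (q j)) v = ∑ j, a j * supportFn (interval (q j)) v := by
  rw [supportFn_sum _ fun j => (isPolytope_interval (q j)).smul (a j)]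
  refine Finset.sum_congr rfl fun j _ => ?_
  rw [supportFn_smul (isPolytope_interval _).isCompact (interval_nonempty _) (ha j)]

lemma projAlong_zonotope {ι : Type*} [Fintype ι] (p : EuclideanSpace ℝ (Fin d))
    (q : ι → EuclideanSpace ℝ (Fin d)) (a : ι → ℝ) :
    projAlong p (∑ j, a j • interval (q j)) =
      ∑ j, a j • interval ((ℝ ∙ p)ᗮ.orthogonalProjectionOnto (q j)) := by
  rw [projAlong, Set.image_finsetSum]
  refine Finset.sum_congr rfl fun j _ => ?_
  rw [Set.image_smul_comm _ _ _ fun y => map_smul _ _ _, interval, interval, ← map_neg]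
  exact congrArg (a j • ·)
    (image_segment ℝ ((ℝ ∙ p)ᗮ.orthogonalProjectionOnto).toLinearMap.toAffineMap (-q j) (q j))

end Zonotopes

end DualVol

/-! ### The theorem -/

open scoped Pointwise
open DualVol
theorem mainTheorem8 {d : ℕ} (P : Set (EuclideanSpace ℝ (Fin d)))
    (p : EuclideanSpace ℝ (Fin d))
    (hP : IsPolytope P) (hfull : (interior P).Nonempty) (hp : p ≠ 0) :
    ∃ Wpos Wneg : RatFn (Fin d),
      -- the pair has the three properties, and is the only such pair
      IsSplitting P p Wpos Wneg ∧
      (∀ Wpos' Wneg' : RatFn (Fin d),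
        IsSplitting P p Wpos' Wneg' → Wpos' = Wpos ∧ Wneg' = Wneg) ∧
      -- `V(x, z) = W_+(z + x p) + W_-(z - x p)` as rational functions of `x` and `z`
      thickenedVolumeFn P p =
        Wpos.subst (fun i => var (some i) + var none * algebraMap ℝ (RatFn (Option (Fin d))) (p i))
          + Wneg.subst
            (fun i => var (some i) - var none * algebraMap ℝ (RatFn (Option (Fin d))) (p i)) ∧
      -- the same identity of rational functions of `z`, for the polytope of each real `x ≥ 0`
      (∀ x : ℝ, 0 ≤ x →
        dualVolumeFn (P + x • interval p) =
          Wpos.subst (fun i => var i + algebraMap ℝ (RatFn (Fin d)) (x * p i))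
            + Wneg.subst (fun i => var i - algebraMap ℝ (RatFn (Fin d)) (x * p i))) ∧
      -- the case of a zonotope with zones `q_j` (scaled by `a_j`): deletion, contraction, recursion
      (∀ (r : ℕ) (q : Fin r → EuclideanSpace ℝ (Fin d)) (a : Fin r → ℝ), (∀ j, 0 < a j) →
        P = ∑ j, a j • interval (q j) →
        Wpos + Wneg =
          (dualMixedVolumeFn fun j => interval (q j)).subst
            (Sum.elim (fun j => algebraMap ℝ (RatFn (Fin d)) (a j)) var) ∧
        projAlong p P =
          ∑ j, a j • interval ((ℝ ∙ p)ᗮ.orthogonalProjectionOnto (q j)) ∧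
        ∀ x : ℝ, 0 < x →
          (dualMixedVolumeFn fun j : Option (Fin r) => j.elim (interval p) fun j => interval (q j)).subst
              (Sum.elim (fun j => algebraMap ℝ (RatFn (Fin d)) (j.elim x a)) var) =
            Wpos.subst (fun i => var i + algebraMap ℝ (RatFn (Fin d)) (x * p i))
              + Wneg.subst (fun i => var i - algebraMap ℝ (RatFn (Fin d)) (x * p i))) := by
  have hQ := hP.add (isPolytope_interval p)
  have hintQ : (interior (P + interval p)).Nonempty := by
    have := interior_add_smul_interval hfull 1 p
    rwa [one_smul] at this
  -- This is the triangulation that defines `thickenedVolumeFn`, so the identity in `(x, z)` needs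
  -- no comparison of tilings; the other dual volume functions are expressed through it by
  -- independence.
  obtain ⟨T, hT, hvol⟩ := exists_fanVolume_eq (L := RatFn (Option (Fin d))) absDet hQ hintQ
  have htil := hT.isTiling hQ
  have hsub := hT.subordinate' hQ
  have hT0 : ∀ S ∈ T, ∀ v ∈ S, v ≠ 0 := fun S hS v hv => hT.ne_zero hS hv
  have hsplit : ∀ {L : Type} [Field L] [Algebra ℝ L] (u : EuclideanSpace ℝ (Fin d) → L),
      triangulationSum absDet (half T p) u + triangulationSum absDet (half T (-p)) u =
        triangulationSum absDet T u :=
    fun u => triangulationSum_half_add absDet htil hp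
      (fun S hS => inner_sign_of_subordinate hsub hS) u
  have hTneg : IsTriangulation (normalFan (P + interval (-p))) T := by rwa [interval_neg]
  have hlin : ∀ x : ℝ, 0 ≤ x → ConewiseLinear T (supportFn (P + x • interval p)) := by
    intro x hx
    have : supportFn (P + x • interval p) =
        fun v => supportFn P v + x * supportFn (interval p) v :=
      funext fun v => by rw [supportFn_add_smul_interval hP hx, supportFn_interval]
    rw [this]
    exact hsub.add_left.conewiseLinear.add (hsub.add_right.conewiseLinear.const_mul x)
  have hreal : ∀ x : ℝ, 0 ≤ x →
      dualVolumeFn (P + x • interval p) =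
        (halfVolume P T p).subst (fun i => var i + algebraMap ℝ (RatFn (Fin d)) (x * p i)) +
          (halfVolume P T (-p)).subst
            (fun i => var i - algebraMap ℝ (RatFn (Fin d)) (x * p i)) := by
    intro x hx
    -- The negative half is the positive half for `-p`, and the interval is the same for both.
    have hneg := halfVolume_translate hP hx (-p) hT0
    simp only [PiLp.neg_apply, mul_neg, map_neg, ← sub_eq_add_neg, interval_neg] at hneg
    rw [halfVolume_translate hP hx p hT0, hneg, hsplit]
    exact dualVolumeFn_eq (hP.add ((isPolytope_interval p).smul x))
      (interior_add_smul_interval hfull x p) htil (hlin x hx)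
  have hadd : halfVolume P T p + halfVolume P T (-p) = dualVolumeFn P := by
    rw [halfVolume, halfVolume, hsplit,
      dualVolumeFn_eq hP hfull htil hsub.add_left.conewiseLinear]
  have hH := isPolytope_projAlong hP p
  have hlim : ∀ c : ℝ, c * c = 1 → ∀ q, q = c • p →
      ∀ z₀ : ((ℝ ∙ p)ᗮ : Submodule ℝ (EuclideanSpace ℝ (Fin d))),
      (∀ v ∈ rayGens (normalFan (projAlong p P)), supportFn (projAlong p P - {z₀}) v ≠ 0) →
      Filter.Tendsto (fun t : ℝ => t * (halfVolume P T q).subst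
        (fun i => (z₀ : EuclideanSpace ℝ (Fin d)) i + t * p i)) Filter.atTop
        (nhds (c * (dualVolume (absDetPerp p) (projAlong p P - {z₀}) / ‖p‖ ^ 2))) := by
    intro c hc q hq z₀ hz₀
    rw [dualVolume_projAlong hP hfull hp (by rintro rfl; simp at hc) hq hT z₀ hz₀]
    refine tendsto_halfVolume hp hc hq htil z₀ fun S hS v hv hv0 => ?_
    have := hz₀ ⟨v, mem_perp_iff.2 hv0⟩ (mem_rayGens_projAlong hP (hT.gens S hS hv))
    rwa [supportFn_sub_singleton hH.isCompact hH.nonempty, supportFn_projAlong hP] at this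
  have hspl : IsSplitting P p (halfVolume P T p) (halfVolume P T (-p)) := by
    refine ⟨hadd, exists_halfVolume_eq hP hT, ?_, fun z₀ hz₀ => ?_, fun z₀ hz₀ => ?_⟩
    · have := exists_halfVolume_eq hP hTneg
      rwa [Bpos_neg, Bzero_neg, Dnew_neg] at this
    · have := hlim 1 (by norm_num) p (one_smul ℝ p).symm z₀ hz₀
      rwa [one_mul] at this
    · have := hlim (-1) (by norm_num) (-p) (by simp) z₀ hz₀
      rwa [neg_one_mul] at this
  refine ⟨halfVolume P T p, halfVolume P T (-p), hspl,
    fun Wpos' Wneg' h => hspl.unique hP hfull h, ?_, hreal, ?_⟩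
  · have hneg := halfVolume_thickened (P := P) hT0 (-p)
    simp only [PiLp.neg_apply, mul_neg, map_neg, ← sub_eq_add_neg, interval_neg] at hneg
    rw [halfVolume_thickened hT0 p, hneg, hsplit, thickenedVolumeFn, shiftedVolume, hvol]
  · rintro r q a ha hPq
    refine ⟨?_, by rw [hPq, projAlong_zonotope], fun x hx => ?_⟩
    · rw [hadd, dualMixedVolumeFn_subst (fun j => isPolytope_interval (q j))
        (interior_sum_interval ha (hPq ▸ hfull)) a hP hfull fun v => by
          rw [hPq, supportFn_zonotope q ha]]
    · have hfun : (fun j : Option (Fin r) => j.elim (interval p) fun j => interval (q j)) =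
          fun j => interval (j.elim p q) := by
        funext j; cases j <;> rfl
      have ha' : ∀ j : Option (Fin r), 0 < j.elim x a := fun j => by
        cases j
        · exact hx
        · exact ha _
      -- The thickened zonotope is again a zonotope, with the extra zone `p` indexed by `none`.
      have hsum : P + x • interval p =
          ∑ j : Option (Fin r), j.elim x a • interval (j.elim p q) := by
        rw [Fintype.sum_option, hPq, add_comm]; rfl
      have hfull' := interior_add_smul_interval hfull x p
      rw [← hreal x hx.le, hfun, dualMixedVolumeFn_subst (fun j => isPolytope_interval _)
        (interior_sum_interval ha' (hsum ▸ hfull')) _ (hP.add ((isPolytope_interval p).smul x))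
        hfull' fun v => by rw [hsum, supportFn_zonotope _ ha']]
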